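/- **Setting.** Let $d\ge 1$, let the context space be the unit sphere $\mathcal X=\mathbb S^{d-1}\subset\mathbb R^d$ with contexts uniformly distributed, and let the action set be $\mathcal A=[-1,1]$ with metric $|a-a'|$ and uniform base measure $\nu$. Let $\Pi$ be a finite set of linear policies $\pi_w:x\mapsto\langle w,x\rangle$, $w\in\mathbb S^{d-1}$, and let $\pi_{w^\star}\in\Pi$. In each round $t$ nature draws an independent pair $(x_t,\ell_t)$, $x_t$ uniform on $\mathbb S^{d-1}$ and $\ell_t:\mathcal A\to[0,1]$ a random loss function with $\mathbb E[\ell_t(a)\mid x_t=x]=f(a-\langle w^\star,x\rangle)$ for all $x,a$; the learner sees $x_t$, chooses $a_t$, and suffers and observes $\ell_t(a_t)$. Here $f:\mathbb R\to\mathbb R$ is $L$-Lipschitz with $L\ge1$ and $f(z)-f(0)\ge L_0|z|$ for all $z\in\mathbb R$, where $L_0>0$. Let $\lambda_0(\pi)=\mathbb E[\ell(\pi(x))]$, $\Pi_{0,\epsilon}=\{\pi\in\Pi:\lambda_0(\pi)\le\min_{\Pi}\lambda_0+\epsilon\}$, $M_0(\epsilon,\delta)=\mathbb E_x[\mathcal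 N_\delta(\{\pi(x):\pi\in\Pi_{0,\epsilon}\})]$, where $\mathcal N_\delta(S)$ is the maximal number of points of $S$ with pairwise distances at least $\delta$, and $\psi_L(\epsilon_0)=\sup_{\epsilon\ge\epsilon_0}M_0(12L\epsilon,\epsilon)/\epsilon$. Let $\mathrm{Regret}(T,\Pi)=\mathbb E[\sum_{t=1}^T\ell_t(a_t)]-T\min_{\pi\in\Pi}\lambda_0(\pi)$. **Algorithm** SmoothPolicyElimination.L (parameters $L$, $\Pi$, $T\ge2$ and the law of $x$). Let $K_h(a)(a')=\mathbf 1\{|a-a'|\le h\}/\nu(B_h(a))$, where $B_h(a)=[a-h,a+h]\cap\mathcal A$, $\kappa_h=\sup_{a,a'}K_h(a)(a')$, and $\delta_T=5\lceil\log(T|\Pi|\log_2T)\rceil$. Put $\Pi^{(1)}=\Pi$. In epoch $m=1,2,\dots$ let $h_m=2^{-m}$, $r_m=L2^{-m}$, $\mu_m=\min\{1/2,r_m\}$, $V_m=\mathbb E_x\,\nu(\bigcup_{\pi\in\Pi^{(m)}}B_{h_m}(\pi(x)))$, $\tilde n_m=\lceil320\,\kappa_{h_m}V_m/r_m^2\rceil$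 and $n_m=\tilde n_m\delta_T$. Choose a distribution $Q_m$ on $\Pi^{(m)}$ minimizing $\max_{\pi\in\Pi^{(m)}}\mathbb E_x\mathbb E_{a\sim K_{h_m}(\pi(x))}[1/q_m(a\mid x)]$, where $q_m(a\mid x)=\mu_m+(1-\mu_m)\sum_{\pi}Q_m(\pi)K_{h_m}(\pi(x))(a)$. For $n_m$ rounds (stopping after $T$ rounds in all) draw $a_t$ with $\nu$-density $q_m(\cdot\mid x_t)$. Split the epoch into $\delta_T$ consecutive batches of $\tilde n_m$ rounds; let $\hat L_m(\pi)$ be the median over the batches of the batch averages of $K_{h_m}(\pi(x_t))(a_t)\,\ell_t(a_t)/q_m(a_t\mid x_t)$, and set $\Pi^{(m+1)}=\{\pi\in\Pi^{(m)}:\hat L_m(\pi)\le\min_{\pi'\in\Pi^{(m)}}\hat L_m(\pi')+3r_m\}$. **Proposition.** There are universal constants $C>0$ and $p\in\mathbb N$ such that, for every instance as above: 1. $M_0(L\epsilon,\epsilon)\le C\,\frac{L}{L_0}\sqrt d$ for all $\epsilon>0$; 2. $\psi_L(\epsilon)\le C\,\frac{L}{L_0\,\epsilon}\sqrt d$ for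 all $\epsilon>0$; 3. the minimizers $Q_m$ exist, and for every choice of them and every $T\ge2$, SmoothPolicyElimination.L satisfies $$\mathrm{Regret}(T,\Pi)\le C(\log T)^p\sqrt{T\,\sqrt d\,\tfrac{L}{L_0}\,\max\{1,\log|\Pi|\}}.$$ -/

import Mathlib

open MeasureTheory ProbabilityTheory
open scoped ENNReal

noncomputable section

namespace SmoothedBandit

/-- The `δ`-packing number of a subset `s` of a metric space: the largest cardinality of a finite
set of points of `s` whose mutual distances are all at least `δ`. -/
def packingNumber {A : Type*} [PseudoMetricSpace A] (δ : ℝ) (s : Set A) : ℝ≥0∞ :=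
  ⨆ (F : Finset A) (_ : (F : Set A) ⊆ s)
    (_ : (F : Set A).Pairwise fun a b => δ ≤ dist a b), (F.card : ℝ≥0∞)

/-- The median of finitely many reals (the mean of the two middle ones if their number is even). -/
def median {k : ℕ} (v : Fin k → ℝ) : ℝ :=
  if hk : 0 < k then
    (v (Tuple.sort v ⟨(k - 1) / 2, by omega⟩) + v (Tuple.sort v ⟨k / 2, by omega⟩)) / 2
  else 0

/-- What the learner knows of a contextual bandit problem: the marginal distribution of the
contexts, the base measure on the actions, and the finite policy set, whose members are the
maps `policy i` for `i ∈ policies`. -/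
structure Setting (X A ι : Type*) [MeasurableSpace X] [MeasurableSpace A] where
  ctxLaw : Measure X
  base : Measure A
  policy : ι → X → A
  policies : Finset ι

/-- A stochastic contextual bandit problem. A context/loss pair is drawn by drawing
`x ∼ ctxLaw`, then `z ∼ lossLaw x`; the loss function is `loss z`. -/
structure ContextualBandit (X A ι Z : Type*) [MeasurableSpace X] [MeasurableSpace A]
    [MeasurableSpace Z] extends Setting X A ι where
  lossLaw : Kernel X Z
  loss : Z → A → ℝ

/-- One observation of the learner: the context, the action it took, and the loss it suffered. -/
abbrev Observation (X A : Type*) : Type _ := X × A × ℝ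

/-- A randomized learner: the distribution of the next action, given the past observations
and the present context. -/
abbrev Learner (X A : Type*) [MeasurableSpace A] : Type _ :=
  List (Observation X A) → X → Measure A

section Setting

variable {X A ι : Type*} [MeasurableSpace X] [PseudoMetricSpace A] [MeasurableSpace A]

/-- The rectangular kernel `K_h(a)`, as a density in `a'` with respect to the base measure. -/
def kernelDensity (D : Setting X A ι) (h : ℝ) (a a' : A) : ℝ :=
  open Classical in
  if dist a a' ≤ h then (D.base.real (Metric.closedBall a h))⁻¹ else 0

/-- `κ_h`, the supremum of the rectangular kernel. -/
def kernelSup (D : Setting X A ι) (h : ℝ) : ℝ :=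
  ⨆ p : A × A, kernelDensity D h p.1 p.2

/-- The smoothed action `Smooth_h(a)`; for `h = 0` it is the Dirac mass at `a`. -/
def smooth (D : Setting X A ι) (h : ℝ) (a : A) : Measure A :=
  open Classical in
  if h = 0 then Measure.dirac a
  else D.base.withDensity fun a' => ENNReal.ofReal (kernelDensity D h a a')

/-! ### The algorithm `SmoothPolicyElimination.L` -/

/-- The bandwidth `h_m` of epoch `m`. -/
def bandwidth (m : ℕ) : ℝ := 1 / 2 ^ m

/-- The radius `r_m` of epoch `m`. -/
def radius (L : ℝ) (m : ℕ) : ℝ := L * (1 / 2 ^ m)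

/-- The exploration probability `μ_m` of epoch `m`. -/
def exploreProb (L : ℝ) (m : ℕ) : ℝ := min (1 / 2) (radius L m)

/-- The number of batches `δ_T`. -/
def numBatches (D : Setting X A ι) (T : ℕ) : ℕ :=
  5 * ⌈Real.log ((T : ℝ) * (D.policies.card : ℝ) * Real.logb 2 (T : ℝ))⌉₊

/-- The characteristic volume of the policy set `S` at bandwidth `h`. -/
def charVolume (D : Setting X A ι) (S : Finset ι) (h : ℝ) : ℝ :=
  ∫ x, D.base.real (⋃ i ∈ S, Metric.closedBall (D.policy i x) h) ∂D.ctxLaw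

/-- The batch size of epoch `m` with active policy set `S`, rounded up to an integer. -/
def batchSize (D : Setting X A ι) (L : ℝ) (m : ℕ) (S : Finset ι) : ℕ :=
  ⌈320 * kernelSup D (bandwidth m) * charVolume D S (bandwidth m) / radius L m ^ 2⌉₊

/-- The length of epoch `m` with active policy set `S`. -/
def epochLength (D : Setting X A ι) (L : ℝ) (T m : ℕ) (S : Finset ι) : ℕ :=
  batchSize D L m S * numBatches D T

/-- The action density `q_m(a ∣ x)` (with respect to the base measure) in epoch `m` with active
policy set `S`, for the distribution `Q` over `S`. -/
def actionDensity (D : Setting X A ι) (L : ℝ) (m : ℕ) (S : Finset ι) (Q : ι → ℝ) (x : X)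
    (a : A) : ℝ :=
  exploreProb L m +
    (1 - exploreProb L m) * ∑ i ∈ S, Q i * kernelDensity D (bandwidth m) (D.policy i x) a

/-- The objective of the optimization problem of epoch `m`: the maximum over `i ∈ S` of
`E_x E_{a ∼ Smooth_h(π_i(x))} [1 / q_m(a ∣ x)]`, as a function of `Q`. -/
def objective (D : Setting X A ι) (L : ℝ) (m : ℕ) (S : Finset ι) (Q : ι → ℝ) : ℝ :=
  ⨆ i : {i // i ∈ S}, ∫ x, ∫ a, 1 / actionDensity D L m S Q x a
    ∂(smooth D (bandwidth m) (D.policy i x)) ∂D.ctxLaw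

/-- The probability distributions over the policy set `S`. -/
def distributionsOn (S : Finset ι) : Set (ι → ℝ) :=
  {Q | (∀ i ∈ S, 0 ≤ Q i) ∧ ∑ i ∈ S, Q i = 1}

/-- `Q m S` solves the optimization problem of every epoch `m ≥ 1`, whatever nonempty policy
set `S` is active in it. -/
def IsSolver (D : Setting X A ι) (L : ℝ) (Q : ℕ → Finset ι → ι → ℝ) : Prop :=
  ∀ m : ℕ, 1 ≤ m → ∀ S : Finset ι, S ⊆ D.policies → S.Nonempty →
    Q m S ∈ distributionsOn S ∧ IsMinOn (objective D L m S) (distributionsOn S) (Q m S)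

/-- The importance weighted loss estimate of policy `i` from one observation of epoch `m`. -/
def lossEstimate (D : Setting X A ι) (L : ℝ) (m : ℕ) (S : Finset ι) (Q : ι → ℝ) (i : ι)
    (o : Observation X A) : ℝ :=
  kernelDensity D (bandwidth m) (D.policy i o.1) o.2.1 * o.2.2 /
    actionDensity D L m S Q o.1 o.2.1

/-- The median-of-means loss estimate `L̂_m(π_i)` from the data of the whole epoch `m`. -/
def medianEstimate (D : Setting X A ι) (L : ℝ) (T m : ℕ) (S : Finset ι) (Q : ι → ℝ)
    (data : List (Observation X A)) (i : ι) : ℝ :=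
  median fun b : Fin (numBatches D T) =>
    (((data.drop (b * batchSize D L m S)).take (batchSize D L m S)).map
      (lossEstimate D L m S Q i)).sum / (batchSize D L m S : ℝ)

/-- The policies that survive epoch `m`: those whose estimated loss exceeds the least estimated
loss by at most `3 r_m`. -/
def eliminate (D : Setting X A ι) (L : ℝ) (T m : ℕ) (S : Finset ι) (Q : ι → ℝ)
    (data : List (Observation X A)) : Finset ι :=
  open Classical in
  S.filter fun i => ∀ j ∈ S, medianEstimate D L T m S Q data i ≤
    medianEstimate D L T m S Q data j + 3 * radius L m

/-- The memory of the algorithm: the number of the epoch, the policies active in it, and the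
observations made in it so far. -/
structure Memory (X A ι : Type*) where
  epoch : ℕ
  active : Finset ι
  data : List (Observation X A)

/-- The memory after one more round; when the epoch is complete, policies are eliminated and the
next epoch begins. -/
def updateMemory (D : Setting X A ι) (L : ℝ) (T : ℕ) (Q : ℕ → Finset ι → ι → ℝ)
    (s : Memory X A ι) (o : Observation X A) : Memory X A ι :=
  if epochLength D L T s.epoch s.active ≤ (s.data ++ [o]).length then
    ⟨s.epoch + 1,
      eliminate D L T s.epoch s.active (Q s.epoch s.active) (s.data ++ [o]), []⟩
  else ⟨s.epoch, s.active, s.data ++ [o]⟩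

/-- The memory after the rounds in `hist`, starting in epoch `1` with all policies active. -/
def memory (D : Setting X A ι) (L : ℝ) (T : ℕ) (Q : ℕ → Finset ι → ι → ℝ)
    (hist : List (Observation X A)) : Memory X A ι :=
  hist.foldl (updateMemory D L T Q) ⟨1, D.policies, []⟩

/-- `SmoothPolicyElimination.L` with parameter `L` and horizon `T`, where `Q` supplies the
solutions of the optimization problems. -/
def smoothPolicyEliminationL (D : Setting X A ι) (L : ℝ) (T : ℕ)
    (Q : ℕ → Finset ι → ι → ℝ) : Learner X A := fun hist x =>
  let s := memory D L T Q hist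
  D.base.withDensity fun a => ENNReal.ofReal
    (actionDensity D L s.epoch s.active (Q s.epoch s.active) x a)

end Setting

section ContextualBandit

variable {X A ι Z : Type*} [MeasurableSpace X] [PseudoMetricSpace A] [MeasurableSpace A]
  [MeasurableSpace Z]

/-- The smoothed loss `λ_h(π_i)`. -/
def smoothedLoss (B : ContextualBandit X A ι Z) (h : ℝ) (i : ι) : ℝ :=
  ∫ x, ∫ z, ∫ a, B.loss z a ∂(smooth B.toSetting h (B.policy i x)) ∂(B.lossLaw x) ∂B.ctxLaw

/-- The benchmark: the least smoothed loss of a policy; `h = 0` gives the benchmark of the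
policy set itself. -/
def bench (B : ContextualBandit X A ι Z) (h : ℝ) : ℝ :=
  sInf (smoothedLoss B h '' (B.policies : Set ι))

/-- The version space `Π_{h,ε}` of `ε`-optimal policies. -/
def versionSpace (B : ContextualBandit X A ι Z) (h ε : ℝ) : Set ι :=
  {i | i ∈ B.policies ∧ smoothedLoss B h i ≤ bench B h + ε}

/-- `M_h(ε, δ)`: the expected `δ`-packing number of the set of actions chosen by the `ε`-optimal
policies. -/
def expectedPacking (B : ContextualBandit X A ι Z) (h ε δ : ℝ) : ℝ≥0∞ :=
  ∫⁻ x, packingNumber δ ((fun i => B.policy i x) '' versionSpace B h ε) ∂B.ctxLaw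

/-- The policy zooming coefficient `ψ_L(ε₀) = sup_{ε ≥ ε₀} M_0(12 L ε, ε) / ε`. -/
def zoomingCoeff (B : ContextualBandit X A ι Z) (L ε₀ : ℝ) : ℝ≥0∞ :=
  ⨆ (ε : ℝ) (_ : ε₀ ≤ ε), expectedPacking B 0 (12 * L * ε) ε / ENNReal.ofReal ε

/-- The expected total loss of a learner over the next `n` rounds, given the observations so far.
In each round nature draws the context and the loss function, the learner sees the context and
draws an action, then suffers and observes the loss of that action. -/
def expectedLoss (B : ContextualBandit X A ι Z) (alg : Learner X A) :
    ℕ → List (Observation X A) → ℝ≥0∞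
  | 0, _ => 0
  | n + 1, hist =>
    ∫⁻ x, ∫⁻ z, ∫⁻ a,
      (ENNReal.ofReal (B.loss z a) + expectedLoss B alg n (hist ++ [(x, a, B.loss z a)]))
        ∂(alg hist x) ∂(B.lossLaw x) ∂B.ctxLaw

/-- The regret over `T` rounds relative to the (unsmoothed) policy set. -/
def regret (B : ContextualBandit X A ι Z) (alg : Learner X A) (T : ℕ) : EReal :=
  (expectedLoss B alg T [] : EReal) - (((T : ℝ) * bench B 0 : ℝ) : EReal)

end ContextualBandit

/-! ### Linear policies on the sphere -/

/-- The unit sphere of `ℝ^d`. -/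
abbrev Sphere (d : ℕ) : Type := Metric.sphere (0 : EuclideanSpace ℝ (Fin d)) 1

/-- The action set `[-1, 1]`. -/
abbrev Action : Type := Set.Icc (-1 : ℝ) 1

/-- The uniform distribution on the unit sphere: normalized surface measure. -/
def uniformSphere (d : ℕ) : Measure (Sphere d) :=
  ((volume : Measure (EuclideanSpace ℝ (Fin d))).toSphere Set.univ)⁻¹ •
    (volume : Measure (EuclideanSpace ℝ (Fin d))).toSphere

/-- The uniform distribution on `[-1, 1]`. -/
def uniformAction : Measure Action :=
  (2 : ℝ≥0∞)⁻¹ • (volume : Measure ℝ).comap Subtype.val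

/-- The linear policy `π_w : x ↦ ⟨w, x⟩`. -/
def linearPolicy {d : ℕ} (w x : Sphere d) : Action :=
  ⟨inner ℝ (w : EuclideanSpace ℝ (Fin d)) (x : EuclideanSpace ℝ (Fin d)), by
    have h := abs_real_inner_le_norm (w : EuclideanSpace ℝ (Fin d))
      (x : EuclideanSpace ℝ (Fin d))
    rw [norm_eq_of_mem_sphere w, norm_eq_of_mem_sphere x, one_mul] at h
    exact abs_le.mp h⟩

/-- The bandit problem with contexts uniform on the sphere, actions in `[-1, 1]`, the policy set
`{π_w : w ∈ W}`, and the given conditional distribution of the loss function. -/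
def sphereBandit {d : ℕ} {Z : Type*} [MeasurableSpace Z] (W : Finset (Sphere d))
    (lossLaw : Kernel (Sphere d) Z) (loss : Z → Action → ℝ) :
    ContextualBandit (Sphere d) Action (Sphere d) Z where
  ctxLaw := uniformSphere d
  base := uniformAction
  policy := linearPolicy
  policies := W
  lossLaw := lossLaw
  loss := loss

end SmoothedBandit

end

open SmoothedBandit

/-! Excess loss controls distance. Put z = ⟨w - w⋆, x⟩ in the growth condition and average over the
sphere, where E|⟨v, x⟩| ≥ ‖v‖ / (2√d): a policy with excess loss ε satisfies ‖w - w⋆‖ ≤ 2ε√d / L₀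
(`IsLinkFunction.dist_le`). By Cauchy–Schwarz the actions of all ε-optimal policies at any context
then lie within that distance of the optimal action. Counting separated points of such an interval
gives the two packing bounds. Measuring it, together with κ_h ≤ 2 / h, gives κ_h V ≤ 50 L√d / L₀ in
every epoch whose active policies are 12 r_m-optimal. The spherical mean is found by integrating
|⟨v, y⟩| against a Gaussian weight both in polar and in orthonormal coordinates.

For the regret, the importance weighted estimate has the smoothed loss as its mean and second moment
at most κ_h E[k_i / q]. Weights that maximize E log q satisfy a first-order condition forcing E[k_i
/ q] ≤ 2 V for every i (`exists_integral_div_mixDensity_le`), so the minimizers Q_m do too. With the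
prescribed batch sizes the medians of means are then within r_m / 2 of the smoothed losses, up to a
failure term 1 / T² per epoch. Smoothing costs at most L h_m = r_m, so elimination keeps w⋆ and
improves 12 r_m-optimality to 12 r_{m+1}-optimality (`IsGood.eliminate`). A round of epoch m costs
at most 14 r_m, the epoch lasts about κ_h V δ_T / r_m² rounds, and its regret is of order (√d / L₀)
δ_T 2^m. Summing this geometric series up to a balancing epoch and charging 14 r for the remaining
rounds gives the square root.

Concentration is expressed through iterated integrals. A potential, the product over batches of 1 +
3 s² with s the normalized batch sum, is at least 2^k when a median of k batches fails, and its
expectation factors by independence. It also supplies a measurable majorant for the loss after the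
epoch, so measurability of the elimination step never enters. -/

noncomputable section

namespace SmoothedBandit

universe u

/-! ### Iterated integrals over lists of independent draws -/

section IteratedIntegral

variable {O : Type u} [MeasurableSpace O]

/-- The integral of a function of the list of the outcomes of `n` independent draws from `P`. -/
def iterLIntegral (P : Measure O) : ℕ → (List O → ℝ≥0∞) → ℝ≥0∞
  | 0, G => G []
  | n + 1, G => ∫⁻ o, iterLIntegral P n (fun l => G (o :: l)) ∂P

/-- A function of lists that depends measurably on the members of the list. -/
def ListMeasurable (G : List O → ℝ≥0∞) : Prop :=
  ∀ (Ω : Type u) [MeasurableSpace Ω] (l : List (Ω → O)), (∀ f ∈ l, Measurable f) →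
    Measurable fun ω => G (l.map (· ω))

variable {P : Measure O}

theorem iterLIntegral_mono_length {n : ℕ} {G H : List O → ℝ≥0∞}
    (h : ∀ l, l.length = n → G l ≤ H l) : iterLIntegral P n G ≤ iterLIntegral P n H := by
  induction n generalizing G H with
  | zero => exact h [] rfl
  | succ n ih => exact lintegral_mono fun o => ih fun l hl => h _ (by simp [hl])

theorem iterLIntegral_congr_length {n : ℕ} {G H : List O → ℝ≥0∞}
    (h : ∀ l, l.length = n → G l = H l) : iterLIntegral P n G = iterLIntegral P n H :=
  le_antisymm (iterLIntegral_mono_length fun l hl => (h l hl).le)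
    (iterLIntegral_mono_length fun l hl => (h l hl).ge)

theorem iterLIntegral_const [IsProbabilityMeasure P] (n : ℕ) (c : ℝ≥0∞) :
    iterLIntegral P n (fun _ => c) = c := by
  induction n with
  | zero => rfl
  | succ n ih => simp [iterLIntegral, ih]

theorem iterLIntegral_const_mul (n : ℕ) {c : ℝ≥0∞} (hc : c ≠ ∞) (G : List O → ℝ≥0∞) :
    iterLIntegral P n (fun l => c * G l) = c * iterLIntegral P n G := by
  induction n generalizing G with
  | zero => rfl
  | succ n ih => simp only [iterLIntegral, ih, lintegral_const_mul' _ _ hc]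

/-- The integrals are nested by definition, so splitting off the first draws requires no
measurability. -/
theorem iterLIntegral_add_length (m n : ℕ) (G : List O → ℝ≥0∞) :
    iterLIntegral P (m + n) G =
      iterLIntegral P m fun l => iterLIntegral P n fun l' => G (l ++ l') := by
  induction m generalizing G with
  | zero => simp [iterLIntegral]
  | succ m ih =>
    rw [Nat.succ_add]
    simp only [iterLIntegral, ih, List.cons_append]

/-- Integrating out one more draw replaces the parameter space Ω by Ω × O; the quantification over
all Ω in `ListMeasurable` is what lets the induction run. -/
theorem ListMeasurable.iterLIntegral_append [SFinite P] {G : List O → ℝ≥0∞}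
    (hG : ListMeasurable G) (n : ℕ) :
    ListMeasurable fun d => iterLIntegral P n fun l => G (d ++ l) := by
  induction n with
  | zero => simpa [iterLIntegral] using hG
  | succ n ih =>
    intro Ω _ l hl
    have h := ih (Ω × O) (l.map (fun f => f ∘ Prod.fst) ++ [Prod.snd]) (by
      intro f hf
      simp only [List.mem_append, List.mem_map, List.mem_singleton] at hf
      rcases hf with ⟨g, hg, rfl⟩ | rfl
      · exact (hl g hg).comp measurable_fst
      · exact measurable_snd)
    have h2 := h.lintegral_prod_right' (ν := P)
    simpa [iterLIntegral, Function.comp_def] using h2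

theorem ListMeasurable.measurable_snoc {G : List O → ℝ≥0∞} (hG : ListMeasurable G)
    (d : List O) : Measurable fun o => G (d ++ [o]) := by
  have h := hG O (d.map (fun c _ => c) ++ [id]) (by
    intro f hf
    simp only [List.mem_append, List.mem_map, List.mem_singleton] at hf
    rcases hf with ⟨g, hg, rfl⟩ | rfl
    · exact measurable_const
    · exact measurable_id)
  simpa [Function.comp_def] using h

theorem ListMeasurable.cons {G : List O → ℝ≥0∞} (hG : ListMeasurable G) (o : O) :
    ListMeasurable fun l => G (o :: l) := by
  intro Ω _ l hl
  have h := hG Ω ((fun _ => o) :: l) (by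
    intro f hf
    rcases List.mem_cons.1 hf with rfl | hf
    · exact measurable_const
    · exact hl f hf)
  simpa using h

theorem ListMeasurable.measurable_iterLIntegral_cons [SFinite P] {G : List O → ℝ≥0∞}
    (hG : ListMeasurable G) (n : ℕ) :
    Measurable fun o => iterLIntegral P n fun l => G (o :: l) := by
  have := (hG.iterLIntegral_append (P := P) n).measurable_snoc []
  simpa using this

/-- Additivity of the lower integral needs only one measurable summand, so `H` is arbitrary. -/
theorem iterLIntegral_add [SFinite P] {G : List O → ℝ≥0∞} (hG : ListMeasurable G) (n : ℕ)
    (H : List O → ℝ≥0∞) :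
    iterLIntegral P n (fun l => G l + H l) = iterLIntegral P n G + iterLIntegral P n H := by
  induction n generalizing G H with
  | zero => rfl
  | succ n ih =>
    simp only [iterLIntegral]
    rw [← lintegral_add_left (hG.measurable_iterLIntegral_cons n)]
    exact lintegral_congr fun o => ih (hG.cons o) _

theorem iterLIntegral_sum [SFinite P] {κ : Type*} (s : Finset κ) {G : κ → List O → ℝ≥0∞}
    (hG : ∀ i ∈ s, ListMeasurable (G i)) (n : ℕ) :
    iterLIntegral P n (fun l => ∑ i ∈ s, G i l) = ∑ i ∈ s, iterLIntegral P n (G i) := by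
  classical
  induction s using Finset.induction_on with
  | empty => simpa using iterLIntegral_const_mul (P := P) n (c := 0) (by simp) (fun _ => 0)
  | insert i s hi ih =>
    simp only [Finset.sum_insert hi]
    rw [iterLIntegral_add (hG i (Finset.mem_insert_self _ _)),
      ih fun j hj => hG j (Finset.mem_insert_of_mem hj)]

theorem listMeasurable_const (c : ℝ≥0∞) : ListMeasurable fun _ : List O => c :=
  fun _ _ _ _ => measurable_const

theorem ListMeasurable.add {G H : List O → ℝ≥0∞} (hG : ListMeasurable G)
    (hH : ListMeasurable H) : ListMeasurable fun l => G l + H l :=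
  fun Ω _ l hl => (hG Ω l hl).add (hH Ω l hl)

theorem ListMeasurable.const_mul {G : List O → ℝ≥0∞} (hG : ListMeasurable G) (c : ℝ≥0∞) :
    ListMeasurable fun l => c * G l :=
  fun Ω _ l hl => (hG Ω l hl).const_mul c

theorem ListMeasurable.sum {κ : Type*} {s : Finset κ} {G : κ → List O → ℝ≥0∞}
    (hG : ∀ i ∈ s, ListMeasurable (G i)) : ListMeasurable fun l => ∑ i ∈ s, G i l :=
  fun Ω _ l hl => Finset.measurable_sum s fun i hi => hG i hi Ω l hl

end IteratedIntegral

/-! ### Robustness of the median -/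

section Median

/-- If the median lies too high, so do the upper middle value and everything sorted after it; if too
low, the lower middle value and everything before it. Either family contains at least half of the
entries. -/
theorem card_le_two_mul_of_lt_abs_median_sub {k : ℕ} {v : Fin k → ℝ} {c r : ℝ} (hk : 0 < k)
    (h : r < |median v - c|) :
    k ≤ 2 * (Finset.univ.filter fun b => r < |v b - c|).card := by
  have hmono : Monotone (v ∘ Tuple.sort v) := Tuple.monotone_sort v
  set i : Fin k := ⟨(k - 1) / 2, by omega⟩ with hi
  set j : Fin k := ⟨k / 2, by omega⟩ with hj
  have hij : v (Tuple.sort v i) ≤ v (Tuple.sort v j) :=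
    hmono (Fin.mk_le_mk.2 (by omega))
  have hmed : median v = (v (Tuple.sort v i) + v (Tuple.sort v j)) / 2 := by
    rw [median, dif_pos hk]
  rw [hmed, lt_abs] at h
  rcases h with h | h
  · have hsub : (Finset.Ici j).map (Tuple.sort v).toEmbedding ⊆
        Finset.univ.filter fun b => r < |v b - c| := by
      intro b hb
      simp only [Finset.mem_map, Finset.mem_Ici] at hb
      obtain ⟨a, ha, rfl⟩ := hb
      have h1 : v (Tuple.sort v j) ≤ v (Tuple.sort v a) := hmono ha
      simp only [Finset.mem_filter, Finset.mem_univ, true_and, Equiv.coe_toEmbedding]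
      exact lt_of_lt_of_le (by linarith) (le_abs_self _)
    have := Finset.card_le_card hsub
    rw [Finset.card_map, Fin.card_Ici] at this
    simp only [hj] at this
    omega
  · have hsub : (Finset.Iic i).map (Tuple.sort v).toEmbedding ⊆
        Finset.univ.filter fun b => r < |v b - c| := by
      intro b hb
      simp only [Finset.mem_map, Finset.mem_Iic] at hb
      obtain ⟨a, ha, rfl⟩ := hb
      have h1 : v (Tuple.sort v a) ≤ v (Tuple.sort v i) := hmono ha
      simp only [Finset.mem_filter, Finset.mem_univ, true_and, Equiv.coe_toEmbedding]
      exact lt_of_lt_of_le (by linarith) (neg_le_abs _)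
    have := Finset.card_le_card hsub
    rw [Finset.card_map, Fin.card_Iic] at this
    simp only [hi] at this
    omega

end Median

/-! ### Concentration of batch sums through a product potential -/

section Concentration

variable {O : Type u}

/-- The sum of `y` over the `b`-th batch of `n` members of a list. -/
def batchSum (y : O → ℝ) (n b : ℕ) (l : List O) : ℝ :=
  (((l.drop (b * n)).take n).map y).sum

/-- The product over the first `k` batches of `1 + 3 s²`, where `s` is the batch sum of `y`. -/
def batchPotential (y : O → ℝ) (k n : ℕ) (l : List O) : ℝ≥0∞ :=
  ∏ b ∈ Finset.range k, ENNReal.ofReal (1 + 3 * batchSum y n b l ^ 2)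

/-- Every factor is at least 1, and a bad batch contributes at least 1 + 3 = 4; half of the batches
being bad yields 4^(k/2) = 2^k. -/
theorem two_pow_le_batchPotential {y : O → ℝ} {k n : ℕ} {l : List O}
    (h : k ≤ 2 * (Finset.univ.filter fun b : Fin k => 1 < |batchSum y n b l|).card) :
    2 ^ k ≤ batchPotential y k n l := by
  set s := Finset.univ.filter fun b : Fin k => 1 < |batchSum y n b l| with hs
  have h1 : ∀ b : Fin k, (1 : ℝ≥0∞) ≤ ENNReal.ofReal (1 + 3 * batchSum y n b l ^ 2) := by
    intro b
    rw [ENNReal.one_le_ofReal]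
    nlinarith [sq_nonneg (batchSum y n b l)]
  have h4 : ∀ b ∈ s, (4 : ℝ≥0∞) ≤ ENNReal.ofReal (1 + 3 * batchSum y n b l ^ 2) := by
    intro b hb
    have hb : 1 < |batchSum y n b l| := (Finset.mem_filter.1 hb).2
    have : (4 : ℝ≥0∞) = ENNReal.ofReal 4 := by simp
    rw [this]
    apply ENNReal.ofReal_le_ofReal
    nlinarith [sq_abs (batchSum y n b l), abs_nonneg (batchSum y n b l)]
  calc (2 : ℝ≥0∞) ^ k ≤ 2 ^ (2 * s.card) := pow_le_pow_right₀ (by norm_num) h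
    _ = 4 ^ s.card := by rw [pow_mul]; norm_num
    _ = ∏ b ∈ s, (4 : ℝ≥0∞) := by simp
    _ ≤ ∏ b ∈ s, ENNReal.ofReal (1 + 3 * batchSum y n b l ^ 2) := Finset.prod_le_prod' h4
    _ ≤ ∏ b : Fin k, ENNReal.ofReal (1 + 3 * batchSum y n b l ^ 2) :=
      Finset.prod_le_prod_of_subset_of_one_le' (Finset.subset_univ _) fun b _ _ => h1 b
    _ = batchPotential y k n l :=
      Fin.prod_univ_eq_prod_range (fun b => ENNReal.ofReal (1 + 3 * batchSum y n b l ^ 2)) k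

variable [MeasurableSpace O] {P : Measure O}

theorem listMeasurable_batchPotential {y : O → ℝ} (hy : Measurable y) (k n : ℕ) :
    ListMeasurable (batchPotential y k n) := by
  have hsum : ∀ (Ω : Type u) [MeasurableSpace Ω] (l : List (Ω → O)), (∀ f ∈ l, Measurable f) →
      Measurable fun ω => ((l.map (· ω)).map y).sum := by
    intro Ω _ l hl
    induction l with
    | nil => simp
    | cons f l ih =>
      simp only [List.map_cons, List.sum_cons]
      exact (hy.comp (hl f (by simp))).add (ih fun g hg => hl g (by simp [hg]))
  intro Ω _ l hl
  refine Finset.measurable_prod _ fun b _ => ENNReal.measurable_ofReal.comp ?_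
  refine (Measurable.const_mul (Measurable.pow_const ?_ 2) 3).const_add 1
  have := hsum Ω ((l.drop (b * n)).take n) fun f hf =>
    hl f (List.mem_of_mem_drop (List.mem_of_mem_take hf))
  simpa [batchSum, List.map_take, List.map_drop] using this

/-- The cross term vanishes because `y` is centred. The constant `α` carries the variance of the
draws still to come in the induction below. -/
theorem lintegral_one_add_sq_le [IsProbabilityMeasure P] {y : O → ℝ} (hy : MemLp y 2 P)
    (h0 : ∫ o, y o ∂P = 0) {v : ℝ} (hv : ∫ o, y o ^ 2 ∂P ≤ v) {α : ℝ} (hα : 0 ≤ α) (s : ℝ) :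
    ∫⁻ o, ENNReal.ofReal (1 + 3 * ((s + y o) ^ 2 + α)) ∂P ≤
      ENNReal.ofReal (1 + 3 * (s ^ 2 + v + α)) := by
  have hint := hy.integrable (by norm_num)
  have hint2 := hy.integrable_sq
  have e : ∀ o, 1 + 3 * ((s + y o) ^ 2 + α) = (1 + 3 * (s ^ 2 + α)) + (6 * s) * y o +
    3 * y o ^ 2 := fun o => by ring
  rw [← ofReal_integral_eq_lintegral_ofReal]
  · apply ENNReal.ofReal_le_ofReal
    simp_rw [e]
    rw [integral_add (by fun_prop) (by fun_prop), integral_add (by fun_prop) (by fun_prop),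
      integral_const_mul, integral_const_mul, h0]
    simp
    linarith
  · simp_rw [e]
    fun_prop
  · exact Filter.Eventually.of_forall fun o => by
      have := sq_nonneg (s + y o)
      simp only [Pi.zero_apply]; positivity

theorem iterLIntegral_one_add_sq_le [IsProbabilityMeasure P] {y : O → ℝ} (hy : MemLp y 2 P)
    (h0 : ∫ o, y o ∂P = 0) {v : ℝ} (hv : ∫ o, y o ^ 2 ∂P ≤ v) (n : ℕ) (s : ℝ) :
    iterLIntegral P n (fun l => ENNReal.ofReal (1 + 3 * (s + (l.map y).sum) ^ 2)) ≤
      ENNReal.ofReal (1 + 3 * (s ^ 2 + n * v)) := by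
  have hv0 : 0 ≤ v := (integral_nonneg fun o => sq_nonneg (y o)).trans hv
  induction n generalizing s with
  | zero => simp [iterLIntegral]
  | succ n ih =>
    calc _ ≤ ∫⁻ o, ENNReal.ofReal (1 + 3 * ((s + y o) ^ 2 + n * v)) ∂P := by
          refine lintegral_mono fun o => ?_
          simpa [add_assoc] using ih (s + y o)
      _ ≤ ENNReal.ofReal (1 + 3 * (s ^ 2 + v + n * v)) :=
          lintegral_one_add_sq_le hy h0 hv (by positivity) s
      _ = _ := by congr 1; push_cast; ring

/-- Distinct batches use distinct draws, so the iterated integral of the product is the product of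
the integrals, each controlled by the variance of one batch. -/
theorem iterLIntegral_batchPotential_le [IsProbabilityMeasure P] {y : O → ℝ} (hy : MemLp y 2 P)
    (h0 : ∫ o, y o ∂P = 0) {v : ℝ} (hv : ∫ o, y o ^ 2 ∂P ≤ v) (k n : ℕ) :
    iterLIntegral P (k * n) (batchPotential y k n) ≤ ENNReal.ofReal (1 + 3 * (n * v)) ^ k := by
  induction k with
  | zero => simp [batchPotential, iterLIntegral]
  | succ k ih =>
    have hkey : ∀ l₁ : List O, l₁.length = n → ∀ l₂ : List O,
        batchPotential y (k + 1) n (l₁ ++ l₂) =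
          ENNReal.ofReal (1 + 3 * (0 + (l₁.map y).sum) ^ 2) * batchPotential y k n l₂ := by
      intro l₁ hl l₂
      rw [batchPotential, Finset.prod_range_succ', mul_comm, batchPotential]
      congr 1
      · simp [batchSum, ← hl]
      · refine Finset.prod_congr rfl fun b _ => ?_
        have : (l₁ ++ l₂).drop ((b + 1) * n) = l₂.drop (b * n) := by
          rw [show (b + 1) * n = l₁.length + b * n by rw [hl]; ring, List.drop_append]
          simp
        simp [batchSum, this]
    rw [show (k + 1) * n = n + k * n by ring, iterLIntegral_add_length]
    calc _ = iterLIntegral P n fun l₁ => iterLIntegral P (k * n) (batchPotential y k n) *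
            ENNReal.ofReal (1 + 3 * (0 + (l₁.map y).sum) ^ 2) := by
          refine iterLIntegral_congr_length fun l₁ hl => ?_
          refine Eq.trans ?_ (mul_comm _ _)
          rw [← iterLIntegral_const_mul _ ENNReal.ofReal_ne_top]
          exact iterLIntegral_congr_length fun l₂ _ => hkey l₁ hl l₂
      _ = iterLIntegral P (k * n) (batchPotential y k n) *
            iterLIntegral P n fun l₁ => ENNReal.ofReal (1 + 3 * (0 + (l₁.map y).sum) ^ 2) :=
          iterLIntegral_const_mul _ (ne_top_of_le_ne_top (by simp) ih) _
      _ ≤ ENNReal.ofReal (1 + 3 * (n * v)) ^ k * ENNReal.ofReal (1 + 3 * (n * v)) :=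
          mul_le_mul' ih (by simpa using iterLIntegral_one_add_sq_le hy h0 hv n 0)
      _ = _ := (pow_succ _ _).symm

end Concentration

/-! ### Log-optimal mixtures of densities -/

section Mixture

variable {Ω I : Type*} [Fintype I] {k : I → Ω → ℝ} {μ κ : ℝ} {Q : I → ℝ}

/-- The mixture of the densities `k i` with weights `Q i`, mixed with the constant density `1`
with weight `μ`. -/
def mixDensity (μ : ℝ) (k : I → Ω → ℝ) (Q : I → ℝ) (ω : Ω) : ℝ :=
  μ + (1 - μ) * ∑ i, Q i * k i ω

theorem mixture_nonneg (hk0 : ∀ i ω, 0 ≤ k i ω) (hQ : Q ∈ stdSimplex ℝ I) (ω : Ω) :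
    0 ≤ ∑ i, Q i * k i ω :=
  Finset.sum_nonneg fun i _ => mul_nonneg (hQ.1 i) (hk0 i ω)

theorem mixture_le (hkκ : ∀ i ω, k i ω ≤ κ) (hQ : Q ∈ stdSimplex ℝ I) (ω : Ω) :
    ∑ i, Q i * k i ω ≤ κ :=
  calc ∑ i, Q i * k i ω ≤ ∑ i, Q i * κ :=
        Finset.sum_le_sum fun i _ => mul_le_mul_of_nonneg_left (hkκ i ω) (hQ.1 i)
    _ = κ := by rw [← Finset.sum_mul, hQ.2, one_mul]

theorem le_mixDensity (hμ1 : μ ≤ 1) (hk0 : ∀ i ω, 0 ≤ k i ω) (hQ : Q ∈ stdSimplex ℝ I) (ω : Ω) :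
    μ ≤ mixDensity μ k Q ω :=
  le_add_of_nonneg_right (mul_nonneg (by linarith) (mixture_nonneg hk0 hQ ω))

theorem mixDensity_le (hμ0 : 0 ≤ μ) (hμ1 : μ ≤ 1) (hκ : 0 ≤ κ) (hkκ : ∀ i ω, k i ω ≤ κ)
    (hQ : Q ∈ stdSimplex ℝ I) (ω : Ω) : mixDensity μ k Q ω ≤ 1 + κ := by
  have h := mixture_le hkκ hQ ω
  have : (1 - μ) * ∑ i, Q i * k i ω ≤ (1 - μ) * κ := mul_le_mul_of_nonneg_left h (by linarith)
  rw [mixDensity]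
  nlinarith

theorem continuous_mixDensity (ω : Ω) : Continuous fun Q => mixDensity μ k Q ω := by
  unfold mixDensity
  fun_prop

theorem abs_log_mixDensity_le (hμ0 : 0 < μ) (hμ1 : μ ≤ 1) (hκ : 0 ≤ κ)
    (hk0 : ∀ i ω, 0 ≤ k i ω) (hkκ : ∀ i ω, k i ω ≤ κ) (hQ : Q ∈ stdSimplex ℝ I) (ω : Ω) :
    |Real.log (mixDensity μ k Q ω)| ≤ |Real.log μ| + |Real.log (1 + κ)| := by
  have h1 := le_mixDensity hμ1 hk0 hQ ω
  have h2 := mixDensity_le hμ0.le hμ1 hκ hkκ hQ ω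
  have h3 := Real.log_le_log hμ0 h1
  have h4 := Real.log_le_log (hμ0.trans_le h1) h2
  rw [abs_le]
  constructor
  · linarith [neg_abs_le (Real.log μ), abs_nonneg (Real.log (1 + κ))]
  · linarith [le_abs_self (Real.log (1 + κ)), abs_nonneg (Real.log μ)]

/-- From log(1 + z) ≥ z / (1 + z), where z / (1 + z) - z + 2z² = z²(1 + 2z) / (1 + z) is nonnegative
for z ≥ -1/2. -/
theorem sub_two_mul_sq_le_log {z : ℝ} (hz : |z| ≤ 1 / 2) : z - 2 * z ^ 2 ≤ Real.log (1 + z) := by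
  have hz' := abs_le.1 hz
  have hpos : 0 < 1 + z := by linarith
  have h := Real.one_sub_inv_le_log_of_pos hpos
  refine le_trans ?_ h
  have : 1 - (1 + z)⁻¹ = z / (1 + z) := by field_simp; ring
  rw [this, le_div_iff₀ hpos]
  nlinarith [sq_nonneg z]

variable [MeasurableSpace Ω]

theorem measurable_mixDensity (hk : ∀ i, Measurable (k i)) : Measurable (mixDensity μ k Q) := by
  unfold mixDensity
  fun_prop

variable {ρ : Measure Ω} [IsProbabilityMeasure ρ]

theorem integrable_div_mixDensity (hμ0 : 0 < μ) (hμ1 : μ ≤ 1) (hk : ∀ i, Measurable (k i))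
    (hk0 : ∀ i ω, 0 ≤ k i ω) (hQ : Q ∈ stdSimplex ℝ I) {g : Ω → ℝ} (hg : Measurable g) {c : ℝ}
    (hgc : ∀ ω, |g ω| ≤ c) : Integrable (fun ω => g ω / mixDensity μ k Q ω) ρ := by
  refine Integrable.of_bound (hg.div (measurable_mixDensity hk)).aestronglyMeasurable (c / μ)
    (Filter.Eventually.of_forall fun ω => ?_)
  have h := le_mixDensity hμ1 hk0 hQ ω
  rw [Real.norm_eq_abs, abs_div, abs_of_pos (hμ0.trans_le h)]
  exact div_le_div₀ ((abs_nonneg _).trans (hgc ω)) (hgc ω) hμ0 h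

theorem continuousOn_integral_div_mixDensity (hμ0 : 0 < μ) (hμ1 : μ ≤ 1)
    (hk : ∀ i, Measurable (k i)) (hk0 : ∀ i ω, 0 ≤ k i ω) (hkκ : ∀ i ω, k i ω ≤ κ) (i : I) :
    ContinuousOn (fun Q => ∫ ω, k i ω / mixDensity μ k Q ω ∂ρ) (stdSimplex ℝ I) := by
  refine continuousOn_of_dominated (bound := fun _ => κ / μ) (fun Q _ =>
    ((hk i).div (measurable_mixDensity hk)).aestronglyMeasurable) (fun Q hQ => ?_)
    (integrable_const _) (Filter.Eventually.of_forall fun ω => ?_)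
  · refine Filter.Eventually.of_forall fun ω => ?_
    have h := le_mixDensity hμ1 hk0 hQ ω
    rw [Real.norm_eq_abs, abs_div, abs_of_pos (hμ0.trans_le h), abs_of_nonneg (hk0 i ω)]
    exact div_le_div₀ ((hk0 i ω).trans (hkκ i ω)) (hkκ i ω) hμ0 h
  · exact continuousOn_const.div (continuous_mixDensity ω).continuousOn fun Q hQ =>
      (hμ0.trans_le (le_mixDensity hμ1 hk0 hQ ω)).ne'

/-- Mixing weights that maximize the expected logarithm of the mixture make the expectation of
`1 / q` small under each of the mixed densities. -/
theorem exists_integral_div_mixDensity_le [Nonempty I] (hμ0 : 0 < μ) (hμ1 : μ ≤ 1 / 2)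
    (hκ : 0 < κ) (hk : ∀ i, Measurable (k i)) (hk0 : ∀ i ω, 0 ≤ k i ω)
    (hkκ : ∀ i ω, k i ω ≤ κ) :
    ∃ Q ∈ stdSimplex ℝ I, ∀ i, ∫ ω, k i ω / mixDensity μ k Q ω ∂ρ ≤
      2 * ρ.real {ω | ∃ i, k i ω ≠ 0} := by
  classical
  have hμ1' : μ ≤ 1 := by linarith
  have hcont : ContinuousOn (fun Q => ∫ ω, Real.log (mixDensity μ k Q ω) ∂ρ)
      (stdSimplex ℝ I) := by
    refine continuousOn_of_dominated (bound := fun _ => |Real.log μ| + |Real.log (1 + κ)|)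
      (fun Q _ => (measurable_mixDensity hk).log.aestronglyMeasurable)
      (fun Q hQ => Filter.Eventually.of_forall fun ω =>
        abs_log_mixDensity_le hμ0 hμ1' hκ.le hk0 hkκ hQ ω)
      (integrable_const _) (Filter.Eventually.of_forall fun ω => ?_)
    exact (continuous_mixDensity ω).continuousOn.log fun Q hQ =>
      (hμ0.trans_le (le_mixDensity hμ1' hk0 hQ ω)).ne'
  -- The witness maximizes E log q over the simplex; it need not be a minimizer of the algorithm's
  -- objective.
  obtain ⟨Q, hQ, hmax⟩ := (isCompact_stdSimplex ℝ I).exists_isMaxOn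
    ⟨_, single_mem_stdSimplex ℝ (Classical.arbitrary I)⟩ hcont
  refine ⟨Q, hQ, fun i => ?_⟩
  set q := mixDensity μ k Q with hq
  set s : Ω → ℝ := fun ω => ∑ j, Q j * k j ω with hs
  have hsm : Measurable s := by fun_prop
  have hs0 : ∀ ω, 0 ≤ s ω := mixture_nonneg hk0 hQ
  have hsκ : ∀ ω, s ω ≤ κ := mixture_le hkκ hQ
  have hqμ : ∀ ω, μ ≤ q ω := le_mixDensity hμ1' hk0 hQ
  have hq0 : ∀ ω, 0 < q ω := fun ω => hμ0.trans_le (hqμ ω)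
  set g : Ω → ℝ := fun ω => (1 - μ) * (k i ω - s ω) with hg
  have hgm : Measurable g := by fun_prop
  have hgκ : ∀ ω, |g ω| ≤ κ := fun ω => by
    rw [hg, abs_mul, abs_of_nonneg (by linarith : 0 ≤ 1 - μ)]
    have : |k i ω - s ω| ≤ κ := by
      rw [abs_le]; constructor <;> linarith [hk0 i ω, hkκ i ω, hs0 ω, hsκ ω]
    nlinarith [abs_nonneg (k i ω - s ω)]
  set b := κ / μ with hb
  have hb0 : 0 < b := by positivity
  have hub : ∀ ω, |g ω / q ω| ≤ b := fun ω => by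
    rw [abs_div, abs_of_pos (hq0 ω)]
    exact div_le_div₀ hκ.le (hgκ ω) hμ0 (hqμ ω)
  have hgi : Integrable (fun ω => g ω / q ω) ρ :=
    integrable_div_mixDensity hμ0 hμ1' hk hk0 hQ hgm hgκ
  have hsi : Integrable (fun ω => s ω / q ω) ρ :=
    integrable_div_mixDensity hμ0 hμ1' hk hk0 hQ hsm
      (fun ω => by rw [abs_of_nonneg (hs0 ω)]; exact hsκ ω)
  have hki : Integrable (fun ω => k i ω / q ω) ρ :=
    integrable_div_mixDensity hμ0 hμ1' hk hk0 hQ (hk i)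
      (fun ω => by rw [abs_of_nonneg (hk0 i ω)]; exact hkκ i ω)
  have hlogi : ∀ Q' ∈ stdSimplex ℝ I, Integrable (fun ω => Real.log (mixDensity μ k Q' ω)) ρ :=
    fun Q' hQ' => Integrable.of_bound (measurable_mixDensity hk).log.aestronglyMeasurable _
      (Filter.Eventually.of_forall fun ω =>
        abs_log_mixDensity_le hμ0 hμ1' hκ.le hk0 hkκ hQ' ω)
  -- Moving the weights a distance `t` towards vertex `i` changes q to q + t g. Maximality together
  -- with the quadratic lower bound for the logarithm gives the first-order condition up to an error
  -- linear in `t`, without differentiating under the integral.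
  have hsmall : ∀ t : ℝ, 0 < t → t ≤ 1 → t * b ≤ 1 / 2 →
      ∫ ω, g ω / q ω ∂ρ ≤ 2 * b ^ 2 * t := by
    intro t ht ht1 htb
    set Q' : I → ℝ := (1 - t) • Q + t • Pi.single i 1 with hQ'
    have hQ'mem : Q' ∈ stdSimplex ℝ I :=
      convex_stdSimplex ℝ I hQ (single_mem_stdSimplex ℝ i) (by linarith) ht.le (by ring)
    have hmix : ∀ ω, mixDensity μ k Q' ω = q ω + t * g ω := by
      intro ω
      have : ∑ j, Q' j * k j ω = (1 - t) * s ω + t * k i ω := by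
        simp [hQ', hs, add_mul, Finset.sum_add_distrib, Finset.mul_sum, mul_assoc,
          Pi.single_apply]
      rw [mixDensity, this, hq, mixDensity]
      simp only [hg, hs]
      ring
    have hle : ∀ ω, t * (g ω / q ω) - 2 * (t * b) ^ 2 ≤
        Real.log (mixDensity μ k Q' ω) - Real.log (q ω) := by
      intro ω
      set u := g ω / q ω with hu
      have hu' : q ω + t * g ω = q ω * (1 + t * u) := by
        rw [hu]; field_simp [(hq0 ω).ne']
      have hz : |t * u| ≤ t * b := by
        rw [abs_mul, abs_of_pos ht]
        exact mul_le_mul_of_nonneg_left (hub ω) ht.le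
      have hz2 := abs_le.1 (hz.trans htb)
      rw [hmix ω, hu', Real.log_mul (hq0 ω).ne' (by linarith), add_sub_cancel_left]
      have := sub_two_mul_sq_le_log (hz.trans htb)
      nlinarith [sq_abs (t * u), abs_nonneg (t * u)]
    have hint := integral_mono ((hgi.const_mul t).sub (integrable_const (2 * (t * b) ^ 2)))
      ((hlogi Q' hQ'mem).sub (hlogi Q hQ)) hle
    have hmax' : ∫ ω, Real.log (mixDensity μ k Q' ω) ∂ρ ≤ ∫ ω, Real.log (q ω) ∂ρ :=
      hmax hQ'mem
    simp only [Pi.sub_apply] at hint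
    rw [integral_sub (hgi.const_mul t) (integrable_const _), integral_const_mul,
      integral_sub (hlogi Q' hQ'mem) (hlogi Q hQ)] at hint
    simp only [integral_const, probReal_univ, one_smul] at hint
    have h3 : t * ∫ ω, g ω / q ω ∂ρ ≤ t * (2 * b ^ 2 * t) := by linarith
    exact le_of_mul_le_mul_left h3 ht
  have hgle : ∫ ω, g ω / q ω ∂ρ ≤ 0 := by
    by_contra! hpos
    set G := ∫ ω, g ω / q ω ∂ρ
    -- The last term makes the error 2 b² t at most G / 2, contradicting G > 0; the others keep t ≤
    -- 1 and t b ≤ 1 / 2.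
    set t := min (min 1 (1 / (2 * b))) (G / (4 * b ^ 2)) with ht
    have ht0 : 0 < t := by positivity
    have h1 := hsmall t ht0 ((min_le_left _ _).trans (min_le_left _ _)) (by
      have : t ≤ 1 / (2 * b) := (min_le_left _ _).trans (min_le_right _ _)
      calc t * b ≤ 1 / (2 * b) * b := mul_le_mul_of_nonneg_right this hb0.le
        _ = 1 / 2 := by field_simp)
    have h2 : 2 * b ^ 2 * t ≤ 2 * b ^ 2 * (G / (4 * b ^ 2)) :=
      mul_le_mul_of_nonneg_left (min_le_right _ _) (by positivity)
    have h3 : 2 * b ^ 2 * (G / (4 * b ^ 2)) = G / 2 := by field_simp; ring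
    linarith
  have hsplit : ∫ ω, g ω / q ω ∂ρ =
      (1 - μ) * (∫ ω, k i ω / q ω ∂ρ - ∫ ω, s ω / q ω ∂ρ) := by
    rw [← integral_sub hki hsi, ← integral_const_mul]
    refine integral_congr_ae (Filter.Eventually.of_forall fun ω => ?_)
    simp only [hg]; ring
  have hcmp : ∫ ω, k i ω / q ω ∂ρ ≤ ∫ ω, s ω / q ω ∂ρ := by
    rw [hsplit] at hgle
    by_contra! h
    nlinarith
  refine hcmp.trans ?_
  have hmeas : MeasurableSet {ω | ∃ i, k i ω ≠ 0} := by
    have : {ω | ∃ i, k i ω ≠ 0} = ⋃ i, {ω | k i ω ≠ 0} := by ext; simp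
    rw [this]
    exact MeasurableSet.iUnion fun i => (hk i) (measurableSet_singleton 0).compl
  -- Since μ ≤ 1/2, q ≥ s / 2, so s / q ≤ 2; it vanishes where all the densities do.
  calc ∫ ω, s ω / q ω ∂ρ ≤ ∫ ω, Set.indicator {ω | ∃ i, k i ω ≠ 0} (fun _ => (2 : ℝ)) ω ∂ρ := by
        refine integral_mono hsi ((integrable_const _).indicator hmeas) fun ω => ?_
        by_cases hω : ω ∈ {ω | ∃ i, k i ω ≠ 0}
        · rw [Set.indicator_of_mem hω]
          simp only
          rw [div_le_iff₀ (hq0 ω)]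
          have : q ω = μ + (1 - μ) * s ω := rfl
          nlinarith [hs0 ω]
        · rw [Set.indicator_of_notMem hω]
          have h0 : ∀ j, k j ω = 0 := by simpa using hω
          simp [hs, h0]
    _ = 2 * ρ.real {ω | ∃ i, k i ω ≠ 0} := by
        rw [integral_indicator_const _ hmeas, smul_eq_mul, mul_comm]

end Mixture

/-! ### The optimization problem: existence and value of its minimizers -/

section RegularSetting

variable {X A ι : Type*} [MeasurableSpace X] [PseudoMetricSpace A] [MeasurableSpace A]

/-- A setting whose two measures are probability measures, whose policies are measurable, and in
which balls of a given positive radius have base measure bounded below. -/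
structure Setting.IsRegular (D : Setting X A ι) : Prop where
  isProbabilityMeasure_ctxLaw : IsProbabilityMeasure D.ctxLaw
  isProbabilityMeasure_base : IsProbabilityMeasure D.base
  measurable_policy : ∀ i, Measurable (D.policy i)
  exists_le_ball : ∀ h : ℝ, 0 < h → ∃ c, 0 < c ∧ ∀ a, c ≤ D.base.real (Metric.closedBall a h)

theorem bandwidth_pos (m : ℕ) : 0 < bandwidth m := by unfold bandwidth; positivity

theorem radius_pos {L : ℝ} (hL : 0 < L) (m : ℕ) : 0 < radius L m := by unfold radius; positivity

theorem exploreProb_pos {L : ℝ} (hL : 0 < L) (m : ℕ) : 0 < exploreProb L m :=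
  lt_min (by norm_num) (radius_pos hL m)

theorem exploreProb_le_half (L : ℝ) (m : ℕ) : exploreProb L m ≤ 1 / 2 := min_le_left _ _

theorem exploreProb_le_one (L : ℝ) (m : ℕ) : exploreProb L m ≤ 1 :=
  (exploreProb_le_half L m).trans (by norm_num)

variable {D : Setting X A ι}

theorem kernelDensity_nonneg (h : ℝ) (a a' : A) : 0 ≤ kernelDensity D h a a' := by
  unfold kernelDensity
  split_ifs
  · positivity
  · exact le_rfl

theorem Setting.IsRegular.bddAbove_kernelDensity (hD : D.IsRegular) {h : ℝ} (hh : 0 < h) :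
    BddAbove (Set.range fun p : A × A => kernelDensity D h p.1 p.2) := by
  obtain ⟨c, hc, hle⟩ := hD.exists_le_ball h hh
  refine ⟨c⁻¹, ?_⟩
  rintro _ ⟨p, rfl⟩
  simp only [kernelDensity]
  split_ifs
  · exact inv_anti₀ hc (hle _)
  · positivity

theorem Setting.IsRegular.kernelDensity_le_kernelSup (hD : D.IsRegular) {h : ℝ} (hh : 0 < h)
    (a a' : A) : kernelDensity D h a a' ≤ kernelSup D h :=
  le_ciSup (hD.bddAbove_kernelDensity hh) (a, a')

theorem Setting.IsRegular.kernelSup_pos [Nonempty A] (hD : D.IsRegular) {h : ℝ} (hh : 0 < h) :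
    0 < kernelSup D h := by
  have a := Classical.arbitrary A
  obtain ⟨c, hc, hle⟩ := hD.exists_le_ball h hh
  refine lt_of_lt_of_le ?_ (hD.kernelDensity_le_kernelSup hh a a)
  simp only [kernelDensity, dist_self, hh.le, if_true]
  exact inv_pos.2 (hc.trans_le (hle a))

/-- The kernel density around the action of a policy of `S`, as a function of the context and the
action. -/
def policyDensity (D : Setting X A ι) (m : ℕ) (S : Finset ι) (i : {i // i ∈ S}) (p : X × A) : ℝ :=
  kernelDensity D (bandwidth m) (D.policy i p.1) p.2

theorem policyDensity_nonneg (m : ℕ) (S : Finset ι) (i : {i // i ∈ S}) (p : X × A) :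
    0 ≤ policyDensity D m S i p :=
  kernelDensity_nonneg _ _ _

theorem Setting.IsRegular.policyDensity_le (hD : D.IsRegular) (m : ℕ) (S : Finset ι)
    (i : {i // i ∈ S}) (p : X × A) : policyDensity D m S i p ≤ kernelSup D (bandwidth m) :=
  hD.kernelDensity_le_kernelSup (bandwidth_pos m) _ _

theorem Setting.IsRegular.abs_policyDensity_le (hD : D.IsRegular) (m : ℕ) (S : Finset ι)
    (i : {i // i ∈ S}) (p : X × A) : |policyDensity D m S i p| ≤ kernelSup D (bandwidth m) := by
  rw [abs_of_nonneg (policyDensity_nonneg m S i p)]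
  exact hD.policyDensity_le m S i p

theorem actionDensity_eq_mixDensity (L : ℝ) (m : ℕ) (S : Finset ι) (Q : ι → ℝ) (x : X) (a : A) :
    actionDensity D L m S Q x a =
      mixDensity (exploreProb L m) (policyDensity D m S) (fun i => Q i) (x, a) := by
  rw [actionDensity, mixDensity, ← Finset.sum_coe_sort]
  rfl

theorem coe_mem_stdSimplex {S : Finset ι} {Q : ι → ℝ} (hQ : Q ∈ distributionsOn S) :
    (fun i : {i // i ∈ S} => Q i) ∈ stdSimplex ℝ {i // i ∈ S} :=
  ⟨fun i => hQ.1 i i.2, by rw [Finset.sum_coe_sort]; exact hQ.2⟩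

theorem exists_distributionsOn_extend {S : Finset ι} {Q : {i // i ∈ S} → ℝ}
    (hQ : Q ∈ stdSimplex ℝ {i // i ∈ S}) :
    ∃ Q' ∈ distributionsOn S, (fun i : {i // i ∈ S} => Q' i) = Q := by
  classical
  have he : (fun i : {i // i ∈ S} => (fun j => if h : j ∈ S then Q ⟨j, h⟩ else 0) (i : ι)) = Q := by
    ext i; simp
  refine ⟨fun j => if h : j ∈ S then Q ⟨j, h⟩ else 0, ⟨fun i hi => ?_, ?_⟩, he⟩
  · simpa [hi] using hQ.1 ⟨i, hi⟩
  · rw [← Finset.sum_coe_sort, ← hQ.2]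
    exact Finset.sum_congr rfl fun i _ => congrFun he i

variable [BorelSpace A]

theorem Setting.IsRegular.integral_kernelDensity (hD : D.IsRegular) {h : ℝ} (hh : 0 < h) (a : A) :
    ∫ a', kernelDensity D h a a' ∂D.base = 1 := by
  have := hD.isProbabilityMeasure_base
  obtain ⟨c, hc, hle⟩ := hD.exists_le_ball h hh
  have : ∀ a', kernelDensity D h a a' = (Metric.closedBall a h).indicator
      (fun _ => (D.base.real (Metric.closedBall a h))⁻¹) a' := by
    intro a'
    by_cases ha : dist a a' ≤ h
    · rw [Set.indicator_of_mem (by simpa [dist_comm] using ha), kernelDensity, if_pos ha]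
    · rw [Set.indicator_of_notMem (by simpa [dist_comm] using ha), kernelDensity, if_neg ha]
  simp_rw [this]
  rw [integral_indicator_const _ Metric.isClosed_closedBall.measurableSet, smul_eq_mul,
    mul_inv_cancel₀ (hc.trans_le (hle a)).ne']

variable [SecondCountableTopology A]

theorem Setting.IsRegular.measurable_real_closedBall (hD : D.IsRegular) (h : ℝ) :
    Measurable fun a => D.base.real (Metric.closedBall a h) := by
  have := hD.isProbabilityMeasure_base
  have hs : MeasurableSet {p : A × A | dist p.2 p.1 ≤ h} :=
    measurableSet_le (by fun_prop) measurable_const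
  exact (measurable_measure_prodMk_left (ν := D.base) hs).ennreal_toReal

theorem Setting.IsRegular.measurable_kernelDensity (hD : D.IsRegular) (h : ℝ) :
    Measurable fun p : A × A => kernelDensity D h p.1 p.2 := by
  unfold kernelDensity
  refine Measurable.ite (measurableSet_le (by fun_prop) measurable_const) ?_ measurable_const
  exact ((hD.measurable_real_closedBall h).comp measurable_fst).inv

theorem Setting.IsRegular.measurable_policyDensity (hD : D.IsRegular) (m : ℕ) (S : Finset ι)
    (i : {i // i ∈ S}) : Measurable (policyDensity D m S i) :=
  (hD.measurable_kernelDensity _).comp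
    (((hD.measurable_policy i).comp measurable_fst).prodMk measurable_snd)

theorem Setting.IsRegular.integral_smooth (hD : D.IsRegular) {h : ℝ} (hh : 0 < h) (a : A)
    (g : A → ℝ) : ∫ a', g a' ∂(smooth D h a) = ∫ a', kernelDensity D h a a' * g a' ∂D.base := by
  rw [smooth, if_neg hh.ne', integral_withDensity_eq_integral_toReal_smul]
  · simp [ENNReal.toReal_ofReal (kernelDensity_nonneg h a _)]
  · exact ((hD.measurable_kernelDensity h).comp measurable_prodMk_left).ennreal_ofReal
  · simp

theorem Setting.IsRegular.isProbabilityMeasure_smooth (hD : D.IsRegular) {h : ℝ} (hh : 0 < h)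
    (a : A) : IsProbabilityMeasure (smooth D h a) := by
  have := hD.isProbabilityMeasure_base
  have hm : Measurable fun a' => kernelDensity D h a a' :=
    (hD.measurable_kernelDensity h).comp measurable_prodMk_left
  have hint : Integrable (fun a' => kernelDensity D h a a') D.base :=
    Integrable.of_bound hm.aestronglyMeasurable (kernelSup D h)
      (Filter.Eventually.of_forall fun a' => by
        rw [Real.norm_eq_abs, abs_of_nonneg (kernelDensity_nonneg h a a')]
        exact hD.kernelDensity_le_kernelSup hh a a')
  constructor
  rw [smooth, if_neg hh.ne', withDensity_apply _ MeasurableSet.univ, Measure.restrict_univ,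
    ← ofReal_integral_eq_lintegral_ofReal hint
      (Filter.Eventually.of_forall fun a' => kernelDensity_nonneg h a a'),
    hD.integral_kernelDensity hh]
  simp

/-- Writing the smoothed action by its density turns the objective into an integral of k_i / q over
contexts and actions, the form treated for abstract mixtures. -/
theorem Setting.IsRegular.integral_integral_smooth_eq (hD : D.IsRegular) {L : ℝ} (hL : 0 < L)
    (m : ℕ) (S : Finset ι) {Q : ι → ℝ} (hQ : Q ∈ distributionsOn S) (i : {i // i ∈ S}) :
    ∫ x, ∫ a, 1 / actionDensity D L m S Q x a ∂(smooth D (bandwidth m) (D.policy i x)) ∂D.ctxLaw =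
      ∫ p, policyDensity D m S i p /
        mixDensity (exploreProb L m) (policyDensity D m S) (fun i : {i // i ∈ S} => Q i) p
        ∂(D.ctxLaw.prod D.base) := by
  have := hD.isProbabilityMeasure_base
  have := hD.isProbabilityMeasure_ctxLaw
  have hint : Integrable (fun p => policyDensity D m S i p /
      mixDensity (exploreProb L m) (policyDensity D m S) (fun i : {i // i ∈ S} => Q i) p)
      (D.ctxLaw.prod D.base) :=
    integrable_div_mixDensity (exploreProb_pos hL m) (exploreProb_le_one L m)
      (hD.measurable_policyDensity m S) (policyDensity_nonneg m S)
      (coe_mem_stdSimplex hQ) (hD.measurable_policyDensity m S i) (hD.abs_policyDensity_le m S i)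
  rw [integral_prod _ hint]
  refine integral_congr_ae (Filter.Eventually.of_forall fun x => ?_)
  simp only [hD.integral_smooth (bandwidth_pos m), actionDensity_eq_mixDensity, mul_one_div]
  rfl

/-- A maximum of finitely many continuous functions on the compact simplex; continuity comes from
dominated convergence, as q ≥ μ > 0. -/
theorem Setting.IsRegular.exists_isMinOn_objective (hD : D.IsRegular) {L : ℝ} (hL : 0 < L)
    (m : ℕ) {S : Finset ι} (hS : S.Nonempty) :
    ∃ Q ∈ distributionsOn S, IsMinOn (objective D L m S) (distributionsOn S) Q := by
  have := hD.isProbabilityMeasure_base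
  have := hD.isProbabilityMeasure_ctxLaw
  have : Nonempty {i // i ∈ S} := hS.to_subtype
  set J : ({i // i ∈ S} → ℝ) → ℝ := fun Q => ⨆ i, ∫ p, policyDensity D m S i p /
        mixDensity (exploreProb L m) (policyDensity D m S) Q p ∂(D.ctxLaw.prod D.base) with hJ
  have hobj : ∀ Q ∈ distributionsOn S, objective D L m S Q =
      J fun i : {i // i ∈ S} => Q i := fun Q hQ =>
    iSup_congr fun i => hD.integral_integral_smooth_eq hL m S hQ i
  have hcont : ContinuousOn J (stdSimplex ℝ {i // i ∈ S}) := by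
    simp only [hJ, ← Finset.sup'_univ_eq_ciSup]
    exact ContinuousOn.finset_sup'_apply _ fun i _ =>
      continuousOn_integral_div_mixDensity (exploreProb_pos hL m) (exploreProb_le_one L m)
        (hD.measurable_policyDensity m S) (policyDensity_nonneg m S) (hD.policyDensity_le m S) i
  classical
  obtain ⟨Q, hQ, hmin⟩ := (isCompact_stdSimplex ℝ {i // i ∈ S}).exists_isMinOn
    ⟨_, single_mem_stdSimplex ℝ (Classical.arbitrary _)⟩ hcont
  obtain ⟨Q', hQ', rfl⟩ := exists_distributionsOn_extend hQ
  refine ⟨Q', hQ', fun R hR => ?_⟩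
  simp only [Set.mem_ofPred_eq]
  rw [hobj _ hQ', hobj _ hR]
  exact hmin (coe_mem_stdSimplex hR)

theorem Setting.IsRegular.exists_isSolver (hD : D.IsRegular) {L : ℝ} (hL : 0 < L) :
    ∃ Q, IsSolver D L Q := by
  classical
  have h : ∀ (m : ℕ) (S : Finset ι), ∃ Q : ι → ℝ, S.Nonempty →
      Q ∈ distributionsOn S ∧ IsMinOn (objective D L m S) (distributionsOn S) Q := fun m S => by
    by_cases hS : S.Nonempty
    · obtain ⟨Q, h1, h2⟩ := hD.exists_isMinOn_objective hL m hS
      exact ⟨Q, fun _ => ⟨h1, h2⟩⟩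
    · exact ⟨0, fun h => absurd h hS⟩
  choose Q hQ using h
  exact ⟨Q, fun m _ S _ hS => hQ m S hS⟩

/-- Identifies the support measure in the mixture bound with the characteristic volume, section by
section in the context. -/
theorem Setting.IsRegular.real_exists_policyDensity_ne_zero (hD : D.IsRegular) (m : ℕ)
    (S : Finset ι) :
    (D.ctxLaw.prod D.base).real {p | ∃ i, policyDensity D m S i p ≠ 0} =
      charVolume D S (bandwidth m) := by
  have := hD.isProbabilityMeasure_base
  have := hD.isProbabilityMeasure_ctxLaw
  obtain ⟨c, hc, hle⟩ := hD.exists_le_ball (bandwidth m) (bandwidth_pos m)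
  have hmeas : MeasurableSet {p | ∃ i, policyDensity D m S i p ≠ 0} := by
    have : {p | ∃ i, policyDensity D m S i p ≠ 0} = ⋃ i, {p | policyDensity D m S i p ≠ 0} := by
      ext; simp
    rw [this]
    exact MeasurableSet.iUnion fun i =>
      (hD.measurable_policyDensity m S i) (measurableSet_singleton 0).compl
  rw [← integral_indicator_one hmeas, integral_prod, charVolume]
  · refine integral_congr_ae (Filter.Eventually.of_forall fun x => ?_)
    have hm : MeasurableSet (⋃ i ∈ S, Metric.closedBall (D.policy i x) (bandwidth m)) :=
      Finset.measurableSet_biUnion _ fun i _ => Metric.isClosed_closedBall.measurableSet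
    simp only
    rw [← integral_indicator_one hm]
    refine integral_congr_ae (Filter.Eventually.of_forall fun a => ?_)
    simp only
    refine Set.indicator_eq_indicator ?_ rfl
    -- Balls have positive measure, so the kernel is nonzero on the whole ball and its support is
    -- exactly that ball.
    have hne : ∀ i, D.base.real (Metric.closedBall (D.policy i x) (bandwidth m)) ≠ 0 :=
      fun i => (hc.trans_le (hle _)).ne'
    simp [policyDensity, kernelDensity, hne, dist_comm a, and_comm]
  · exact (integrable_const 1).indicator hmeas

/-- The log-optimal weights are a competitor with all components at most 2 V, so the minimal maximum
is at most 2 V as well. -/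
theorem IsSolver.integral_div_mixDensity_le (hD : D.IsRegular) {L : ℝ} (hL : 0 < L) [Nonempty A]
    {Q : ℕ → Finset ι → ι → ℝ} (hQ : IsSolver D L Q) {m : ℕ} (hm : 1 ≤ m) {S : Finset ι}
    (hS : S ⊆ D.policies) (i : {i // i ∈ S}) :
    ∫ p, policyDensity D m S i p /
        mixDensity (exploreProb L m) (policyDensity D m S) (fun i : {i // i ∈ S} => Q m S i) p
        ∂(D.ctxLaw.prod D.base) ≤ 2 * charVolume D S (bandwidth m) := by
  have := hD.isProbabilityMeasure_base
  have := hD.isProbabilityMeasure_ctxLaw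
  have : Nonempty {i // i ∈ S} := ⟨i⟩
  obtain ⟨hmem, hmin⟩ := hQ m hm S hS ⟨i, i.2⟩
  obtain ⟨R, hR, hRle⟩ := exists_integral_div_mixDensity_le (ρ := D.ctxLaw.prod D.base)
    (k := policyDensity D m S)
    (exploreProb_pos hL m) (exploreProb_le_half L m) (hD.kernelSup_pos (bandwidth_pos m))
    (hD.measurable_policyDensity m S) (policyDensity_nonneg m S) (hD.policyDensity_le m S)
  obtain ⟨R', hR', rfl⟩ := exists_distributionsOn_extend hR
  rw [hD.real_exists_policyDensity_ne_zero] at hRle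
  have h1 : objective D L m S (Q m S) ≤ objective D L m S R' := hmin hR'
  rw [← hD.integral_integral_smooth_eq hL m S hmem i]
  refine le_trans (le_ciSup (f := fun i : {i // i ∈ S} => ∫ x, ∫ a, 1 / actionDensity D L m S
    (Q m S) x a ∂(smooth D (bandwidth m) (D.policy i x)) ∂D.ctxLaw)
    (Set.finite_range _).bddAbove i) (h1.trans (ciSup_le fun j => ?_))
  rw [hD.integral_integral_smooth_eq hL m S hR' j]
  exact hRle j

end RegularSetting

/-! ### The law of one round and the moments of the loss estimate -/

section RegularBandit

variable {X A ι Z : Type*} [MeasurableSpace X] [PseudoMetricSpace A] [MeasurableSpace A]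
  [MeasurableSpace Z]

/-- A bandit problem in a regular setting with jointly measurable losses in `[0, 1]`. -/
structure ContextualBandit.IsRegular (B : ContextualBandit X A ι Z) : Prop where
  setting : B.toSetting.IsRegular
  isMarkovKernel_lossLaw : IsMarkovKernel B.lossLaw
  measurable_loss : Measurable (Function.uncurry B.loss)
  loss_mem : ∀ z a, B.loss z a ∈ Set.Icc (0 : ℝ) 1

/-- The joint law of the context, the loss variable, and an independent action drawn from the
base measure. -/
def dominatingLaw (B : ContextualBandit X A ι Z) : Measure ((X × Z) × A) :=
  (B.ctxLaw ⊗ₘ B.lossLaw).prod B.base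

/-- The observation made when the action of the given triple is taken. -/
def observe (B : ContextualBandit X A ι Z) (ω : (X × Z) × A) : Observation X A :=
  (ω.1.1, ω.2, B.loss ω.1.2 ω.2)

/-- The law of one observation in epoch `m` with active policy set `S`. -/
def obsLaw (B : ContextualBandit X A ι Z) (L : ℝ) (m : ℕ) (S : Finset ι) (Q : ι → ℝ) :
    Measure (Observation X A) :=
  ((dominatingLaw B).withDensity fun ω =>
    ENNReal.ofReal (actionDensity B.toSetting L m S Q ω.1.1 ω.2)).map (observe B)

variable {B : ContextualBandit X A ι Z}

theorem ContextualBandit.IsRegular.isProbabilityMeasure_dominatingLaw (hB : B.IsRegular) :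
    IsProbabilityMeasure (dominatingLaw B) := by
  have := hB.setting.isProbabilityMeasure_ctxLaw
  have := hB.setting.isProbabilityMeasure_base
  have := hB.isMarkovKernel_lossLaw
  unfold dominatingLaw
  infer_instance

theorem ContextualBandit.IsRegular.measurable_observe (hB : B.IsRegular) :
    Measurable (observe B) :=
  measurable_fst.fst.prodMk (measurable_snd.prodMk
    (hB.measurable_loss.comp (measurable_fst.snd.prodMk measurable_snd)))

theorem ContextualBandit.IsRegular.lintegral_dominatingLaw (hB : B.IsRegular)
    {φ : (X × Z) × A → ℝ≥0∞} (hφ : Measurable φ) :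
    ∫⁻ ω, φ ω ∂(dominatingLaw B) =
      ∫⁻ x, ∫⁻ z, ∫⁻ a, φ ((x, z), a) ∂B.base ∂(B.lossLaw x) ∂B.ctxLaw := by
  have := hB.setting.isProbabilityMeasure_ctxLaw
  have := hB.setting.isProbabilityMeasure_base
  have := hB.isMarkovKernel_lossLaw
  rw [dominatingLaw, lintegral_prod _ hφ.aemeasurable,
    Measure.lintegral_compProd hφ.lintegral_prod_right']

theorem ContextualBandit.IsRegular.integral_dominatingLaw (hB : B.IsRegular)
    {φ : (X × Z) × A → ℝ} (hφ : Integrable φ (dominatingLaw B)) :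
    ∫ ω, φ ω ∂(dominatingLaw B) =
      ∫ x, ∫ z, ∫ a, φ ((x, z), a) ∂B.base ∂(B.lossLaw x) ∂B.ctxLaw := by
  have := hB.setting.isProbabilityMeasure_ctxLaw
  have := hB.setting.isProbabilityMeasure_base
  have := hB.isMarkovKernel_lossLaw
  rw [dominatingLaw] at hφ ⊢
  rw [integral_prod _ hφ, Measure.integral_compProd hφ.integral_prod_left]

theorem ContextualBandit.IsRegular.integral_dominatingLaw_of_ctx_action (hB : B.IsRegular)
    {g : X × A → ℝ} (hg : Measurable g) {c : ℝ} (hc : ∀ p, |g p| ≤ c) :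
    ∫ ω, g (ω.1.1, ω.2) ∂(dominatingLaw B) = ∫ p, g p ∂(B.ctxLaw.prod B.base) := by
  have := hB.setting.isProbabilityMeasure_ctxLaw
  have := hB.setting.isProbabilityMeasure_base
  have := hB.isMarkovKernel_lossLaw
  have := hB.isProbabilityMeasure_dominatingLaw
  rw [hB.integral_dominatingLaw, integral_prod]
  · simp
  · exact Integrable.of_bound hg.aestronglyMeasurable c (Filter.Eventually.of_forall hc)
  · exact Integrable.of_bound
      (hg.comp (measurable_fst.fst.prodMk measurable_snd)).aestronglyMeasurable c
      (Filter.Eventually.of_forall fun ω => hc _)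

variable {L : ℝ} {m : ℕ} {S : Finset ι} {Q : ι → ℝ}

theorem exploreProb_le_actionDensity {D : Setting X A ι} (hQ : Q ∈ distributionsOn S) (x : X)
    (a : A) : exploreProb L m ≤ actionDensity D L m S Q x a := by
  rw [actionDensity_eq_mixDensity]
  exact le_mixDensity (exploreProb_le_one L m) (policyDensity_nonneg m S)
    (coe_mem_stdSimplex hQ) _

theorem actionDensity_pos {D : Setting X A ι} (hL : 0 < L) (hQ : Q ∈ distributionsOn S) (x : X)
    (a : A) : 0 < actionDensity D L m S Q x a :=
  (exploreProb_pos hL m).trans_le (exploreProb_le_actionDensity hQ x a)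

theorem ContextualBandit.IsRegular.smoothedLoss_nonneg (hB : B.IsRegular) (h : ℝ) (i : ι) :
    0 ≤ smoothedLoss B h i :=
  integral_nonneg fun _ => integral_nonneg fun _ => integral_nonneg fun _ =>
    (hB.loss_mem _ _).1

theorem ContextualBandit.IsRegular.abs_lossEstimate_observe_le [Nonempty A] (hB : B.IsRegular)
    (hL : 0 < L) (hQ : Q ∈ distributionsOn S) (i : ι) (ω : (X × Z) × A) :
    |lossEstimate B.toSetting L m S Q i (observe B ω)| ≤
      kernelSup B.toSetting (bandwidth m) / exploreProb L m := by
  have h1 := hB.loss_mem ω.1.2 ω.2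
  have h2 := kernelDensity_nonneg (D := B.toSetting) (bandwidth m) (B.policy i ω.1.1) ω.2
  have h3 := hB.setting.kernelDensity_le_kernelSup (bandwidth_pos m) (B.policy i ω.1.1) ω.2
  have h4 := exploreProb_le_actionDensity (D := B.toSetting) (L := L) (m := m) hQ ω.1.1 ω.2
  simp only [lossEstimate, observe]
  rw [abs_div, abs_of_pos (actionDensity_pos hL hQ _ _), abs_of_nonneg (mul_nonneg h2 h1.1)]
  exact div_le_div₀ (h2.trans h3) (by nlinarith [h1.1, h1.2]) (exploreProb_pos hL m) h4

variable [BorelSpace A] [SecondCountableTopology A]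

theorem Setting.IsRegular.measurable_actionDensity {D : Setting X A ι} (hD : D.IsRegular) (L : ℝ)
    (m : ℕ) (S : Finset ι) (Q : ι → ℝ) :
    Measurable fun p : X × A => actionDensity D L m S Q p.1 p.2 := by
  simp only [actionDensity_eq_mixDensity]
  exact measurable_mixDensity (hD.measurable_policyDensity m S)

theorem Setting.IsRegular.measurable_lossEstimate {D : Setting X A ι} (hD : D.IsRegular) (L : ℝ)
    (m : ℕ) (S : Finset ι) (Q : ι → ℝ) (i : ι) : Measurable (lossEstimate D L m S Q i) := by
  have h0 : Measurable fun o : Observation X A => (o.1, o.2.1) := by fun_prop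
  have h1 := (hD.measurable_kernelDensity (bandwidth m)).comp
    (((hD.measurable_policy i).comp measurable_fst).prodMk measurable_snd)
  have h2 := h1.comp h0
  have h3 := (hD.measurable_actionDensity L m S Q).comp h0
  simp only [Function.comp_def] at h2 h3
  unfold lossEstimate
  exact (h2.mul measurable_snd.snd).div h3

theorem ContextualBandit.IsRegular.measurable_actionDensity_comp (hB : B.IsRegular) (L : ℝ)
    (m : ℕ) (S : Finset ι) (Q : ι → ℝ) : Measurable fun ω : (X × Z) × A =>
      actionDensity B.toSetting L m S Q ω.1.1 ω.2 := by
  have h0 : Measurable fun ω : (X × Z) × A => (ω.1.1, ω.2) := by fun_prop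
  simpa only [Function.comp_def] using (hB.setting.measurable_actionDensity L m S Q).comp h0

/-- Puts the integrals in the order context, loss, action, in which the expected loss of a learner
is defined. -/
theorem ContextualBandit.IsRegular.lintegral_obsLaw (hB : B.IsRegular)
    {φ : Observation X A → ℝ≥0∞} (hφ : Measurable φ) :
    ∫⁻ o, φ o ∂(obsLaw B L m S Q) = ∫⁻ x, ∫⁻ z, ∫⁻ a, φ (x, a, B.loss z a)
      ∂(B.base.withDensity fun a => ENNReal.ofReal (actionDensity B.toSetting L m S Q x a))
      ∂(B.lossLaw x) ∂B.ctxLaw := by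
  have hq := (hB.measurable_actionDensity_comp L m S Q).ennreal_ofReal
  have hφ' := hφ.comp hB.measurable_observe
  rw [obsLaw, lintegral_map hφ hB.measurable_observe,
    show ∫⁻ ω, φ (observe B ω) ∂_ = ∫⁻ ω, (φ ∘ observe B) ω ∂_ from rfl,
    lintegral_withDensity_eq_lintegral_mul _ hq hφ', hB.lintegral_dominatingLaw (hq.mul hφ')]
  refine lintegral_congr fun x => lintegral_congr fun z => ?_
  rw [lintegral_withDensity_eq_lintegral_mul]
  · rfl
  · exact ((hB.setting.measurable_actionDensity L m S Q).comp
      measurable_prodMk_left).ennreal_ofReal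
  · exact hφ'.comp (measurable_prodMk_left (x := (x, z)))

theorem ContextualBandit.IsRegular.integral_obsLaw (hB : B.IsRegular) (hL : 0 < L)
    (hQ : Q ∈ distributionsOn S) {φ : Observation X A → ℝ} (hφ : Measurable φ) :
    ∫ o, φ o ∂(obsLaw B L m S Q) =
      ∫ ω, actionDensity B.toSetting L m S Q ω.1.1 ω.2 * φ (observe B ω) ∂(dominatingLaw B) := by
  rw [obsLaw, integral_map hB.measurable_observe.aemeasurable hφ.aestronglyMeasurable,
    integral_withDensity_eq_integral_toReal_smul
      (hB.measurable_actionDensity_comp L m S Q).ennreal_ofReal (by simp)]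
  simp [ENNReal.toReal_ofReal (actionDensity_pos hL hQ _ _).le]

theorem ContextualBandit.IsRegular.integrable_kernelDensity_mul_loss (hB : B.IsRegular) (m : ℕ)
    (i : ι) :
    Integrable (fun ω : (X × Z) × A =>
      kernelDensity B.toSetting (bandwidth m) (B.policy i ω.1.1) ω.2 * B.loss ω.1.2 ω.2)
      (dominatingLaw B) := by
  have := hB.isProbabilityMeasure_dominatingLaw
  have h0 : Measurable fun ω : (X × Z) × A => (ω.1.2, ω.2) := by fun_prop
  refine Integrable.of_bound (Measurable.aestronglyMeasurable ?_)
    (kernelSup B.toSetting (bandwidth m)) (Filter.Eventually.of_forall fun ω => ?_)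
  · exact ((hB.setting.measurable_kernelDensity _).comp
      (((hB.setting.measurable_policy i).comp measurable_fst.fst).prodMk measurable_snd)).mul
      (hB.measurable_loss.comp h0)
  · have h1 := hB.loss_mem ω.1.2 ω.2
    have h2 := kernelDensity_nonneg (D := B.toSetting) (bandwidth m) (B.policy i ω.1.1) ω.2
    have h3 := hB.setting.kernelDensity_le_kernelSup (bandwidth_pos m) (B.policy i ω.1.1) ω.2
    rw [Real.norm_eq_abs, abs_of_nonneg (mul_nonneg h2 h1.1)]
    nlinarith [h1.1, h1.2]

theorem ContextualBandit.IsRegular.integral_kernelDensity_mul_loss (hB : B.IsRegular) (m : ℕ)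
    (i : ι) :
    ∫ ω, kernelDensity B.toSetting (bandwidth m) (B.policy i ω.1.1) ω.2 * B.loss ω.1.2 ω.2
      ∂(dominatingLaw B) = smoothedLoss B (bandwidth m) i := by
  have := hB.isProbabilityMeasure_dominatingLaw
  rw [hB.integral_dominatingLaw (hB.integrable_kernelDensity_mul_loss m i), smoothedLoss]
  simp only [hB.setting.integral_smooth (bandwidth_pos m)]

theorem ContextualBandit.IsRegular.integral_actionDensity (hB : B.IsRegular)
    (hQ : Q ∈ distributionsOn S) (x : X) :
    ∫ a, actionDensity B.toSetting L m S Q x a ∂B.base = 1 := by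
  have := hB.setting.isProbabilityMeasure_base
  have hint : ∀ i, Integrable (fun a => kernelDensity B.toSetting (bandwidth m) (B.policy i x) a)
      B.base := fun i =>
    Integrable.of_bound ((hB.setting.measurable_kernelDensity _).comp
      measurable_prodMk_left).aestronglyMeasurable (kernelSup B.toSetting (bandwidth m))
      (Filter.Eventually.of_forall fun a => by
        rw [Real.norm_eq_abs, abs_of_nonneg (kernelDensity_nonneg _ _ _)]
        exact hB.setting.kernelDensity_le_kernelSup (bandwidth_pos m) _ _)
  simp only [actionDensity]
  rw [integral_add (integrable_const _)
    ((integrable_finsetSum _ fun i _ => (hint i).const_mul (Q i)).const_mul _),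
    integral_const_mul, integral_finsetSum _ fun i _ => (hint i).const_mul (Q i)]
  simp only [integral_const_mul, hB.setting.integral_kernelDensity (bandwidth_pos m), mul_one,
    hQ.2]
  simp

theorem ContextualBandit.IsRegular.isProbabilityMeasure_action (hB : B.IsRegular) (hL : 0 < L)
    (hQ : Q ∈ distributionsOn S) (x : X) : IsProbabilityMeasure
      (B.base.withDensity fun a => ENNReal.ofReal (actionDensity B.toSetting L m S Q x a)) := by
  constructor
  have h1 := hB.integral_actionDensity (L := L) (m := m) hQ x
  rw [withDensity_apply _ MeasurableSet.univ, Measure.restrict_univ,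
    ← ofReal_integral_eq_lintegral_ofReal
      -- A non-integrable function would have integral 0, contradicting the value 1.
      (by by_contra h; rw [integral_undef h] at h1; norm_num at h1)
      (Filter.Eventually.of_forall fun a => (actionDensity_pos hL hQ x a).le), h1]
  simp

theorem ContextualBandit.IsRegular.isProbabilityMeasure_obsLaw (hB : B.IsRegular) (hL : 0 < L)
    (hQ : Q ∈ distributionsOn S) : IsProbabilityMeasure (obsLaw B L m S Q) := by
  have := hB.setting.isProbabilityMeasure_ctxLaw
  have := hB.isMarkovKernel_lossLaw
  have := fun x => hB.isProbabilityMeasure_action (m := m) hL hQ x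
  constructor
  rw [← lintegral_one, hB.lintegral_obsLaw measurable_const]
  simp

theorem ContextualBandit.IsRegular.memLp_lossEstimate [Nonempty A] (hB : B.IsRegular)
    (hL : 0 < L) (hQ : Q ∈ distributionsOn S) (i : ι) :
    MemLp (lossEstimate B.toSetting L m S Q i) 2 (obsLaw B L m S Q) := by
  have := hB.isProbabilityMeasure_obsLaw (m := m) hL hQ
  have hm := hB.setting.measurable_lossEstimate L m S Q i
  refine MemLp.of_bound hm.aestronglyMeasurable
    (kernelSup B.toSetting (bandwidth m) / exploreProb L m) ?_
  rw [obsLaw, ae_map_iff hB.measurable_observe.aemeasurable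
    (measurableSet_le hm.norm measurable_const)]
  exact Filter.Eventually.of_forall fun ω => hB.abs_lossEstimate_observe_le hL hQ i ω

/-- Importance weighting is unbiased: the sampling density cancels the denominator of the estimate.
-/
theorem ContextualBandit.IsRegular.integral_lossEstimate (hB : B.IsRegular) (hL : 0 < L)
    (hQ : Q ∈ distributionsOn S) (i : ι) :
    ∫ o, lossEstimate B.toSetting L m S Q i o ∂(obsLaw B L m S Q) =
      smoothedLoss B (bandwidth m) i := by
  rw [hB.integral_obsLaw hL hQ (hB.setting.measurable_lossEstimate L m S Q i),
    ← hB.integral_kernelDensity_mul_loss]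
  refine integral_congr_ae (Filter.Eventually.of_forall fun ω => ?_)
  exact mul_div_cancel₀ _ (actionDensity_pos hL hQ _ _).ne'

/-- One factor q cancels, leaving E[(kℓ)² / q] ≤ κ E[k / q] because ℓ ≤ 1 and k ≤ κ; the minimizer
property bounds the last expectation by 2 V. -/
theorem ContextualBandit.IsRegular.integral_lossEstimate_sq_le [Nonempty A] (hB : B.IsRegular)
    (hL : 0 < L) {Q : ℕ → Finset ι → ι → ℝ} (hQ : IsSolver B.toSetting L Q) (hm : 1 ≤ m)
    (hS : S ⊆ B.policies) {i : ι} (hi : i ∈ S) :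
    ∫ o, lossEstimate B.toSetting L m S (Q m S) i o ^ 2 ∂(obsLaw B L m S (Q m S)) ≤
      2 * kernelSup B.toSetting (bandwidth m) * charVolume B.toSetting S (bandwidth m) := by
  have hQS := (hQ m hm S hS ⟨i, hi⟩).1
  have := hB.isProbabilityMeasure_dominatingLaw
  set κ := kernelSup B.toSetting (bandwidth m) with hκ
  have hκ0 : 0 < κ := hB.setting.kernelSup_pos (bandwidth_pos m)
  set g : X × A → ℝ := fun p => policyDensity B.toSetting m S ⟨i, hi⟩ p /
    actionDensity B.toSetting L m S (Q m S) p.1 p.2 with hg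
  have hgm : Measurable g := (hB.setting.measurable_policyDensity m S _).div
    (hB.setting.measurable_actionDensity L m S (Q m S))
  have hgb : ∀ p, |g p| ≤ κ / exploreProb L m := fun p => by
    rw [hg, abs_div, abs_of_pos (actionDensity_pos hL hQS _ _)]
    exact div_le_div₀ hκ0.le (hB.setting.abs_policyDensity_le m S _ p) (exploreProb_pos hL m)
      (exploreProb_le_actionDensity hQS _ _)
  have hg2 : ∫ p, g p ∂(B.ctxLaw.prod B.base) ≤ 2 * charVolume B.toSetting S (bandwidth m) := by
    have := IsSolver.integral_div_mixDensity_le hB.setting hL hQ hm hS ⟨i, hi⟩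
    simpa only [hg, actionDensity_eq_mixDensity] using this
  rw [hB.integral_obsLaw hL hQS ((hB.setting.measurable_lossEstimate L m S _ i).pow_const 2)]
  calc _ ≤ ∫ ω, κ * g (ω.1.1, ω.2) ∂(dominatingLaw B) := by
        refine integral_mono_of_nonneg (Filter.Eventually.of_forall fun ω => ?_)
          (Integrable.const_mul (Integrable.of_bound
            (hgm.comp (measurable_fst.fst.prodMk measurable_snd)).aestronglyMeasurable
            (κ / exploreProb L m)
            (Filter.Eventually.of_forall fun ω => hgb _)) _)
          (Filter.Eventually.of_forall fun ω => ?_)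
        · exact mul_nonneg (actionDensity_pos hL hQS _ _).le (sq_nonneg _)
        · have h1 := hB.loss_mem ω.1.2 ω.2
          have h2 := kernelDensity_nonneg (D := B.toSetting) (bandwidth m) (B.policy i ω.1.1) ω.2
          have h3 := hB.setting.kernelDensity_le_kernelSup (bandwidth_pos m)
            (B.policy i ω.1.1) ω.2
          have h4 := actionDensity_pos (D := B.toSetting) (m := m) hL hQS ω.1.1 ω.2
          simp only [lossEstimate, observe, hg, policyDensity]
          set k := kernelDensity B.toSetting (bandwidth m) (B.policy i ω.1.1) ω.2
          set q := actionDensity B.toSetting L m S (Q m S) ω.1.1 ω.2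
          set l := B.loss ω.1.2 ω.2
          have e1 : q * (k * l / q) ^ 2 = (k * l) ^ 2 / q := by field_simp
          have e2 : κ * (k / q) = κ * k / q := by ring
          rw [e1, e2]
          refine div_le_div_of_nonneg_right ?_ h4.le
          have h5 : (k * l) ^ 2 ≤ k ^ 2 := by
            apply pow_le_pow_left₀ (mul_nonneg h2 h1.1)
            nlinarith [h1.2]
          nlinarith
    _ = κ * ∫ p, g p ∂(B.ctxLaw.prod B.base) := by
        rw [integral_const_mul, hB.integral_dominatingLaw_of_ctx_action hgm hgb]
    _ ≤ κ * (2 * charVolume B.toSetting S (bandwidth m)) :=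
        mul_le_mul_of_nonneg_left hg2 hκ0.le
    _ = _ := by ring

/-- The uniform part of the action law has weight μ and loss at most 1; the rest is an average of
smoothed losses of active policies. -/
theorem ContextualBandit.IsRegular.lintegral_loss_obsLaw_le [Nonempty A] (hB : B.IsRegular)
    (hL : 0 < L) (hQ : Q ∈ distributionsOn S) {c : ℝ}
    (hc : ∀ i ∈ S, smoothedLoss B (bandwidth m) i ≤ c) :
    ∫⁻ o, ENNReal.ofReal o.2.2 ∂(obsLaw B L m S Q) ≤ ENNReal.ofReal (exploreProb L m + c) := by
  have := hB.isProbabilityMeasure_dominatingLaw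
  have hprob := hB.isProbabilityMeasure_obsLaw (m := m) hL hQ
  have hμ0 := exploreProb_pos hL m
  have hμ1 := exploreProb_le_one L m
  have hmeas : Measurable fun o : Observation X A => o.2.2 := measurable_snd.snd
  have hlossm : Measurable fun ω : (X × Z) × A => B.loss ω.1.2 ω.2 :=
    hB.measurable_loss.comp (measurable_fst.snd.prodMk measurable_snd)
  have hae : ∀ᵐ o ∂(obsLaw B L m S Q), o.2.2 ∈ Set.Icc (0 : ℝ) 1 := by
    rw [obsLaw, ae_map_iff hB.measurable_observe.aemeasurable (hmeas measurableSet_Icc)]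
    exact Filter.Eventually.of_forall fun ω => hB.loss_mem _ _
  have hint : Integrable (fun o : Observation X A => o.2.2) (obsLaw B L m S Q) :=
    Integrable.of_bound hmeas.aestronglyMeasurable 1 (hae.mono fun o ho => by
      rw [Real.norm_eq_abs, abs_of_nonneg ho.1]; exact ho.2)
  rw [← ofReal_integral_eq_lintegral_ofReal hint (hae.mono fun o ho => ho.1)]
  apply ENNReal.ofReal_le_ofReal
  rw [hB.integral_obsLaw hL hQ hmeas]
  have hKi := hB.integrable_kernelDensity_mul_loss m
  have hli : Integrable (fun ω : (X × Z) × A => B.loss ω.1.2 ω.2) (dominatingLaw B) :=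
    Integrable.of_bound hlossm.aestronglyMeasurable 1 (Filter.Eventually.of_forall fun ω => by
      rw [Real.norm_eq_abs, abs_of_nonneg (hB.loss_mem _ _).1]; exact (hB.loss_mem _ _).2)
  have hl1 : ∫ ω, B.loss ω.1.2 ω.2 ∂(dominatingLaw B) ≤ 1 := by
    calc _ ≤ ∫ ω, (1 : ℝ) ∂(dominatingLaw B) :=
          integral_mono hli (integrable_const _) fun ω => (hB.loss_mem _ _).2
      _ = 1 := by simp
  have hsum0 : 0 ≤ ∑ i ∈ S, Q i * smoothedLoss B (bandwidth m) i :=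
    Finset.sum_nonneg fun i hi => mul_nonneg (hQ.1 i hi) (hB.smoothedLoss_nonneg _ i)
  have hsum : ∑ i ∈ S, Q i * smoothedLoss B (bandwidth m) i ≤ c := by
    calc _ ≤ ∑ i ∈ S, Q i * c :=
          Finset.sum_le_sum fun i hi => mul_le_mul_of_nonneg_left (hc i hi) (hQ.1 i hi)
      _ = c := by rw [← Finset.sum_mul, hQ.2, one_mul]
  calc ∫ ω, actionDensity B.toSetting L m S Q ω.1.1 ω.2 * (observe B ω).2.2 ∂(dominatingLaw B)
      = ∫ ω, (exploreProb L m * B.loss ω.1.2 ω.2 + (1 - exploreProb L m) * ∑ i ∈ S, Q i *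
          (kernelDensity B.toSetting (bandwidth m) (B.policy i ω.1.1) ω.2 * B.loss ω.1.2 ω.2))
          ∂(dominatingLaw B) := by
        refine integral_congr_ae (Filter.Eventually.of_forall fun ω => ?_)
        simp only [actionDensity, observe, add_mul, mul_assoc, Finset.sum_mul]
    _ = exploreProb L m * ∫ ω, B.loss ω.1.2 ω.2 ∂(dominatingLaw B) +
          (1 - exploreProb L m) * ∑ i ∈ S, Q i * smoothedLoss B (bandwidth m) i := by
        rw [integral_add (hli.const_mul _)
          ((integrable_finsetSum _ fun i _ => (hKi i).const_mul (Q i)).const_mul _),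
          integral_const_mul, integral_const_mul,
          integral_finsetSum _ fun i _ => (hKi i).const_mul (Q i)]
        simp only [integral_const_mul, hB.integral_kernelDensity_mul_loss]
    _ ≤ exploreProb L m + c := by nlinarith

end RegularBandit

/-! ### Accuracy of the medians of means in one epoch -/

section EpochConcentration

variable {X A ι Z : Type*} [MeasurableSpace X] [PseudoMetricSpace A] [MeasurableSpace A]
  [MeasurableSpace Z] {B : ContextualBandit X A ι Z} {L : ℝ} {T m : ℕ} {S : Finset ι}

theorem sum_map_mul_sub {O : Type*} (e : O → ℝ) (c a : ℝ) (l : List O) :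
    (l.map fun o => c * (e o - a)).sum = c * ((l.map e).sum - l.length * a) := by
  induction l with
  | nil => simp
  | cons o l ih =>
    simp only [List.map_cons, List.sum_cons, ih, List.length_cons]
    push_cast
    ring

/-- The deviation of the loss estimate of policy `i` from its mean, in units of half the radius
times the batch size. -/
def scaledDeviation (B : ContextualBandit X A ι Z) (L : ℝ) (m : ℕ) (S : Finset ι) (Q : ι → ℝ)
    (i : ι) (o : Observation X A) : ℝ :=
  2 / (batchSize B.toSetting L m S * radius L m) *
    (lossEstimate B.toSetting L m S Q i o - smoothedLoss B (bandwidth m) i)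

/-- The scaling makes a batch average off by more than r / 2 the same as a normalized batch sum
exceeding 1 in absolute value; a bad median forces this in half of the batches. -/
theorem two_pow_le_batchPotential_scaledDeviation (hL : 0 < L)
    (hbatch : 0 < batchSize B.toSetting L m S) (hk : 0 < numBatches B.toSetting T)
    {Q : ι → ℝ} {i : ι} {data : List (Observation X A)}
    (hlen : data.length = epochLength B.toSetting L T m S)
    (hdev : radius L m / 2 <
      |medianEstimate B.toSetting L T m S Q data i - smoothedLoss B (bandwidth m) i|) :
    2 ^ numBatches B.toSetting T ≤ batchPotential (scaledDeviation B L m S Q i)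
      (numBatches B.toSetting T) (batchSize B.toSetting L m S) data := by
  set n := batchSize B.toSetting L m S with hn
  set k := numBatches B.toSetting T with hk'
  have hr := radius_pos hL m
  have hn0 : (0 : ℝ) < n := by exact_mod_cast hbatch
  have hcard := card_le_two_mul_of_lt_abs_median_sub hk hdev
  refine two_pow_le_batchPotential (hcard.trans (Nat.mul_le_mul_left 2 (Finset.card_le_card ?_)))
  intro b hb
  simp only [Finset.mem_filter, Finset.mem_univ, true_and] at hb ⊢
  have hlen' : ((data.drop (b * n)).take n).length = n := by
    have h1 : ((b : ℕ) + 1) * n ≤ k * n := Nat.mul_le_mul_right n b.2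
    have h2 : data.length = n * k := hlen
    rw [List.length_take, List.length_drop, h2]
    apply min_eq_left
    rw [add_mul, one_mul, mul_comm k] at h1
    omega
  set s := (((data.drop (b * n)).take n).map (lossEstimate B.toSetting L m S Q i)).sum with hs
  set a := smoothedLoss B (bandwidth m) i
  have hsum : batchSum (scaledDeviation B L m S Q i) n b data = 2 / radius L m * (s / n - a) := by
    unfold batchSum scaledDeviation
    rw [sum_map_mul_sub, hlen', ← hn]
    field_simp
    rw [← hs]
  rw [hsum, abs_mul, abs_of_pos (by positivity)]
  calc (1 : ℝ) = 2 / radius L m * (radius L m / 2) := by field_simp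
    _ < _ := mul_lt_mul_of_pos_left hb (by positivity)

variable [BorelSpace A] [SecondCountableTopology A]

theorem ContextualBandit.IsRegular.measurable_scaledDeviation (hB : B.IsRegular) (L : ℝ) (m : ℕ)
    (S : Finset ι) (Q : ι → ℝ) (i : ι) : Measurable (scaledDeviation B L m S Q i) :=
  ((hB.setting.measurable_lossEstimate L m S Q i).sub_const _).const_mul _

theorem ContextualBandit.IsRegular.iterLIntegral_batchPotential_scaledDeviation_le [Nonempty A]
    (hB : B.IsRegular) (hL : 0 < L) {Q : ℕ → Finset ι → ι → ℝ} (hQ : IsSolver B.toSetting L Q)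
    (hm : 1 ≤ m) (hS : S ⊆ B.policies) (hbatch : 0 < batchSize B.toSetting L m S) {i : ι}
    (hi : i ∈ S) :
    iterLIntegral (obsLaw B L m S (Q m S)) (epochLength B.toSetting L T m S)
      (batchPotential (scaledDeviation B L m S (Q m S) i) (numBatches B.toSetting T)
        (batchSize B.toSetting L m S)) ≤ ENNReal.ofReal (43 / 40) ^ numBatches B.toSetting T := by
  have hQS := (hQ m hm S hS ⟨i, hi⟩).1
  have hprob := hB.isProbabilityMeasure_obsLaw (m := m) hL hQS
  have hLp := hB.memLp_lossEstimate (m := m) hL hQS i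
  have hmean := hB.integral_lossEstimate (m := m) hL hQS i
  have hsq := hB.integral_lossEstimate_sq_le hL hQ hm hS hi
  set e := lossEstimate B.toSetting L m S (Q m S) i
  set a := smoothedLoss B (bandwidth m) i with ha
  set n := batchSize B.toSetting L m S with hn
  set w := 2 * kernelSup B.toSetting (bandwidth m) * charVolume B.toSetting S (bandwidth m)
  have hn0 : (0 : ℝ) < n := by exact_mod_cast hbatch
  have hr := radius_pos hL m
  set c := 2 / (n * radius L m) with hc
  have hy : scaledDeviation B L m S (Q m S) i = fun o => c * (e o - a) := rfl
  have hLp' : MemLp (fun o => e o - a) 2 (obsLaw B L m S (Q m S)) := hLp.sub (memLp_const a)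
  have h0 : ∫ o, c * (e o - a) ∂(obsLaw B L m S (Q m S)) = 0 := by
    rw [integral_const_mul, integral_sub (hLp.integrable (by norm_num)) (integrable_const _),
      hmean]
    simp
  have hv : ∫ o, (c * (e o - a)) ^ 2 ∂(obsLaw B L m S (Q m S)) ≤ c ^ 2 * w := by
    have e1 : ∀ o, (c * (e o - a)) ^ 2 = c ^ 2 * ((e o ^ 2 - 2 * a * e o) + a ^ 2) :=
      fun o => by ring
    have i1 : Integrable (fun o => e o ^ 2) (obsLaw B L m S (Q m S)) := hLp.integrable_sq
    have i2 : Integrable e (obsLaw B L m S (Q m S)) := hLp.integrable (by norm_num)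
    have i3 : Integrable (fun o => e o ^ 2 - 2 * a * e o) (obsLaw B L m S (Q m S)) :=
      i1.sub (i2.const_mul _)
    simp_rw [e1]
    rw [integral_const_mul, integral_add i3 (integrable_const _),
      integral_sub i1 (i2.const_mul _), integral_const_mul, hmean]
    -- The variance is at most the second moment.
    refine mul_le_mul_of_nonneg_left ?_ (sq_nonneg c)
    simp only [integral_const, probReal_univ, one_smul]
    nlinarith [sq_nonneg a]
  have hfin := iterLIntegral_batchPotential_le (hLp'.const_mul c) h0 hv
    (numBatches B.toSetting T) n
  rw [hy, epochLength, mul_comm]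
  refine hfin.trans (pow_le_pow_left₀ (by simp) (ENNReal.ofReal_le_ofReal ?_) _)
  -- With w = 2 κ V the prescribed batch size is at least 160 w / r², so the batch variance n c² w =
  -- 4 w / (n r²) is at most 1 / 40, and 1 + 3 / 40 = 43 / 40.
  have hnle : 160 * w / radius L m ^ 2 ≤ n := by
    have := Nat.le_ceil (320 * kernelSup B.toSetting (bandwidth m) *
      charVolume B.toSetting S (bandwidth m) / radius L m ^ 2)
    calc (160 * w / radius L m ^ 2 : ℝ) = 320 * kernelSup B.toSetting (bandwidth m) *
          charVolume B.toSetting S (bandwidth m) / radius L m ^ 2 := by simp only [w]; ring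
      _ ≤ n := this
  have h2 : (n : ℝ) * (c ^ 2 * w) = (4 * w / radius L m ^ 2) / n := by
    rw [hc]; field_simp; ring
  have h3 : (4 * w / radius L m ^ 2) / n ≤ 1 / 40 := by
    rw [div_le_iff₀ hn0]
    have : 4 * w / radius L m ^ 2 = (1 / 40) * (160 * w / radius L m ^ 2) := by ring
    rw [this]
    exact mul_le_mul_of_nonneg_left hnle (by norm_num)
  linarith

end EpochConcentration

/-! ### The expected loss as a recursion on the memory -/

section Recursion

variable {X A ι Z : Type*} [MeasurableSpace X] [PseudoMetricSpace A] [MeasurableSpace A]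
  [MeasurableSpace Z] {B : ContextualBandit X A ι Z} {L : ℝ} {T m : ℕ} {S : Finset ι}
  {Q : ℕ → Finset ι → ι → ℝ}

/-- The expected total loss of the algorithm over the next `n` rounds, given its memory. -/
def memoryLoss (B : ContextualBandit X A ι Z) (L : ℝ) (T : ℕ) (Q : ℕ → Finset ι → ι → ℝ) :
    ℕ → Memory X A ι → ℝ≥0∞
  | 0, _ => 0
  | n + 1, s =>
    ∫⁻ x, ∫⁻ z, ∫⁻ a, (ENNReal.ofReal (B.loss z a) +
      memoryLoss B L T Q n (updateMemory B.toSetting L T Q s (x, a, B.loss z a)))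
      ∂(B.base.withDensity fun a => ENNReal.ofReal
        (actionDensity B.toSetting L s.epoch s.active (Q s.epoch s.active) x a))
      ∂(B.lossLaw x) ∂B.ctxLaw

/-- The learner sees the history only through its memory, which is a left fold and so is updated one
observation at a time. -/
theorem expectedLoss_eq_memoryLoss (n : ℕ) (hist : List (Observation X A)) :
    expectedLoss B (smoothPolicyEliminationL B.toSetting L T Q) n hist =
      memoryLoss B L T Q n (memory B.toSetting L T Q hist) := by
  induction n generalizing hist with
  | zero => rfl
  | succ n ih =>
    simp only [expectedLoss, memoryLoss, ih, memory, List.foldl_append, List.foldl_cons,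
      List.foldl_nil]
    rfl

theorem eliminate_subset (D : Setting X A ι) (L : ℝ) (T m : ℕ) (S : Finset ι) (Q : ι → ℝ)
    (data : List (Observation X A)) : eliminate D L T m S Q data ⊆ S :=
  Finset.filter_subset _ _

theorem eliminate_nonempty (D : Setting X A ι) (hL : 0 < L) (T m : ℕ) (hS : S.Nonempty)
    (Q : ι → ℝ) (data : List (Observation X A)) : (eliminate D L T m S Q data).Nonempty := by
  obtain ⟨i, hi, hmin⟩ := S.exists_min_image (medianEstimate D L T m S Q data) hS
  refine ⟨i, Finset.mem_filter.2 ⟨hi, fun j hj => ?_⟩⟩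
  linarith [hmin j hj, radius_pos hL m]

variable [BorelSpace A] [SecondCountableTopology A]

/-- The continuation loss `F` passes through medians and eliminations; requiring measurability only
of a majorant `ψ` spares any study of `F`. -/
theorem ContextualBandit.IsRegular.lintegral_round_le (hB : B.IsRegular) {Q : ι → ℝ}
    {F ψ : Observation X A → ℝ≥0∞} (hψ : Measurable ψ) (hF : ∀ o, F o ≤ ψ o) :
    ∫⁻ x, ∫⁻ z, ∫⁻ a, (ENNReal.ofReal (B.loss z a) + F (x, a, B.loss z a))
      ∂(B.base.withDensity fun a => ENNReal.ofReal (actionDensity B.toSetting L m S Q x a))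
      ∂(B.lossLaw x) ∂B.ctxLaw ≤
      ∫⁻ o, ENNReal.ofReal o.2.2 ∂(obsLaw B L m S Q) + ∫⁻ o, ψ o ∂(obsLaw B L m S Q) := by
  have hm : Measurable fun o : Observation X A => ENNReal.ofReal o.2.2 :=
    measurable_snd.snd.ennreal_ofReal
  have hmψ : Measurable fun o : Observation X A => ENNReal.ofReal o.2.2 + ψ o := hm.add hψ
  rw [← lintegral_add_left hm, hB.lintegral_obsLaw hmψ]
  exact lintegral_mono fun x => lintegral_mono fun z => lintegral_mono fun a =>
    add_le_add_right (hF _) _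

theorem ContextualBandit.IsRegular.lintegral_loss_obsLaw_le_one (hB : B.IsRegular) (hL : 0 < L)
    {Q : ι → ℝ} (hQ : Q ∈ distributionsOn S) :
    ∫⁻ o, ENNReal.ofReal o.2.2 ∂(obsLaw B L m S Q) ≤ 1 := by
  have hprob := hB.isProbabilityMeasure_obsLaw (m := m) hL hQ
  have hm : Measurable fun o : Observation X A => ENNReal.ofReal o.2.2 :=
    measurable_snd.snd.ennreal_ofReal
  rw [obsLaw, lintegral_map hm hB.measurable_observe]
  calc _ ≤ ∫⁻ ω, (fun _ => 1) (observe B ω) ∂_ :=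
        lintegral_mono fun ω => ENNReal.ofReal_le_one.2 (hB.loss_mem _ _).2
    _ = ∫⁻ o, 1 ∂(obsLaw B L m S Q) :=
        (lintegral_map measurable_const hB.measurable_observe).symm
    _ = 1 := by simp

/-- The trivial bound, paid after a failed epoch. It survives any elimination because the active set
stays nonempty, so the weights remain a distribution. -/
theorem ContextualBandit.IsRegular.memoryLoss_le (hB : B.IsRegular) (hL : 0 < L)
    (hQ : IsSolver B.toSetting L Q) (n : ℕ) (s : Memory X A ι) (hm : 1 ≤ s.epoch)
    (hS : s.active ⊆ B.policies) (hS' : s.active.Nonempty) : memoryLoss B L T Q n s ≤ n := by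
  induction n generalizing s with
  | zero => simp [memoryLoss]
  | succ n ih =>
    have hQS := (hQ _ hm _ hS hS').1
    have hprob := hB.isProbabilityMeasure_obsLaw (m := s.epoch) hL hQS
    refine (hB.lintegral_round_le (ψ := fun _ => (n : ℝ≥0∞)) measurable_const
      (F := fun o => memoryLoss B L T Q n (updateMemory B.toSetting L T Q s o)) fun o => ?_).trans
      ((add_le_add_left (hB.lintegral_loss_obsLaw_le_one hL hQS) _).trans_eq
        (by simp [add_comm]))
    unfold updateMemory
    split_ifs
    · exact ih _ (by simp) ((eliminate_subset ..).trans hS) (eliminate_nonempty _ hL _ _ hS' _ _)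
    · exact ih _ hm hS hS'

theorem ContextualBandit.IsRegular.memoryLoss_le_of_lt_epochLength (hB : B.IsRegular) (hL : 0 < L)
    (hQ : IsSolver B.toSetting L Q) (hm : 1 ≤ m) (hS : S ⊆ B.policies) (hS' : S.Nonempty) (n : ℕ)
    (data : List (Observation X A)) (hn : data.length + n < epochLength B.toSetting L T m S) :
    memoryLoss B L T Q n ⟨m, S, data⟩ ≤
      n * ∫⁻ o, ENNReal.ofReal o.2.2 ∂(obsLaw B L m S (Q m S)) := by
  have hprob := hB.isProbabilityMeasure_obsLaw (m := m) hL (hQ m hm S hS hS').1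
  induction n generalizing data with
  | zero => simp [memoryLoss]
  | succ n ih =>
    refine (hB.lintegral_round_le measurable_const
      (F := fun o => memoryLoss B L T Q n (updateMemory B.toSetting L T Q ⟨m, S, data⟩ o))
      (ψ := fun _ => n * ∫⁻ o, ENNReal.ofReal o.2.2 ∂(obsLaw B L m S (Q m S)))
      fun o => ?_).trans (le_of_eq ?_)
    · rw [updateMemory, if_neg (by simp; omega)]
      exact ih _ (by simp; omega)
    · simp; ring

/-- Within an epoch the action law is fixed, so its observations are independent draws from one law;
here `k + 1` rounds of the epoch remain and `r` rounds follow it. -/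
theorem ContextualBandit.IsRegular.memoryLoss_le_iterLIntegral (hB : B.IsRegular) (hL : 0 < L)
    (hQ : IsSolver B.toSetting L Q) (hm : 1 ≤ m) (hS : S ⊆ B.policies) (hS' : S.Nonempty)
    (r k : ℕ) {G : List (Observation X A) → ℝ≥0∞} (hG : ListMeasurable G)
    (hle : ∀ data, data.length = epochLength B.toSetting L T m S →
      memoryLoss B L T Q r ⟨m + 1, eliminate B.toSetting L T m S (Q m S) data, []⟩ ≤ G data)
    (data : List (Observation X A))
    (hn : data.length + (k + 1) = epochLength B.toSetting L T m S) :
    memoryLoss B L T Q (r + k + 1) ⟨m, S, data⟩ ≤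
      (k + 1 : ℕ) * ∫⁻ o, ENNReal.ofReal o.2.2 ∂(obsLaw B L m S (Q m S)) +
        iterLIntegral (obsLaw B L m S (Q m S)) (k + 1) fun l => G (data ++ l) := by
  have hprob := hB.isProbabilityMeasure_obsLaw (m := m) hL (hQ m hm S hS hS').1
  induction k generalizing data with
  | zero =>
    refine (hB.lintegral_round_le (hG.measurable_snoc data)
      (F := fun o => memoryLoss B L T Q r (updateMemory B.toSetting L T Q ⟨m, S, data⟩ o))
      fun o => ?_).trans (le_of_eq ?_)
    -- The last observation fills the epoch exactly, which triggers the elimination.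
    · rw [updateMemory, if_pos (by simp; omega)]
      exact hle _ (by simp; omega)
    · simp [iterLIntegral]
  | succ k ih =>
    have hmeas : Measurable fun o => iterLIntegral (obsLaw B L m S (Q m S)) (k + 1)
        fun l => G ((data ++ [o]) ++ l) :=
      (hG.iterLIntegral_append (P := obsLaw B L m S (Q m S)) (k + 1)).measurable_snoc data
    refine (hB.lintegral_round_le
      (F := fun o => memoryLoss B L T Q (r + k + 1)
        (updateMemory B.toSetting L T Q ⟨m, S, data⟩ o))
      (hmeas.const_add ((k + 1 : ℕ) * ∫⁻ o, ENNReal.ofReal o.2.2 ∂(obsLaw B L m S (Q m S))))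
      fun o => ?_).trans (le_of_eq ?_)
    · rw [updateMemory, if_neg (by simp; omega)]
      exact ih _ (by simp; omega)
    · rw [lintegral_add_left measurable_const]
      simp only [iterLIntegral, List.append_assoc, List.singleton_append, lintegral_const,
        measure_univ, mul_one]
      push_cast
      ring

end Recursion

/-! ### Size of the number of batches -/

section NumBatches

variable {X A ι : Type*} [MeasurableSpace X] [MeasurableSpace A] {T : ℕ}

theorem numBatches_pos (D : Setting X A ι) (hT : 2 ≤ T) (hD : D.policies.Nonempty) :
    0 < numBatches D T := by
  have hT' : (2 : ℝ) ≤ T := by exact_mod_cast hT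
  have hc : (1 : ℝ) ≤ D.policies.card := by exact_mod_cast hD.card_pos
  have hlog : 1 ≤ Real.logb 2 T := by
    rw [Real.le_logb_iff_rpow_le (by norm_num) (by linarith)]; simpa using hT'
  refine Nat.mul_pos (by norm_num) (Nat.ceil_pos.2 (Real.log_pos ?_))
  nlinarith [mul_le_mul hT' hc (by norm_num) (by linarith)]

theorem le_mul_card_mul_logb (D : Setting X A ι) (hT : 2 ≤ T) :
    (T : ℝ) * D.policies.card ≤ (T : ℝ) * D.policies.card * Real.logb 2 T := by
  have hT' : (2 : ℝ) ≤ T := by exact_mod_cast hT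
  have hlog : 1 ≤ Real.logb 2 T := by
    rw [Real.le_logb_iff_rpow_le (by norm_num) (by linarith)]; simpa using hT'
  exact le_mul_of_one_le_right (by positivity) hlog

/-- The number of batches makes the total failure probability negligible. -/
theorem card_mul_pow_numBatches_le (D : Setting X A ι) (hT : 2 ≤ T) (hD : D.policies.Nonempty) :
    D.policies.card * (43 / 80 : ℝ) ^ numBatches D T ≤ 1 / (T : ℝ) ^ 2 := by
  have hT' : (2 : ℝ) ≤ T := by exact_mod_cast hT
  have hc : (1 : ℝ) ≤ D.policies.card := by exact_mod_cast hD.card_pos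
  have hy := le_mul_card_mul_logb D hT
  set P : ℝ := (D.policies.card : ℝ) with hP
  set y := (T : ℝ) * P * Real.logb 2 T with hydef
  have hTP : 0 < (T : ℝ) * P := by positivity
  -- This is where the factor 5 in the number of batches acts: five batches gain e⁻², hence all of
  -- them gain (T |Π|)⁻².
  have hexp : (43 / 80 : ℝ) ^ 5 ≤ Real.exp (-2) := by
    have h1 : Real.exp 1 < 2.7182818286 := Real.exp_one_lt_d9
    have h2 : Real.exp 2 = Real.exp 1 ^ 2 := by rw [← Real.exp_nat_mul]; norm_num
    have h3 : Real.exp 2 ≤ 8 := by rw [h2]; nlinarith [Real.exp_pos 1]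
    rw [Real.exp_neg]
    calc (43 / 80 : ℝ) ^ 5 ≤ 8⁻¹ := by norm_num
      _ ≤ (Real.exp 2)⁻¹ := inv_anti₀ (Real.exp_pos 2) h3
  have hpow : (43 / 80 : ℝ) ^ numBatches D T ≤ 1 / ((T : ℝ) * P) ^ 2 := by
    calc (43 / 80 : ℝ) ^ numBatches D T = ((43 / 80 : ℝ) ^ 5) ^ ⌈Real.log y⌉₊ := by
          rw [← pow_mul]; rfl
      _ ≤ Real.exp (-2) ^ ⌈Real.log y⌉₊ := pow_le_pow_left₀ (by norm_num) hexp _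
      _ = Real.exp (-2 * ⌈Real.log y⌉₊) := by rw [mul_comm, ← Real.exp_nat_mul]
      _ ≤ Real.exp (-2 * Real.log ((T : ℝ) * P)) := by
          refine Real.exp_le_exp.2 ?_
          have h1 := Nat.le_ceil (Real.log y)
          have h2 := Real.log_le_log hTP hy
          linarith
      _ = 1 / ((T : ℝ) * P) ^ 2 := by
          rw [neg_mul, Real.exp_neg, one_div, two_mul, Real.exp_add, Real.exp_log hTP, sq]
  calc P * (43 / 80 : ℝ) ^ numBatches D T ≤ P * (1 / ((T : ℝ) * P) ^ 2) :=
        mul_le_mul_of_nonneg_left hpow (by positivity)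
    _ = 1 / (T : ℝ) ^ 2 / P := by field_simp
    _ ≤ 1 / (T : ℝ) ^ 2 := div_le_self (by positivity) hc

/-- As log₂ T ≤ T, the count is at most 5 (2 log T + log |Π| + 1); then 1 ≤ 2 log T absorbs
everything into a single product. -/
theorem numBatches_le (D : Setting X A ι) (hT : 2 ≤ T) (hD : D.policies.Nonempty) :
    (numBatches D T : ℝ) ≤ 30 * Real.log T * max 1 (Real.log D.policies.card) := by
  have hT' : (2 : ℝ) ≤ T := by exact_mod_cast hT
  have hc : (1 : ℝ) ≤ D.policies.card := by exact_mod_cast hD.card_pos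
  have hy := le_mul_card_mul_logb D hT
  set P : ℝ := (D.policies.card : ℝ) with hP
  have hlogT : 1 / 2 ≤ Real.log T := by
    have := Real.log_le_log (by norm_num) hT'
    linarith [Real.log_two_gt_d9]
  have hb : 1 ≤ Real.logb 2 T := by
    rw [Real.le_logb_iff_rpow_le (by norm_num) (by linarith)]; simpa using hT'
  have hb2 : Real.logb 2 T ≤ T := by
    rw [Real.logb_le_iff_le_rpow (by norm_num) (by linarith), Real.rpow_natCast]
    exact_mod_cast (Nat.lt_two_pow_self).le
  have hlog : Real.log (T * P * Real.logb 2 T) ≤ 2 * Real.log T + Real.log P := by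
    rw [Real.log_mul (by positivity) (by positivity), Real.log_mul (by positivity) (by positivity)]
    have := Real.log_le_log (by linarith) hb2
    linarith
  have hnn : 0 ≤ Real.log (T * P * Real.logb 2 T) :=
    Real.log_nonneg (by nlinarith [mul_le_mul hT' hc (by norm_num) (by linarith)])
  have hceil := (Nat.ceil_lt_add_one hnn).le
  have e : (numBatches D T : ℝ) = 5 * (⌈Real.log (T * P * Real.logb 2 T)⌉₊ : ℝ) := by
    simp [numBatches, hP]
  rw [e]
  set M := max 1 (Real.log P)
  have hM1 : 1 ≤ M := le_max_left _ _
  have hM2 : Real.log P ≤ M := le_max_right _ _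
  nlinarith

end NumBatches

/-! ### Elimination and the regret over all epochs -/

section RegretBound

variable {X A ι Z : Type*} [MeasurableSpace X] [PseudoMetricSpace A] [MeasurableSpace A]
  [MeasurableSpace Z] {B : ContextualBandit X A ι Z} {L : ℝ} {T m : ℕ} {S : Finset ι}
  {Q : ℕ → Finset ι → ι → ℝ} {istar : ι}

/-- The policy set `S` contains the policy `istar`, and the losses of its members exceed that of
`istar` by at most `12` times the radius of epoch `m`. -/
structure IsGood (B : ContextualBandit X A ι Z) (L : ℝ) (istar : ι) (m : ℕ) (S : Finset ι) :
    Prop where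
  subset : S ⊆ B.policies
  mem : istar ∈ S
  le : ∀ i ∈ S, smoothedLoss B 0 i ≤ smoothedLoss B 0 istar + 12 * radius L m

/-- The policy `istar` is optimal, and smoothing with the bandwidth of any epoch changes the loss
of a policy by at most the radius of that epoch. -/
structure IsOptimalLipschitz (B : ContextualBandit X A ι Z) (L : ℝ) (istar : ι) : Prop where
  mem : istar ∈ B.policies
  optimal : ∀ i ∈ B.policies, smoothedLoss B 0 istar ≤ smoothedLoss B 0 i
  bias : ∀ i ∈ B.policies, ∀ m : ℕ, 1 ≤ m →
    |smoothedLoss B (bandwidth m) i - smoothedLoss B 0 i| ≤ radius L m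

theorem radius_succ (L : ℝ) (m : ℕ) : radius L (m + 1) = radius L m / 2 := by
  unfold radius; rw [pow_succ]; field_simp

/-- Each estimate errs by r / 2 and each bias by r. Comparing two policies costs 3 r, exactly the
tolerance, so `istar` survives. A survivor has excess at most 3 r + 3 r = 6 r, which is 12 times the
next radius. -/
theorem IsGood.eliminate (hopt : IsOptimalLipschitz B L istar) (hL : 0 < L)
    (hS : IsGood B L istar m S) (hm : 1 ≤ m) {Q : ι → ℝ} {data : List (Observation X A)}
    (hdev : ∀ i ∈ S, |medianEstimate B.toSetting L T m S Q data i -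
      smoothedLoss B (bandwidth m) i| ≤ radius L m / 2) :
    IsGood B L istar (m + 1) (eliminate B.toSetting L T m S Q data) := by
  have hsub := eliminate_subset B.toSetting L T m S Q data
  have hr := radius_pos hL m
  refine ⟨hsub.trans hS.subset, Finset.mem_filter.2 ⟨hS.mem, fun j hj => ?_⟩, fun i hi => ?_⟩
  · have h1 := abs_le.1 (hdev istar hS.mem)
    have h2 := abs_le.1 (hdev j hj)
    have h3 := abs_le.1 (hopt.bias istar hopt.mem m hm)
    have h4 := abs_le.1 (hopt.bias j (hS.subset hj) m hm)
    have h5 := hopt.optimal j (hS.subset hj)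
    linarith [h1.1, h1.2, h2.1, h2.2, h3.1, h3.2, h4.1, h4.2]
  · have hi' := (Finset.mem_filter.1 hi).2 istar hS.mem
    have h1 := abs_le.1 (hdev istar hS.mem)
    have h2 := abs_le.1 (hdev i (hsub hi))
    have h3 := abs_le.1 (hopt.bias istar hopt.mem m hm)
    have h4 := abs_le.1 (hopt.bias i (hS.subset (hsub hi)) m hm)
    rw [radius_succ]
    linarith [h1.1, h1.2, h2.1, h2.2, h3.1, h3.2, h4.1, h4.2]

variable [BorelSpace A] [SecondCountableTopology A]

/-- A kernel of total mass 1 cannot vanish almost everywhere. Consequently every epoch has at least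
one round, on which the recursion over epochs depends. -/
theorem Setting.IsRegular.charVolume_pos {D : Setting X A ι} (hD : D.IsRegular) (m : ℕ)
    (hS : S.Nonempty) : 0 < charVolume D S (bandwidth m) := by
  have := hD.isProbabilityMeasure_base
  have := hD.isProbabilityMeasure_ctxLaw
  obtain ⟨i, hi⟩ := hS
  rw [← hD.real_exists_policyDensity_ne_zero]
  by_contra! h
  have h0 := le_antisymm h measureReal_nonneg
  rw [measureReal_eq_zero_iff] at h0
  have hae : policyDensity D m S ⟨i, hi⟩ =ᵐ[D.ctxLaw.prod D.base] 0 := by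
    refine measure_mono_null (fun p hp => ?_) h0
    exact ⟨⟨i, hi⟩, hp⟩
  have hint : Integrable (policyDensity D m S ⟨i, hi⟩) (D.ctxLaw.prod D.base) :=
    Integrable.of_bound (hD.measurable_policyDensity m S _).aestronglyMeasurable _
      (Filter.Eventually.of_forall fun p => hD.abs_policyDensity_le m S _ p)
  have h1 : ∫ p, policyDensity D m S ⟨i, hi⟩ p ∂(D.ctxLaw.prod D.base) = 1 := by
    rw [integral_prod _ hint]
    simp [policyDensity, hD.integral_kernelDensity (bandwidth_pos m)]
  rw [integral_congr_ae hae] at h1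
  simp at h1

theorem Setting.IsRegular.batchSize_pos [Nonempty A] {D : Setting X A ι} (hD : D.IsRegular)
    (hL : 0 < L) (m : ℕ) (hS : S.Nonempty) : 0 < batchSize D L m S := by
  have h1 := hD.kernelSup_pos (bandwidth_pos m)
  have h2 := hD.charVolume_pos m hS
  have h3 := radius_pos hL m
  exact Nat.ceil_pos.2 (by positivity)

/-- The 14 is 12 for the excess of active policies, 1 for the smoothing bias and 1 for exploration.
-/
theorem ContextualBandit.IsRegular.lintegral_loss_obsLaw_le_of_isGood [Nonempty A]
    (hB : B.IsRegular) (hL : 0 < L) (hQ : IsSolver B.toSetting L Q)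
    (hopt : IsOptimalLipschitz B L istar) (hm : 1 ≤ m) (hS : IsGood B L istar m S) :
    ∫⁻ o, ENNReal.ofReal o.2.2 ∂(obsLaw B L m S (Q m S)) ≤
      ENNReal.ofReal (smoothedLoss B 0 istar + min 1 (14 * radius L m)) := by
  have hQS := (hQ m hm S hS.subset ⟨istar, hS.mem⟩).1
  have h0 := hB.smoothedLoss_nonneg 0 istar
  rw [← min_add_add_left, ENNReal.ofReal_min]
  refine le_min ?_ ?_
  · refine (hB.lintegral_loss_obsLaw_le_one hL hQS).trans ?_
    rw [ENNReal.one_le_ofReal]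
    linarith
  · refine (hB.lintegral_loss_obsLaw_le (c := smoothedLoss B 0 istar + 13 * radius L m) hL hQS
      fun i hi => ?_).trans (ENNReal.ofReal_le_ofReal ?_)
    · have h1 := (abs_le.1 (hopt.bias i (hS.subset hi) m hm)).2
      have h2 := hS.le i hi
      linarith
    · have : exploreProb L m ≤ radius L m := min_le_right _ _
      linarith

/-- The expected loss from the start of an epoch that is completed, in terms of a bound for the
expected loss from the start of the next epoch with a good policy set. -/
theorem ContextualBandit.IsRegular.memoryLoss_epoch_le [Nonempty A]
    (hB : B.IsRegular) (hL : 0 < L) (hQ : IsSolver B.toSetting L Q)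
    (hopt : IsOptimalLipschitz B L istar) (hT : 2 ≤ T) (hm : 1 ≤ m) (hS : IsGood B L istar m S)
    {r : ℕ} {H : ℝ≥0∞}
    (hH : ∀ S', IsGood B L istar (m + 1) S' → memoryLoss B L T Q r ⟨m + 1, S', []⟩ ≤ H) :
    memoryLoss B L T Q (r + epochLength B.toSetting L T m S) ⟨m, S, []⟩ ≤
      epochLength B.toSetting L T m S *
        ENNReal.ofReal (smoothedLoss B 0 istar + min 1 (14 * radius L m)) +
      (H + r * ENNReal.ofReal (1 / (T : ℝ) ^ 2)) := by
  have hne : S.Nonempty := ⟨istar, hS.mem⟩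
  have hQS := (hQ m hm S hS.subset hne).1
  have hprob := hB.isProbabilityMeasure_obsLaw (m := m) hL hQS
  have hbatch := hB.setting.batchSize_pos hL m hne
  have hk := numBatches_pos B.toSetting hT ⟨istar, hopt.mem⟩
  set k := numBatches B.toSetting T with hkdef
  set P := obsLaw B L m S (Q m S) with hPdef
  set N := epochLength B.toSetting L T m S with hN
  have hNpos : 0 < N := Nat.mul_pos hbatch hk
  set Φ : ι → List (Observation X A) → ℝ≥0∞ := fun i =>
    batchPotential (scaledDeviation B L m S (Q m S) i) k (batchSize B.toSetting L m S) with hΦ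
  have hΦm : ∀ i, ListMeasurable (Φ i) := fun i =>
    listMeasurable_batchPotential (hB.measurable_scaledDeviation L m S _ i) _ _
  -- A Markov-type majorant: `H` covers accurate medians, and if the median of policy `i` fails then
  -- 2⁻ᵏ Φ i ≥ 1, so the second term covers the trivial loss `r`.
  set G : List (Observation X A) → ℝ≥0∞ := fun l => H + (r * 2⁻¹ ^ k) * ∑ i ∈ S, Φ i l with hG
  have hGm : ListMeasurable G := (listMeasurable_const H).add
    ((ListMeasurable.sum fun i _ => hΦm i).const_mul _)
  have hle : ∀ data, data.length = N →
      memoryLoss B L T Q r ⟨m + 1, eliminate B.toSetting L T m S (Q m S) data, []⟩ ≤ G data := by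
    intro data hdata
    by_cases hdev : ∀ i ∈ S, |medianEstimate B.toSetting L T m S (Q m S) data i -
        smoothedLoss B (bandwidth m) i| ≤ radius L m / 2
    · exact (hH _ (hS.eliminate hopt hL hm hdev)).trans le_self_add
    · push Not at hdev
      obtain ⟨i, hi, hdev⟩ := hdev
      have h1 : (2 : ℝ≥0∞) ^ k ≤ Φ i data :=
        two_pow_le_batchPotential_scaledDeviation hL hbatch hk hdata hdev
      have h2 : Φ i data ≤ ∑ i ∈ S, Φ i data :=
        Finset.single_le_sum (f := fun i => Φ i data) (fun _ _ => by simp) hi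
      calc _ ≤ (r : ℝ≥0∞) := hB.memoryLoss_le hL hQ r _ (by simp)
            ((eliminate_subset ..).trans hS.subset) (eliminate_nonempty _ hL _ _ hne _ _)
        _ = (r * 2⁻¹ ^ k) * 2 ^ k := by
            rw [mul_assoc, ← mul_pow, ENNReal.inv_mul_cancel (by simp) (by simp), one_pow, mul_one]
        _ ≤ (r * 2⁻¹ ^ k) * ∑ i ∈ S, Φ i data := mul_le_mul_right (h1.trans h2) _
        _ ≤ G data := le_add_self
  have hmain := hB.memoryLoss_le_iterLIntegral hL hQ hm hS.subset hne r (N - 1) hGm hle []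
    (by simp only [List.length_nil]; omega)
  rw [show r + (N - 1) + 1 = r + N by omega, show N - 1 + 1 = N by omega] at hmain
  refine hmain.trans (add_le_add (mul_le_mul_right
    (hB.lintegral_loss_obsLaw_le_of_isGood hL hQ hopt hm hS) _) ?_)
  simp only [List.nil_append, hG]
  have hcoef : (r : ℝ≥0∞) * 2⁻¹ ^ k ≠ ∞ :=
    ENNReal.mul_ne_top (by simp) (ENNReal.pow_ne_top (by simp))
  rw [iterLIntegral_add (listMeasurable_const H), iterLIntegral_const,
    iterLIntegral_const_mul _ hcoef, iterLIntegral_sum S fun i _ => hΦm i]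
  refine add_le_add_right ?_ _
  rw [mul_assoc]
  refine mul_le_mul_right ?_ _
  calc 2⁻¹ ^ k * ∑ i ∈ S, iterLIntegral P N (Φ i)
      ≤ 2⁻¹ ^ k * ∑ i ∈ S, ENNReal.ofReal (43 / 40) ^ k := by
        refine mul_le_mul_right (Finset.sum_le_sum fun i hi => ?_) _
        exact hB.iterLIntegral_batchPotential_scaledDeviation_le hL hQ hm hS.subset hbatch hi
    _ = S.card * ENNReal.ofReal (43 / 80) ^ k := by
        -- The normalization 2⁻ᵏ turns the moment bound (43 / 40)ᵏ into (43 / 80)ᵏ.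
        have : ENNReal.ofReal (43 / 80) = 2⁻¹ * ENNReal.ofReal (43 / 40) := by
          rw [show (2 : ℝ≥0∞)⁻¹ = ENNReal.ofReal 2⁻¹ by
            rw [ENNReal.ofReal_inv_of_pos (by norm_num)]; simp,
            ← ENNReal.ofReal_mul (by norm_num)]
          norm_num
        rw [this, mul_pow, Finset.sum_const, nsmul_eq_mul]
        ring
    _ ≤ B.policies.card * ENNReal.ofReal (43 / 80) ^ k :=
        mul_le_mul_left (by exact_mod_cast Finset.card_le_card hS.subset) _
    _ = ENNReal.ofReal (B.policies.card * (43 / 80 : ℝ) ^ k) := by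
        rw [ENNReal.ofReal_mul (by positivity), ENNReal.ofReal_pow (by norm_num)]
        simp
    _ ≤ ENNReal.ofReal (1 / (T : ℝ) ^ 2) :=
        ENNReal.ofReal_le_ofReal
          (card_mul_pow_numBatches_le B.toSetting hT ⟨istar, hopt.mem⟩)

/-- The expected loss from the start of an epoch with a good policy set, in terms of bounds `b`
for the regret of the epochs up to epoch `m₀`. -/
theorem ContextualBandit.IsRegular.memoryLoss_le_of_isGood [Nonempty A]
    (hB : B.IsRegular) (hL : 0 < L) (hQ : IsSolver B.toSetting L Q)
    (hopt : IsOptimalLipschitz B L istar) (hT : 2 ≤ T) {b : ℕ → ℝ} (hb0 : ∀ m, 0 ≤ b m)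
    (hb : ∀ m, 1 ≤ m → ∀ S, IsGood B L istar m S →
      min 1 (14 * radius L m) * epochLength B.toSetting L T m S ≤ b m)
    (m₀ n : ℕ) (hn : n ≤ T) (m : ℕ) (hm : 1 ≤ m) (S : Finset ι) (hS : IsGood B L istar m S) :
    memoryLoss B L T Q n ⟨m, S, []⟩ ≤ ENNReal.ofReal (n * smoothedLoss B 0 istar +
      ∑ j ∈ Finset.Ico m (m₀ + 1), b j + n * min 1 (14 * radius L (m₀ + 1)) + n / T) := by
  induction n using Nat.strong_induction_on generalizing m S with
  | _ n ih =>
  have hne : S.Nonempty := ⟨istar, hS.mem⟩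
  have hlam := hB.smoothedLoss_nonneg 0 istar
  set lam := smoothedLoss B 0 istar
  set g : ℕ → ℝ := fun m => min 1 (14 * radius L m) with hg
  have hg0 : ∀ m, 0 ≤ g m := fun m => le_min zero_le_one
    (mul_nonneg (by norm_num) (radius_pos hL m).le)
  have hganti : Antitone g := by
    refine antitone_nat_of_succ_le fun m => min_le_min le_rfl ?_
    rw [radius_succ]
    linarith [radius_pos hL m]
  have hT0 : (0 : ℝ) < T := by exact_mod_cast (by omega : 0 < T)
  have hsum0 : ∀ a c, 0 ≤ ∑ j ∈ Finset.Ico a c, b j := fun a c =>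
    Finset.sum_nonneg fun j _ => hb0 j
  set N := epochLength B.toSetting L T m S with hN
  have hNpos : 0 < N := Nat.mul_pos (hB.setting.batchSize_pos hL m hne)
    (numBatches_pos B.toSetting hT ⟨istar, hopt.mem⟩)
  -- Rounds of an epoch up to `m₀` are charged to `b m`; rounds of later epochs are charged
  -- individually at the rate of epoch `m₀ + 1`.
  have hstep : ∀ c : ℕ, c ≤ N → c * g m + ∑ j ∈ Finset.Ico (m + 1) (m₀ + 1), b j ≤
      ∑ j ∈ Finset.Ico m (m₀ + 1), b j + c * g (m₀ + 1) := by
    intro c hc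
    have hc' : (c : ℝ) ≤ N := by exact_mod_cast hc
    by_cases hmm : m ≤ m₀
    · rw [Finset.sum_eq_sum_Ico_succ_bot (by omega : m < m₀ + 1)]
      have h1 := hb m hm S hS
      have h2 : c * g m ≤ g m * N := by
        rw [mul_comm]; exact mul_le_mul_of_nonneg_left hc' (hg0 m)
      have h3 : 0 ≤ c * g (m₀ + 1) := mul_nonneg (Nat.cast_nonneg _) (hg0 _)
      linarith
    · rw [Finset.Ico_eq_empty (by omega), Finset.Ico_eq_empty (by omega)]
      have h1 : c * g m ≤ c * g (m₀ + 1) :=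
        mul_le_mul_of_nonneg_left (hganti (by omega)) (Nat.cast_nonneg _)
      simpa using h1
  rcases lt_or_ge n N with hlt | hge
  · refine (hB.memoryLoss_le_of_lt_epochLength hL hQ hm hS.subset hne n [] (by simpa)).trans ?_
    refine (mul_le_mul_right (hB.lintegral_loss_obsLaw_le_of_isGood hL hQ hopt hm hS) _).trans ?_
    rw [← ENNReal.ofReal_natCast n, ← ENNReal.ofReal_mul (Nat.cast_nonneg _)]
    refine ENNReal.ofReal_le_ofReal ?_
    have h1 := hstep n hlt.le
    have h2 := hsum0 (m + 1) (m₀ + 1)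
    have h3 : (0 : ℝ) ≤ n / T := by positivity
    simp only [hg] at h1
    linarith
  · obtain ⟨r, rfl⟩ := Nat.exists_eq_add_of_le' hge
    have hr := fun S' hS' => ih r (by omega) (by omega) (m + 1) (by omega) S' hS'
    refine (hB.memoryLoss_epoch_le hL hQ hopt hT hm hS hr).trans ?_
    rw [← ENNReal.ofReal_natCast N, ← ENNReal.ofReal_natCast r,
      ← ENNReal.ofReal_mul (Nat.cast_nonneg _), ← ENNReal.ofReal_mul (Nat.cast_nonneg _),
      ← ENNReal.ofReal_add _ (by positivity), ← ENNReal.ofReal_add]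
    · refine ENNReal.ofReal_le_ofReal ?_
      have h1 := hstep N le_rfl
      -- The failure cost r / T² is at most 1 / T and is charged to the epoch's rounds at rate 1 /
      -- T, of which there is at least one.
      have h2 : (r : ℝ) / T + r * (1 / (T : ℝ) ^ 2) ≤ ((r + N : ℕ) : ℝ) / T := by
        have h3 : (1 : ℝ) ≤ N := by exact_mod_cast hNpos
        have h4 : (r : ℝ) ≤ T := by exact_mod_cast (by omega : r ≤ T)
        have h5 : r * (1 / (T : ℝ) ^ 2) ≤ 1 / T := by
          rw [mul_one_div, div_le_div_iff₀ (by positivity) hT0]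
          nlinarith
        have h6 : (1 : ℝ) / T ≤ N / T := div_le_div_of_nonneg_right h3 hT0.le
        push_cast
        rw [add_div]
        linarith
      simp only [hg] at h1
      push_cast at h2 ⊢
      linarith
    · exact mul_nonneg (Nat.cast_nonneg _) (add_nonneg hlam (hg0 m))
    · have := mul_nonneg (Nat.cast_nonneg (α := ℝ) r) (hg0 (m₀ + 1))
      have := hsum0 (m + 1) (m₀ + 1)
      simp only [hg] at *
      positivity
    · have := mul_nonneg (Nat.cast_nonneg (α := ℝ) r) (hg0 (m₀ + 1))
      have := hsum0 (m + 1) (m₀ + 1)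
      simp only [hg] at *
      positivity

/-- The regret bound of `SmoothPolicyElimination.L` under a bound on the products
`κ_h V` of the epochs. -/
theorem ContextualBandit.IsRegular.expectedLoss_le [Nonempty A]
    (hB : B.IsRegular) (hL : 1 ≤ L) (hQ : IsSolver B.toSetting L Q)
    (hopt : IsOptimalLipschitz B L istar) (hT : 2 ≤ T) {c K : ℝ} (hc : 0 ≤ c) (hK : 1 ≤ K)
    (hloss : ∀ i ∈ B.policies, smoothedLoss B 0 i ≤ 1)
    (hV : ∀ m, 1 ≤ m → ∀ S, IsGood B L istar m S →
      kernelSup B.toSetting (bandwidth m) * charVolume B.toSetting S (bandwidth m) ≤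
        c * (L * K)) :
    expectedLoss B (smoothPolicyEliminationL B.toSetting L T Q) T [] ≤
      ENNReal.ofReal (T * smoothedLoss B 0 istar +
        (8960 * c + 17) * Real.sqrt (T * (L * K) * numBatches B.toSetting T)) := by
  have hL0 : 0 < L := by linarith
  rw [expectedLoss_eq_memoryLoss]
  change memoryLoss B L T Q T ⟨1, B.policies, []⟩ ≤ _
  have hne : B.policies.Nonempty := ⟨istar, hopt.mem⟩
  have hlam := hB.smoothedLoss_nonneg 0 istar
  -- The initial set is good because losses are at most 1 and 12 r₁ = 6 L ≥ 1.
  have hgood : IsGood B L istar 1 B.policies := by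
    refine ⟨subset_rfl, hopt.mem, fun i hi => ?_⟩
    have h1 := hloss i hi
    have h2 : radius L 1 = L / 2 := by unfold radius; ring
    rw [h2]
    linarith
  set lam := smoothedLoss B 0 istar
  set δ : ℝ := (numBatches B.toSetting T : ℝ) with hδ
  have hδ1 : 1 ≤ δ := by
    have := numBatches_pos B.toSetting hT hne
    rw [hδ]
    exact_mod_cast this
  have hT1 : (2 : ℝ) ≤ T := by exact_mod_cast hT
  set R := Real.sqrt (T * (L * K) * δ) with hR
  have hLK : 1 ≤ L * K := by nlinarith
  have hRsq : R ^ 2 = T * (L * K) * δ := Real.sq_sqrt (by positivity)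
  have hR0 : 0 ≤ R := Real.sqrt_nonneg _
  have hR1 : 1 ≤ R := by
    rw [hR, Real.one_le_sqrt]
    have : 1 ≤ T * (L * K) := by nlinarith
    nlinarith
  rcases lt_or_ge (T * L) (K * δ) with hsmall | hbig
  -- For T L < K δ the trivial bound suffices, since then T ≤ R.
  · refine (hB.memoryLoss_le hL0 hQ T _ le_rfl subset_rfl hne).trans ?_
    rw [← ENNReal.ofReal_natCast]
    refine ENNReal.ofReal_le_ofReal ?_
    have h1 : (T : ℝ) ≤ R := by
      refine Real.le_sqrt_of_sq_le ?_
      have : (T : ℝ) ≤ T * L := by nlinarith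
      calc (T : ℝ) ^ 2 ≤ (T * L) * (T * L) := by nlinarith
        _ ≤ (T * L) * (K * δ) := mul_le_mul_of_nonneg_left hsmall.le (by positivity)
        _ = _ := by ring
    have h2 : R ≤ (8960 * c + 17) * R := le_mul_of_one_le_left hR0 (by linarith)
    have h3 : 0 ≤ T * lam := by positivity
    linarith
  · have hKδ : 0 < K * δ := by positivity
    set s := R / (K * δ) with hs
    have hs1 : 1 ≤ s := by
      rw [hs, one_le_div hKδ]
      refine Real.le_sqrt_of_sq_le ?_
      calc (K * δ) ^ 2 = (K * δ) * (K * δ) := sq _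
        _ ≤ (T * L) * (K * δ) := mul_le_mul_of_nonneg_right hbig hKδ.le
        _ = _ := by ring
    -- The epochs summed cost about K δ 2^m₀ and the later rounds about T L / 2^m₀; 2^m₀ ≈ s makes
    -- both of order R.
    obtain ⟨m₀, hm1, hm2⟩ := exists_nat_pow_near hs1 (by norm_num : (1 : ℝ) < 2)
    -- Here 4480 = 14 · 320, the product of the per-round regret and the batch size constant; the
    -- extra 1 pays for rounding the batch size up.
    set b : ℕ → ℝ := fun j => (4480 * c + 1) * (K * δ) * 2 ^ j with hb
    have hrad : ∀ j, radius L j = L / 2 ^ j := fun j => by unfold radius; ring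
    have hb' : ∀ j, 1 ≤ j → ∀ S, IsGood B L istar j S →
        min 1 (14 * radius L j) * epochLength B.toSetting L T j S ≤ b j := by
      intro j hj S hS
      have hr := radius_pos hL0 j
      have hκ := hB.setting.kernelSup_pos (bandwidth_pos j)
      have hvol := hB.setting.charVolume_pos j (S := S) ⟨istar, hS.mem⟩
      set w := kernelSup B.toSetting (bandwidth j) * charVolume B.toSetting S (bandwidth j)
      have hw : w ≤ c * (L * K) := hV j hj S hS
      have hw0 : 0 < w := mul_pos hκ hvol
      have hbs : (batchSize B.toSetting L j S : ℝ) ≤ 320 * w / radius L j ^ 2 + 1 := by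
        have h1 := (Nat.ceil_lt_add_one (a := 320 * w / radius L j ^ 2) (by positivity)).le
        have h2 : batchSize B.toSetting L j S = ⌈320 * w / radius L j ^ 2⌉₊ := by
          simp only [batchSize, w]; rw [mul_assoc]
        rw [h2]; exact h1
      have hep : (epochLength B.toSetting L T j S : ℝ) ≤ (320 * w / radius L j ^ 2 + 1) * δ := by
        rw [epochLength, Nat.cast_mul]
        exact mul_le_mul_of_nonneg_right hbs (by positivity)
      set g := min 1 (14 * radius L j) with hg
      have hg0 : 0 ≤ g := le_min zero_le_one (by positivity)
      have hg1 : g ≤ 1 := min_le_left _ _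
      have hg2 : g ≤ 14 * radius L j := min_le_right _ _
      have h3 : g * (320 * w / radius L j ^ 2) ≤ 4480 * c * K * 2 ^ j := by
        calc g * (320 * w / radius L j ^ 2) ≤
              (14 * radius L j) * (320 * (c * (L * K)) / radius L j ^ 2) := by
              refine mul_le_mul hg2 ?_ (by positivity) (by positivity)
              exact div_le_div_of_nonneg_right (by linarith) (by positivity)
          _ = 4480 * c * K * 2 ^ j := by rw [hrad]; field_simp; ring
      have h4 : (1 : ℝ) ≤ 2 ^ j := one_le_pow₀ (by norm_num)
      have h5 : g ≤ K * 2 ^ j := by nlinarith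
      calc g * epochLength B.toSetting L T j S ≤ g * ((320 * w / radius L j ^ 2 + 1) * δ) :=
            mul_le_mul_of_nonneg_left hep hg0
        _ = (g * (320 * w / radius L j ^ 2) + g) * δ := by ring
        _ ≤ (4480 * c * K * 2 ^ j + K * 2 ^ j) * δ :=
            mul_le_mul_of_nonneg_right (add_le_add h3 h5) (by linarith)
        _ = b j := by simp only [hb]; ring
    refine (hB.memoryLoss_le_of_isGood hL0 hQ hopt hT (fun j => by positivity) hb' m₀ T le_rfl 1
      le_rfl _ hgood).trans (ENNReal.ofReal_le_ofReal ?_)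
    have hsum : ∑ j ∈ Finset.Ico 1 (m₀ + 1), b j ≤ (8960 * c + 2) * R := by
      have hgeom : ∑ j ∈ Finset.Ico 1 (m₀ + 1), (2 : ℝ) ^ j ≤ 2 * 2 ^ m₀ := by
        have h1 : ∑ j ∈ Finset.Ico 1 (m₀ + 1), (2 : ℝ) ^ j ≤
            ∑ j ∈ Finset.range (m₀ + 1), (2 : ℝ) ^ j := by
          refine Finset.sum_le_sum_of_subset_of_nonneg (fun j hj => ?_) fun _ _ _ => by positivity
          simp at hj ⊢; omega
        rw [geom_sum_eq (by norm_num), pow_succ] at h1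
        linarith
      simp only [hb]
      rw [← Finset.mul_sum]
      have h2 : K * δ * s = R := by rw [hs]; field_simp
      calc (4480 * c + 1) * (K * δ) * ∑ j ∈ Finset.Ico 1 (m₀ + 1), (2 : ℝ) ^ j
          ≤ (4480 * c + 1) * (K * δ) * (2 * s) :=
            mul_le_mul_of_nonneg_left (by linarith) (by positivity)
        _ = (8960 * c + 2) * (K * δ * s) := by ring
        _ = _ := by rw [h2]
    have hlast : T * min 1 (14 * radius L (m₀ + 1)) ≤ 14 * R := by
      have hspos : 0 < s := by linarith
      calc T * min 1 (14 * radius L (m₀ + 1)) ≤ T * (14 * (L / 2 ^ (m₀ + 1))) := by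
            rw [hrad]
            exact mul_le_mul_of_nonneg_left (min_le_right _ _) (by positivity)
        _ ≤ T * (14 * (L / s)) := by gcongr
        _ = 14 * (T * L / s) := by ring
        _ = 14 * R := by
            have hRpos : 0 < R := by linarith
            congr 1
            rw [hs, div_div_eq_mul_div, div_eq_iff hRpos.ne', ← sq, hRsq]
            ring
    -- The failure term totals 1 ≤ R, whence the constant (8960 c + 2) + 14 + 1.
    have hTT : (T : ℝ) / T = 1 := div_self (by positivity)
    rw [hTT]
    linarith

end RegretBound

/-! ### Gaussian moments in one dimension -/

section Gaussian

theorem integral_abs_mul_exp_neg_sq_div_two :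
    ∫ t : ℝ, |t| * Real.exp (-(1 / 2) * t ^ 2) = 2 := by
  have h1 := integral_rpow_mul_exp_neg_mul_rpow (p := 2) (q := 1) (b := 1 / 2) (by norm_num)
    (by norm_num) (by norm_num)
  have h2 := integral_comp_abs (f := fun t : ℝ => t * Real.exp (-(1 / 2) * t ^ 2))
  simp only [sq_abs] at h2
  rw [h2]
  have h3 : ∫ t in Set.Ioi (0 : ℝ), t * Real.exp (-(1 / 2) * t ^ 2) = 1 := by
    have h4 : (1 / 2 : ℝ) ^ (-((1 : ℝ) + 1) / 2) * (1 / 2) * Real.Gamma ((1 + 1) / 2) = 1 := by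
      norm_num [Real.rpow_neg_one]
    rw [h4] at h1
    simpa using h1
  rw [h3, mul_one]

/-- The integral of `r ^ n e^{- r² / 2}` over the positive half-line. -/
def radialMoment (n : ℕ) : ℝ := ∫ r in Set.Ioi (0 : ℝ), r ^ n * Real.exp (-(1 / 2) * r ^ 2)

theorem radialMoment_eq (n : ℕ) : radialMoment n =
    (1 / 2 : ℝ) ^ (-((n : ℝ) + 1) / 2) * (1 / 2) * Real.Gamma (((n : ℝ) + 1) / 2) := by
  rw [← integral_rpow_mul_exp_neg_mul_rpow (p := 2) (q := n) (b := 1 / 2) (by norm_num)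
    (by have : (0 : ℝ) ≤ n := Nat.cast_nonneg n
        linarith) (by norm_num)]
  simp [radialMoment]

theorem radialMoment_pos (n : ℕ) : 0 < radialMoment n := by
  rw [radialMoment_eq]
  have := Real.Gamma_pos_of_pos (s := ((n : ℝ) + 1) / 2) (by positivity)
  positivity

/-- A non-integrable function would have integral 0, yet the Gamma formula gives a positive value.
-/
theorem integrableOn_radialMoment (n : ℕ) :
    IntegrableOn (fun r : ℝ => r ^ n * Real.exp (-(1 / 2) * r ^ 2)) (Set.Ioi 0) := by
  by_contra h
  have := radialMoment_pos n
  rw [radialMoment, integral_undef h] at this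
  exact lt_irrefl _ this

theorem radialMoment_add_two (n : ℕ) : radialMoment (n + 2) = (n + 1) * radialMoment n := by
  rw [radialMoment_eq, radialMoment_eq]
  have h1 : (((n + 2 : ℕ) : ℝ) + 1) / 2 = ((n : ℝ) + 1) / 2 + 1 := by push_cast; ring
  have h2 : -(((n + 2 : ℕ) : ℝ) + 1) / 2 = -((n : ℝ) + 1) / 2 - 1 := by push_cast; ring
  rw [h1, h2, Real.Gamma_add_one (by positivity), Real.rpow_sub (by norm_num), Real.rpow_one]
  ring

/-- Integrate r ≤ r² / (2a) + a / 2 with a = √(n + 1); the recursion for moments two apart makes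
both halves equal. -/
theorem radialMoment_succ_le (n : ℕ) :
    radialMoment (n + 1) ≤ Real.sqrt (n + 1) * radialMoment n := by
  have hs : 0 < Real.sqrt (n + 1) := Real.sqrt_pos.2 (by positivity)
  have hsq : Real.sqrt (n + 1) ^ 2 = n + 1 := Real.sq_sqrt (by positivity)
  have h : radialMoment (n + 1) ≤ (Real.sqrt (n + 1))⁻¹ / 2 * radialMoment (n + 2) +
      Real.sqrt (n + 1) / 2 * radialMoment n := by
    unfold radialMoment
    rw [← integral_const_mul, ← integral_const_mul,
      ← integral_add ((integrableOn_radialMoment _).const_mul _)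
        ((integrableOn_radialMoment _).const_mul _)]
    refine setIntegral_mono_on (integrableOn_radialMoment _)
      (((integrableOn_radialMoment _).const_mul _).add
        ((integrableOn_radialMoment _).const_mul _)) measurableSet_Ioi fun r hr => ?_
    have hr0 : 0 < r := hr
    have key : r ≤ (Real.sqrt (n + 1))⁻¹ / 2 * r ^ 2 + Real.sqrt (n + 1) / 2 := by
      have : (Real.sqrt (n + 1))⁻¹ / 2 * r ^ 2 + Real.sqrt (n + 1) / 2 - r =
          (r - Real.sqrt (n + 1)) ^ 2 / (2 * Real.sqrt (n + 1)) := by field_simp; ring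
      have h2 : 0 ≤ (r - Real.sqrt (n + 1)) ^ 2 / (2 * Real.sqrt (n + 1)) := by positivity
      linarith
    calc r ^ (n + 1) * Real.exp (-(1 / 2) * r ^ 2)
        = r * (r ^ n * Real.exp (-(1 / 2) * r ^ 2)) := by ring
      _ ≤ ((Real.sqrt (n + 1))⁻¹ / 2 * r ^ 2 + Real.sqrt (n + 1) / 2) *
          (r ^ n * Real.exp (-(1 / 2) * r ^ 2)) :=
          mul_le_mul_of_nonneg_right key (by positivity)
      _ = _ := by ring
  rw [radialMoment_add_two] at h
  refine h.trans (le_of_eq ?_)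
  have : (Real.sqrt (n + 1))⁻¹ * ((n : ℝ) + 1) = Real.sqrt (n + 1) := by
    rw [inv_mul_eq_div, div_eq_iff hs.ne', ← sq, hsq]
  linear_combination (radialMoment n / 2) * this

end Gaussian

/-! ### Polar coordinates -/

section Polar

open Metric

variable {E : Type*} [NormedAddCommGroup E] [NormedSpace ℝ E] [FiniteDimensional ℝ E]
  [MeasurableSpace E] [BorelSpace E]

/-- Integration in polar coordinates of a product of functions of the angle and of the radius. -/
theorem integral_angle_mul_radius (μ : Measure E) [μ.IsAddHaarMeasure]
    (f : sphere (0 : E) 1 → ℝ) (h : ℝ → ℝ) :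
    ∫ y : ({(0 : E)}ᶜ : Set E), f (homeomorphUnitSphereProd E y).1 * h ‖(y : E)‖ ∂(μ.comap (↑)) =
      (∫ x, f x ∂μ.toSphere) *
        ∫ r in Set.Ioi (0 : ℝ), r ^ (Module.finrank ℝ E - 1) * h r := by
  have h1 := μ.measurePreserving_homeomorphUnitSphereProd.integral_comp
    (Homeomorph.measurableEmbedding _)
    (fun p : sphere (0 : E) 1 × Set.Ioi (0 : ℝ) => f p.1 * h p.2)
  simp only [homeomorphUnitSphereProd_apply_snd_coe] at h1
  rw [h1, integral_prod_mul f fun r : Set.Ioi (0 : ℝ) => h r]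
  congr 1
  simp only [Measure.volumeIoiPow, ENNReal.ofReal]
  rw [integral_withDensity_eq_integral_smul,
    integral_subtype_comap measurableSet_Ioi
      fun a => Real.toNNReal (a ^ (Module.finrank ℝ E - 1)) • h a,
    setIntegral_congr_fun measurableSet_Ioi fun x hx => ?_]
  · simp only [NNReal.smul_def, smul_eq_mul]
    rw [Real.coe_toNNReal _ (pow_nonneg (le_of_lt hx) _)]
  · exact (measurable_subtype_coe.pow_const _).real_toNNReal

end Polar

/-! ### Mean of |⟨v, x⟩| on the sphere -/

section Sphere

variable {d : ℕ}

theorem integral_sphere_mul_radialMoment [NeZero d] :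
    (volume : Measure (EuclideanSpace ℝ (Fin d))).toSphere.real Set.univ * radialMoment (d - 1) =
      ∫ y : EuclideanSpace ℝ (Fin d), Real.exp (-(1 / 2) * ‖y‖ ^ 2) := by
  have h := integral_angle_mul_radius (volume : Measure (EuclideanSpace ℝ (Fin d))) (fun _ => 1)
    (fun r => Real.exp (-(1 / 2) * r ^ 2))
  rw [integral_subtype_comap (measurableSet_singleton _).compl
    (fun y : EuclideanSpace ℝ (Fin d) => 1 * Real.exp (-(1 / 2) * ‖y‖ ^ 2)),
    restrict_compl_singleton] at h
  simp only [one_mul, integral_const, smul_eq_mul, mul_one, finrank_euclideanSpace_fin] at h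
  exact h.symm

/-- By homogeneity the radial integrand gains one factor r, raising the power d - 1 of the polar
Jacobian to d. -/
theorem integral_abs_inner_sphere_mul_radialMoment [NeZero d] (v : EuclideanSpace ℝ (Fin d)) :
    (∫ x : Sphere d, |inner ℝ v (x : EuclideanSpace ℝ (Fin d))|
      ∂(volume : Measure (EuclideanSpace ℝ (Fin d))).toSphere) * radialMoment d =
      ∫ y : EuclideanSpace ℝ (Fin d), |inner ℝ v y| * Real.exp (-(1 / 2) * ‖y‖ ^ 2) := by
  have h := integral_angle_mul_radius (volume : Measure (EuclideanSpace ℝ (Fin d)))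
    (fun x => |inner ℝ v (x : EuclideanSpace ℝ (Fin d))|)
    (fun r => r * Real.exp (-(1 / 2) * r ^ 2))
  have h2 : ∀ y : ({(0 : EuclideanSpace ℝ (Fin d))}ᶜ : Set (EuclideanSpace ℝ (Fin d))),
      |inner ℝ v ((homeomorphUnitSphereProd (EuclideanSpace ℝ (Fin d)) y).1 :
        EuclideanSpace ℝ (Fin d))| *
      (‖(y : EuclideanSpace ℝ (Fin d))‖ *
        Real.exp (-(1 / 2) * ‖(y : EuclideanSpace ℝ (Fin d))‖ ^ 2)) =
      |inner ℝ v (y : EuclideanSpace ℝ (Fin d))| *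
        Real.exp (-(1 / 2) * ‖(y : EuclideanSpace ℝ (Fin d))‖ ^ 2) := by
    intro y
    have hy : ‖(y : EuclideanSpace ℝ (Fin d))‖ ≠ 0 := norm_ne_zero_iff.2 y.2
    rw [homeomorphUnitSphereProd_apply_fst_coe, inner_smul_right, abs_mul, abs_inv, abs_norm]
    field_simp
  simp only [h2] at h
  rw [integral_subtype_comap (measurableSet_singleton _).compl
    (fun y : EuclideanSpace ℝ (Fin d) => |inner ℝ v y| * Real.exp (-(1 / 2) * ‖y‖ ^ 2)),
    restrict_compl_singleton] at h
  rw [h]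
  congr 1
  rw [radialMoment]
  refine setIntegral_congr_fun measurableSet_Ioi fun r _ => ?_
  simp only [finrank_euclideanSpace_fin]
  rw [← mul_assoc, ← pow_succ, Nat.sub_add_cancel (NeZero.one_le)]

theorem exp_neg_norm_sq (ι : Type*) [Fintype ι] (y : EuclideanSpace ℝ ι) :
    Real.exp (-(1 / 2) * ‖y‖ ^ 2) = ∏ i, Real.exp (-(1 / 2) * y i ^ 2) := by
  rw [EuclideanSpace.real_norm_sq_eq, ← Real.exp_sum, Finset.mul_sum]

theorem integral_euclideanSpace_prod {ι : Type*} [Fintype ι] (f : ι → ℝ → ℝ) :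
    ∫ y : EuclideanSpace ℝ ι, ∏ i, f i (y i) = ∏ i, ∫ t, f i t := by
  rw [← integral_fintype_prod_volume_eq_prod]
  exact (PiLp.volume_preserving_ofLp ι).integral_comp
    (MeasurableEquiv.toLp 2 (ι → ℝ)).symm.measurableEmbedding (fun y : ι → ℝ => ∏ i, f i (y i))

theorem integral_exp_neg_sq_pos : 0 < ∫ t : ℝ, Real.exp (-(1 / 2) * t ^ 2) := by
  rw [integral_gaussian]
  positivity

theorem integral_exp_neg_sq_le : ∫ t : ℝ, Real.exp (-(1 / 2) * t ^ 2) ≤ 4 := by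
  rw [integral_gaussian]
  refine Real.sqrt_le_iff.2 ⟨by norm_num, ?_⟩
  have := Real.pi_le_four
  linarith

/-- In orthonormal coordinates starting with `u` both integrals are products over the axes and
differ in one factor only, 2 against the Gaussian integral. -/
theorem integral_abs_inner_mul_exp_neg_norm_sq [NeZero d] {u : EuclideanSpace ℝ (Fin d)}
    (hu : ‖u‖ = 1) :
    (∫ y : EuclideanSpace ℝ (Fin d), |inner ℝ u y| * Real.exp (-(1 / 2) * ‖y‖ ^ 2)) *
        ∫ t : ℝ, Real.exp (-(1 / 2) * t ^ 2) =
      2 * ∫ y : EuclideanSpace ℝ (Fin d), Real.exp (-(1 / 2) * ‖y‖ ^ 2) := by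
  have horth : Orthonormal ℝ (({0} : Set (Fin d)).domRestrict fun _ => u) :=
    ⟨fun _ => hu, fun i j hij => (hij (Subsingleton.elim i j)).elim⟩
  obtain ⟨b, hb⟩ := horth.exists_orthonormalBasis_extension_of_card_eq (by simp)
  have hb0 : b 0 = u := hb 0 rfl
  have h1 := b.measurePreserving_repr.integral_comp b.repr.toHomeomorph.measurableEmbedding
    (fun z : EuclideanSpace ℝ (Fin d) => |z 0| * Real.exp (-(1 / 2) * ‖z‖ ^ 2))
  simp only [LinearIsometryEquiv.norm_map, OrthonormalBasis.repr_apply_apply, hb0] at h1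
  have h2 : ∀ z : EuclideanSpace ℝ (Fin d), |z 0| * Real.exp (-(1 / 2) * ‖z‖ ^ 2) =
      ∏ i, (if i = 0 then |z i| else 1) * Real.exp (-(1 / 2) * z i ^ 2) := fun z => by
    rw [Finset.prod_mul_distrib, ← exp_neg_norm_sq]
    simp
  rw [h1]
  simp only [h2]
  simp only [exp_neg_norm_sq]
  rw [integral_euclideanSpace_prod
      (fun i : Fin d => fun t => (if i = 0 then |t| else 1) * Real.exp (-(1 / 2) * t ^ 2)),
    integral_euclideanSpace_prod (fun _ : Fin d => fun t => Real.exp (-(1 / 2) * t ^ 2)),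
    ← Finset.mul_prod_erase _ _ (Finset.mem_univ (0 : Fin d)),
    ← Finset.mul_prod_erase _ (fun _ => ∫ t : ℝ, Real.exp (-(1 / 2) * t ^ 2))
      (Finset.mem_univ (0 : Fin d))]
  have h3 : ∏ i ∈ Finset.univ.erase (0 : Fin d),
        ∫ t : ℝ, (if i = 0 then |t| else 1) * Real.exp (-(1 / 2) * t ^ 2) =
      ∏ i ∈ Finset.univ.erase (0 : Fin d), ∫ t : ℝ, Real.exp (-(1 / 2) * t ^ 2) :=
    Finset.prod_congr rfl fun i hi => by
      simp only [if_neg (Finset.ne_of_mem_erase hi), one_mul]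
  simp only [if_true, integral_abs_mul_exp_neg_sq_div_two, h3]
  ring

instance isProbabilityMeasure_uniformSphere [NeZero d] :
    IsProbabilityMeasure (uniformSphere d) := by
  constructor
  have h0 : (volume : Measure (EuclideanSpace ℝ (Fin d))).toSphere Set.univ ≠ 0 := by
    rw [Measure.measure_univ_ne_zero]
    exact Measure.toSphere_ne_zero _
  rw [uniformSphere, Measure.smul_apply, smul_eq_mul,
    ENNReal.inv_mul_cancel h0 (measure_ne_top _ _)]

theorem integrable_of_continuous_sphere [NeZero d] {g : Sphere d → ℝ} (hg : Continuous g) :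
    Integrable g (uniformSphere d) :=
  hg.integrable_of_hasCompactSupport (HasCompactSupport.of_compactSpace g)

/-- The mean absolute value of a linear functional on the sphere is at least a constant times
its norm divided by the square root of the dimension. -/
theorem norm_div_le_integral_abs_inner [NeZero d] (v : EuclideanSpace ℝ (Fin d)) :
    ‖v‖ / (2 * Real.sqrt d) ≤
      ∫ x : Sphere d, |inner ℝ v (x : EuclideanSpace ℝ (Fin d))| ∂(uniformSphere d) := by
  rcases eq_or_ne v 0 with rfl | hv
  · simp
  have hv0 : 0 < ‖v‖ := norm_pos_iff.2 hv
  set u : EuclideanSpace ℝ (Fin d) := ‖v‖⁻¹ • v with hu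
  have hu1 : ‖u‖ = 1 := by rw [hu, norm_smul, norm_inv, norm_norm, inv_mul_cancel₀ hv0.ne']
  set σ := (volume : Measure (EuclideanSpace ℝ (Fin d))).toSphere with hσ
  have h1 := integral_abs_inner_sphere_mul_radialMoment u
  have h2 := integral_sphere_mul_radialMoment (d := d)
  have h3 := integral_abs_inner_mul_exp_neg_norm_sq hu1
  have h4 := integral_exp_neg_sq_pos
  have h5 := integral_exp_neg_sq_le
  rw [← h1, ← h2] at h3
  set I := ∫ x : Sphere d, |inner ℝ u (x : EuclideanSpace ℝ (Fin d))| ∂σ with hI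
  set s := σ.real Set.univ with hs
  set γ := ∫ t : ℝ, Real.exp (-(1 / 2) * t ^ 2)
  have hd : (((d - 1 : ℕ) : ℝ) + 1) = d := by exact_mod_cast Nat.sub_add_cancel NeZero.one_le
  have hJ := radialMoment_succ_le (d - 1)
  rw [Nat.sub_add_cancel NeZero.one_le, hd] at hJ
  have hJ0 := radialMoment_pos (d - 1)
  have hJ1 := radialMoment_pos d
  have hsd : 0 < Real.sqrt d := Real.sqrt_pos.2 (by exact_mod_cast NeZero.pos d)
  have hs0 : 0 < s := by
    have : NeZero σ := ⟨Measure.toSphere_ne_zero _⟩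
    exact measureReal_univ_pos
  have hI0 : 0 ≤ I := integral_nonneg fun _ => abs_nonneg _
  -- With J the radial moments and γ the Gaussian integral, I J_d γ = 2 s J_{d-1}; insert J_d ≤ √d
  -- J_{d-1} and γ ≤ 4.
  have hIs : s / (2 * Real.sqrt d) ≤ I := by
    rw [div_le_iff₀ (by positivity)]
    have h6 : 2 * (s * radialMoment (d - 1)) ≤ I * (Real.sqrt d * radialMoment (d - 1)) * 4 := by
      rw [← h3]
      gcongr
    have h7 : radialMoment (d - 1) * s ≤ radialMoment (d - 1) * (I * (2 * Real.sqrt d)) := by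
      linarith
    exact le_of_mul_le_mul_left h7 hJ0
  have hvI : ∫ x : Sphere d, |inner ℝ v (x : EuclideanSpace ℝ (Fin d))| ∂(uniformSphere d) =
      s⁻¹ * (‖v‖ * I) := by
    have e : ∀ x : Sphere d, |inner ℝ v (x : EuclideanSpace ℝ (Fin d))| =
        ‖v‖ * |inner ℝ u (x : EuclideanSpace ℝ (Fin d))| := fun x => by
      rw [hu, real_inner_smul_left, abs_mul, abs_inv, abs_norm, mul_inv_cancel_left₀ hv0.ne']
    simp only [e, uniformSphere, integral_smul_measure, integral_const_mul]
    simp [hs, measureReal_def, hI, hσ]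
    ring
  rw [hvI]
  calc ‖v‖ / (2 * Real.sqrt d) = s⁻¹ * (‖v‖ * (s / (2 * Real.sqrt d))) := by field_simp
    _ ≤ _ := by gcongr

end Sphere

/-! ### Separated points in an interval -/

section Packing

/-- Cells of length δ, closed on the left and open on the right, hold at most one point each, and
⌊2R/δ⌋ + 1 of them cover the interval. -/
theorem card_le_of_separated {c R δ : ℝ} (hδ : 0 < δ) (hR : 0 ≤ R) {F : Finset Action}
    (hF : ∀ a ∈ F, |(a : ℝ) - c| ≤ R) (hsep : (F : Set Action).Pairwise fun a b => δ ≤ dist a b) :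
    (F.card : ℝ) ≤ 1 + 2 * R / δ := by
  have hpos : ∀ a ∈ F, 0 ≤ ((a : ℝ) - (c - R)) / δ := fun a ha =>
    div_nonneg (by linarith [(abs_le.1 (hF a ha)).1]) hδ.le
  have hcard : F.card ≤ (Finset.range (⌊2 * R / δ⌋₊ + 1)).card := by
    refine Finset.card_le_card_of_injOn (fun a => ⌊((a : ℝ) - (c - R)) / δ⌋₊) (fun a ha => ?_)
      fun a ha b hb hab => ?_
    · simp only [Finset.coe_range, Set.mem_Iio, Nat.lt_succ_iff]
      exact Nat.floor_le_floor
        (div_le_div_of_nonneg_right (by linarith [(abs_le.1 (hF a ha)).2]) hδ.le)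
    · by_contra hne
      have h1 := hsep ha hb hne
      simp only at hab
      set u := ((a : ℝ) - (c - R)) / δ with hu
      set v := ((b : ℝ) - (c - R)) / δ with hv
      have h2 := Nat.floor_le (hpos a ha)
      have h3 := Nat.floor_le (hpos b hb)
      have h4 := Nat.lt_floor_add_one u
      have h5 := Nat.lt_floor_add_one v
      rw [← hu] at h2
      rw [← hv] at h3
      rw [hab] at h2 h4
      have h6 : |u - v| < 1 := by rw [abs_lt]; constructor <;> linarith
      have h7 : |u - v| = dist a b / δ := by
        rw [Subtype.dist_eq, Real.dist_eq, hu, hv, ← sub_div, abs_div, abs_of_pos hδ]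
        congr 2; ring
      rw [h7, div_lt_one hδ] at h6
      linarith
  rw [Finset.card_range] at hcard
  have h8 : (F.card : ℝ) ≤ (⌊2 * R / δ⌋₊ : ℝ) + 1 := by exact_mod_cast hcard
  have h9 := Nat.floor_le (a := 2 * R / δ) (by positivity)
  linarith

theorem packingNumber_le {c R δ : ℝ} (hδ : 0 < δ) (hR : 0 ≤ R) {s : Set Action}
    (hs : ∀ a ∈ s, |(a : ℝ) - c| ≤ R) : packingNumber δ s ≤ ENNReal.ofReal (1 + 2 * R / δ) := by
  refine iSup_le fun F => iSup_le fun hF => iSup_le fun hsep => ?_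
  rw [← ENNReal.ofReal_natCast]
  exact ENNReal.ofReal_le_ofReal (card_le_of_separated hδ hR (fun a ha => hs a (hF ha)) hsep)

end Packing

/-! ### Balls in the action space -/

section Action

theorem uniformAction_real (s : Set Action) :
    uniformAction.real s = volume.real (Subtype.val '' s) / 2 := by
  have h : MeasurableEmbedding (Subtype.val : Action → ℝ) :=
    MeasurableEmbedding.subtype_coe measurableSet_Icc
  rw [uniformAction, measureReal_def, Measure.smul_apply, h.comap_apply, smul_eq_mul,
    ENNReal.toReal_mul, measureReal_def]
  simp
  ring

instance isProbabilityMeasure_uniformAction : IsProbabilityMeasure uniformAction := by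
  have h : MeasurableEmbedding (Subtype.val : Action → ℝ) :=
    MeasurableEmbedding.subtype_coe measurableSet_Icc
  constructor
  rw [uniformAction, Measure.smul_apply, h.comap_apply, Set.image_univ, Subtype.range_coe,
    Real.volume_Icc, smul_eq_mul]
  norm_num
  exact ENNReal.inv_mul_cancel (by simp) (by simp)

theorem image_closedBall (a : Action) (h : ℝ) :
    Subtype.val '' Metric.closedBall a h = Set.Icc (max (a - h) (-1)) (min (a + h) 1) := by
  ext t
  simp only [Set.mem_image, Metric.mem_closedBall, Subtype.dist_eq, Real.dist_eq, abs_le,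
    Set.mem_Icc, max_le_iff, le_min_iff]
  constructor
  · rintro ⟨b, ⟨h1, h2⟩, rfl⟩
    exact ⟨⟨by linarith, b.2.1⟩, by linarith, b.2.2⟩
  · rintro ⟨⟨h1, h2⟩, h3, h4⟩
    exact ⟨⟨t, h2, h4⟩, ⟨by simp only; linarith, by simp only; linarith⟩, rfl⟩

/-- Even at an endpoint of [-1, 1] one side of the ball, of length h ≤ 2, stays inside; the density
is 1/2. -/
theorem half_le_uniformAction_closedBall (a : Action) {h : ℝ} (h0 : 0 ≤ h) (h2 : h ≤ 2) :
    h / 2 ≤ uniformAction.real (Metric.closedBall a h) := by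
  have ha := a.2
  rw [uniformAction_real, image_closedBall, Real.volume_real_Icc]
  refine div_le_div_of_nonneg_right (le_max_of_le_left ?_) (by norm_num)
  rcases max_cases ((a : ℝ) - h) (-1) with h3 | h3 <;>
  rcases min_cases ((a : ℝ) + h) 1 with h4 | h4 <;>
  rw [h3.1, h4.1] <;> linarith [ha.1, ha.2]

theorem uniformAction_closedBall_le (a : Action) {h : ℝ} (h0 : 0 ≤ h) :
    uniformAction.real (Metric.closedBall a h) ≤ h := by
  have ha := a.2
  rw [uniformAction_real, image_closedBall, Real.volume_real_Icc, div_le_iff₀ (by norm_num)]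
  refine max_le ?_ (by positivity)
  linarith [le_max_left ((a : ℝ) - h) (-1), min_le_left ((a : ℝ) + h) 1]

end Action

/-! ### Linear policies: packing, volume and regret -/

section SphereBandit

variable {d : ℕ} {Z : Type*} [MeasurableSpace Z] {W : Finset (Sphere d)}
  {lossLaw : Kernel (Sphere d) Z} {loss : Z → Action → ℝ}

theorem continuous_linearPolicy (w : Sphere d) : Continuous (linearPolicy w) := by
  unfold linearPolicy
  fun_prop

theorem neZero_of_sphere (w : Sphere d) : NeZero d := by
  refine ⟨?_⟩
  rintro rfl
  have h := norm_eq_of_mem_sphere w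
  rw [Subsingleton.elim (w : EuclideanSpace ℝ (Fin 0)) 0] at h
  simp at h

theorem sphereBandit_isRegular [NeZero d] [IsMarkovKernel lossLaw]
    (hm : Measurable (Function.uncurry loss)) (h01 : ∀ z a, loss z a ∈ Set.Icc (0 : ℝ) 1) :
    (sphereBandit W lossLaw loss).IsRegular where
  setting :=
    { isProbabilityMeasure_ctxLaw := isProbabilityMeasure_uniformSphere
      isProbabilityMeasure_base := isProbabilityMeasure_uniformAction
      measurable_policy := fun w => (continuous_linearPolicy w).measurable
      exists_le_ball := fun h hh => ⟨min h 2 / 2, by positivity, fun a =>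
        (half_le_uniformAction_closedBall a (by positivity) (min_le_right _ _)).trans
          (measureReal_mono (Metric.closedBall_subset_closedBall (min_le_left _ _)))⟩ }
  isMarkovKernel_lossLaw := inferInstanceAs (IsMarkovKernel lossLaw)
  measurable_loss := hm
  loss_mem := h01

theorem kernelSup_sphereBandit_le {h : ℝ} (h0 : 0 < h) (h2 : h ≤ 2) :
    kernelSup (sphereBandit W lossLaw loss).toSetting h ≤ 2 / h := by
  refine Real.iSup_le (fun p => ?_) (by positivity)
  unfold kernelDensity
  split_ifs
  · rw [← inv_div]
    exact inv_anti₀ (by positivity) (half_le_uniformAction_closedBall _ h0.le h2)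
  · positivity

theorem abs_linearPolicy_sub_le (w w' x : Sphere d) :
    |(linearPolicy w x : ℝ) - linearPolicy w' x| ≤ dist w w' := by
  have h := abs_real_inner_le_norm ((w : EuclideanSpace ℝ (Fin d)) - w')
    (x : EuclideanSpace ℝ (Fin d))
  rw [norm_eq_of_mem_sphere x, mul_one, inner_sub_left, ← dist_eq_norm] at h
  exact h

/-- At each context all the balls lie in the single ball of radius h + R about the action of `w`. -/
theorem charVolume_sphereBandit_le [NeZero d] {S : Finset (Sphere d)} {w : Sphere d} {h R : ℝ}
    (h0 : 0 ≤ h) (hR : 0 ≤ R) (hS : ∀ i ∈ S, dist i w ≤ R) :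
    charVolume (sphereBandit W lossLaw loss).toSetting S h ≤ h + R := by
  have hpt : ∀ x : Sphere d,
      uniformAction.real (⋃ i ∈ S, Metric.closedBall (linearPolicy i x) h) ≤ h + R := fun x => by
    refine (measureReal_mono (Set.iUnion₂_subset fun i hi => ?_)).trans
      (uniformAction_closedBall_le (linearPolicy w x) (by positivity))
    refine Metric.closedBall_subset_closedBall' (add_le_add_right ?_ _)
    exact (abs_linearPolicy_sub_le i w x).trans (hS i hi)
  calc charVolume (sphereBandit W lossLaw loss).toSetting S h
      ≤ ∫ _ : Sphere d, (h + R) ∂(uniformSphere d) :=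
        integral_mono_of_nonneg (Filter.Eventually.of_forall fun _ => measureReal_nonneg)
          (integrable_const (μ := uniformSphere d) _) (Filter.Eventually.of_forall hpt)
    _ = h + R := by simp

variable {L L₀ : ℝ} {f : ℝ → ℝ} {wstar : Sphere d}

theorem exists_abs_sub_ge_one (b : Action) : ∃ a : Action, 1 ≤ |(a : ℝ) - b| := by
  rcases le_total (b : ℝ) 0 with h | h
  · exact ⟨⟨1, by norm_num⟩, by simp only; exact le_trans (by linarith) (le_abs_self _)⟩
  · exact ⟨⟨-1, by norm_num⟩, by simp only; exact le_trans (by linarith) (neg_le_abs _)⟩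

/-- The losses of the instance lie in `[0, 1]`, are governed by the `L`-Lipschitz function `f`,
and `f` grows at least linearly with slope `L₀` away from `0`. -/
structure IsLinkFunction (lossLaw : Kernel (Sphere d) Z) (loss : Z → Action → ℝ)
    (wstar : Sphere d) (L L₀ : ℝ) (f : ℝ → ℝ) : Prop where
  one_le : 1 ≤ L
  pos : 0 < L₀
  lipschitz : ∀ z z' : ℝ, |f z - f z'| ≤ L * |z - z'|
  growth : ∀ z : ℝ, L₀ * |z| ≤ f z - f 0
  measurable_loss : Measurable (Function.uncurry loss)
  loss_mem : ∀ z a, loss z a ∈ Set.Icc (0 : ℝ) 1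
  integral_loss : ∀ (x : Sphere d) (a : Action),
    ∫ z, loss z a ∂(lossLaw x) = f ((a : ℝ) - (linearPolicy wstar x : ℝ))

theorem IsLinkFunction.continuous (hf : IsLinkFunction lossLaw loss wstar L L₀ f) :
    Continuous f := by
  refine LipschitzWith.continuous (K := ⟨L, by linarith [hf.one_le]⟩) ?_
  exact LipschitzWith.of_dist_le_mul fun z z' => hf.lipschitz z z'

theorem IsLinkFunction.smoothedLoss_zero (hf : IsLinkFunction lossLaw loss wstar L L₀ f)
    (w : Sphere d) : smoothedLoss (sphereBandit W lossLaw loss) 0 w =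
      ∫ x : Sphere d, f ((linearPolicy w x : ℝ) - linearPolicy wstar x) ∂(uniformSphere d) := by
  refine integral_congr_ae (Filter.Eventually.of_forall fun x => ?_)
  simp only [smooth, if_true, integral_dirac]
  exact hf.integral_loss x _

theorem IsLinkFunction.continuous_comp (hf : IsLinkFunction lossLaw loss wstar L L₀ f)
    (w : Sphere d) :
    Continuous fun x : Sphere d => f ((linearPolicy w x : ℝ) - linearPolicy wstar x) :=
  hf.continuous.comp ((continuous_subtype_val.comp (continuous_linearPolicy w)).sub
    (continuous_subtype_val.comp (continuous_linearPolicy wstar)))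

theorem IsLinkFunction.smoothedLoss_star [NeZero d]
    (hf : IsLinkFunction lossLaw loss wstar L L₀ f) :
    smoothedLoss (sphereBandit W lossLaw loss) 0 wstar = f 0 := by
  simp [hf.smoothedLoss_zero]

/-- The excess loss of a linear policy controls its distance to the optimal policy. -/
theorem IsLinkFunction.dist_le [NeZero d] (hf : IsLinkFunction lossLaw loss wstar L L₀ f)
    (w : Sphere d) :
    dist w wstar ≤ 2 * Real.sqrt d / L₀ *
      (smoothedLoss (sphereBandit W lossLaw loss) 0 w -
        smoothedLoss (sphereBandit W lossLaw loss) 0 wstar) := by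
  have hsd : 0 < Real.sqrt d := Real.sqrt_pos.2 (by exact_mod_cast NeZero.pos d)
  have h0 := hf.pos
  rw [hf.smoothedLoss_zero, hf.smoothedLoss_star]
  set u : EuclideanSpace ℝ (Fin d) := (w : EuclideanSpace ℝ (Fin d)) - wstar with hu
  have h1 := norm_div_le_integral_abs_inner u
  have hci : Continuous fun x : Sphere d => |inner ℝ u (x : EuclideanSpace ℝ (Fin d))| := by
    fun_prop
  have h2 : ∫ x : Sphere d, (f 0 + L₀ * |inner ℝ u (x : EuclideanSpace ℝ (Fin d))|) ∂(uniformSphere d) ≤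
      ∫ x : Sphere d, f ((linearPolicy w x : ℝ) - linearPolicy wstar x) ∂(uniformSphere d) := by
    refine integral_mono ((integrable_const _).add
      ((integrable_of_continuous_sphere hci).const_mul _))
      (integrable_of_continuous_sphere (hf.continuous_comp w)) fun x => ?_
    have h3 := hf.growth ((linearPolicy w x : ℝ) - linearPolicy wstar x)
    have h4 : inner ℝ u (x : EuclideanSpace ℝ (Fin d)) =
        (linearPolicy w x : ℝ) - linearPolicy wstar x := inner_sub_left _ _ _
    simp only [h4]
    linarith
  rw [integral_add (integrable_const _) ((integrable_of_continuous_sphere hci).const_mul _),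
    integral_const_mul] at h2
  simp only [integral_const, probReal_univ, one_smul] at h2
  rw [hu, ← dist_eq_norm, ← Subtype.dist_eq, div_le_iff₀ (by positivity)] at h1
  set I := ∫ x : Sphere d, |inner ℝ u (x : EuclideanSpace ℝ (Fin d))| ∂(uniformSphere d)
  calc dist w wstar ≤ I * (2 * Real.sqrt d) := h1
    _ = 2 * Real.sqrt d / L₀ * (L₀ * I) := by field_simp
    _ ≤ _ := mul_le_mul_of_nonneg_left (by linarith) (by positivity)

/-- A nonnegative distance is at most a positive multiple of the excess loss, so the latter is
nonnegative. -/
theorem IsLinkFunction.optimal [NeZero d] (hf : IsLinkFunction lossLaw loss wstar L L₀ f)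
    (w : Sphere d) :
    smoothedLoss (sphereBandit W lossLaw loss) 0 wstar ≤
      smoothedLoss (sphereBandit W lossLaw loss) 0 w := by
  have hsd : 0 < Real.sqrt d := Real.sqrt_pos.2 (by exact_mod_cast NeZero.pos d)
  have h0 := hf.pos
  have h := dist_nonneg.trans (hf.dist_le (W := W) w)
  by_contra! hlt
  have : 0 < 2 * Real.sqrt d / L₀ := by positivity
  nlinarith

theorem IsLinkFunction.bench_eq [NeZero d] (hf : IsLinkFunction lossLaw loss wstar L L₀ f)
    (hW : wstar ∈ W) : bench (sphereBandit W lossLaw loss) 0 =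
      smoothedLoss (sphereBandit W lossLaw loss) 0 wstar :=
  IsLeast.csInf_eq ⟨⟨wstar, hW, rfl⟩, by rintro _ ⟨w, _, rfl⟩; exact hf.optimal w⟩

/-- The ratio `t` of tolerance to separation is kept general: `t = L` serves the packing bound and
`t = 12 L` the zooming coefficient. -/
theorem IsLinkFunction.expectedPacking_le [NeZero d]
    (hf : IsLinkFunction lossLaw loss wstar L L₀ f) (hW : wstar ∈ W) {t δ : ℝ} (ht : 0 ≤ t) (hδ : 0 < δ) :
    expectedPacking (sphereBandit W lossLaw loss) 0 (t * δ) δ ≤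
      ENNReal.ofReal (1 + 4 * t * (Real.sqrt d / L₀)) := by
  have h0 := hf.pos
  set R := 2 * Real.sqrt d / L₀ * (t * δ) with hR
  have hpt : ∀ x : Sphere d, packingNumber δ ((fun i => linearPolicy i x) ''
      versionSpace (sphereBandit W lossLaw loss) 0 (t * δ)) ≤
      ENNReal.ofReal (1 + 4 * t * (Real.sqrt d / L₀)) := by
    intro x
    have h := packingNumber_le (c := linearPolicy wstar x) (R := R) hδ (by positivity)
      (s := (fun i => linearPolicy i x) ''
        versionSpace (sphereBandit W lossLaw loss) 0 (t * δ)) (by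
        rintro _ ⟨w, hw, rfl⟩
        refine (abs_linearPolicy_sub_le w wstar x).trans ((hf.dist_le (W := W) w).trans ?_)
        have := hw.2
        rw [hf.bench_eq hW] at this
        exact mul_le_mul_of_nonneg_left (by linarith) (by positivity))
    refine h.trans_eq ?_
    congr 2
    rw [hR]; field_simp; ring
  calc expectedPacking (sphereBandit W lossLaw loss) 0 (t * δ) δ
      ≤ ∫⁻ _ : Sphere d, ENNReal.ofReal (1 + 4 * t * (Real.sqrt d / L₀)) ∂(uniformSphere d) :=
        lintegral_mono hpt
    _ = _ := by simp

variable [IsMarkovKernel lossLaw]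

theorem IsLinkFunction.mem_Icc (hf : IsLinkFunction lossLaw loss wstar L L₀ f) (x : Sphere d)
    (a : Action) : f ((a : ℝ) - linearPolicy wstar x) ∈ Set.Icc (0 : ℝ) 1 := by
  rw [← hf.integral_loss x a]
  refine ⟨integral_nonneg fun z => (hf.loss_mem z a).1, ?_⟩
  calc ∫ z, loss z a ∂(lossLaw x) ≤ ∫ _ : Z, (1 : ℝ) ∂(lossLaw x) :=
        integral_mono_of_nonneg (Filter.Eventually.of_forall fun z => (hf.loss_mem z a).1)
          (integrable_const _) (Filter.Eventually.of_forall fun z => (hf.loss_mem z a).2)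
    _ = 1 := by simp

/-- Some action is at distance at least 1 from the optimal one, while mean losses differ by at most
1. -/
theorem IsLinkFunction.slope_le_one (hf : IsLinkFunction lossLaw loss wstar L L₀ f) :
    L₀ ≤ 1 := by
  obtain ⟨a, ha⟩ := exists_abs_sub_ge_one (linearPolicy wstar wstar)
  have h1 := hf.growth ((a : ℝ) - linearPolicy wstar wstar)
  have h2 := (hf.mem_Icc wstar a).2
  have h3 := (hf.mem_Icc wstar (linearPolicy wstar wstar)).1
  rw [sub_self] at h3
  nlinarith [hf.pos]

variable [NeZero d]

theorem IsLinkFunction.smoothedLoss_le_one (hf : IsLinkFunction lossLaw loss wstar L L₀ f)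
    (w : Sphere d) : smoothedLoss (sphereBandit W lossLaw loss) 0 w ≤ 1 := by
  rw [hf.smoothedLoss_zero]
  calc _ ≤ ∫ _ : Sphere d, (1 : ℝ) ∂(uniformSphere d) :=
        integral_mono (integrable_of_continuous_sphere (hf.continuous_comp w))
          (integrable_const _) fun x => (hf.mem_Icc x (linearPolicy w x)).2
    _ = 1 := by simp

/-- After exchanging the loss and action integrals, f is averaged over actions within h_m of the
policy's action, where it varies by at most L h_m = r_m. -/
theorem IsLinkFunction.abs_smoothedLoss_sub_le (hf : IsLinkFunction lossLaw loss wstar L L₀ f)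
    (w : Sphere d) (m : ℕ) :
    |smoothedLoss (sphereBandit W lossLaw loss) (bandwidth m) w -
      smoothedLoss (sphereBandit W lossLaw loss) 0 w| ≤ radius L m := by
  set B := sphereBandit W lossLaw loss with hB
  have hreg : B.IsRegular := sphereBandit_isRegular hf.measurable_loss hf.loss_mem
  have hbw := bandwidth_pos m
  have hcont := hf.continuous
  set g : Sphere d → ℝ := fun x => ∫ a : Action, f ((a : ℝ) - linearPolicy wstar x)
    ∂(smooth B.toSetting (bandwidth m) (linearPolicy w x)) with hg
  have hsm : smoothedLoss B (bandwidth m) w = ∫ x, g x ∂(uniformSphere d) := by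
    refine integral_congr_ae (Filter.Eventually.of_forall fun x => ?_)
    have hprob := hreg.setting.isProbabilityMeasure_smooth hbw (linearPolicy w x)
    simp only [hg, ← hf.integral_loss]
    change ∫ z, ∫ a, loss z a ∂(smooth B.toSetting (bandwidth m) (linearPolicy w x))
      ∂(lossLaw x) = _
    exact integral_integral_swap (Integrable.of_bound
      hf.measurable_loss.aestronglyMeasurable 1 (Filter.Eventually.of_forall fun p => by
        have := hf.loss_mem p.1 p.2
        simp only [Function.uncurry, Real.norm_eq_abs]
        rw [abs_of_nonneg this.1]; exact this.2))
  have hgint : Integrable g (uniformSphere d) := by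
    have h1 : Integrable (fun p : Sphere d × Action =>
        kernelDensity B.toSetting (bandwidth m) (linearPolicy w p.1) p.2 *
          f ((p.2 : ℝ) - linearPolicy wstar p.1)) ((uniformSphere d).prod uniformAction) := by
      refine Integrable.of_bound (Measurable.aestronglyMeasurable ?_)
        (kernelSup B.toSetting (bandwidth m)) (Filter.Eventually.of_forall fun p => ?_)
      · have hp : Measurable fun p : Sphere d × Action => (linearPolicy w p.1, p.2) :=
          ((continuous_linearPolicy w).measurable.comp measurable_fst).prodMk measurable_snd
        have hk := (hreg.setting.measurable_kernelDensity (bandwidth m)).comp hp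
        have hq : Continuous fun p : Sphere d × Action =>
            f ((p.2 : ℝ) - linearPolicy wstar p.1) :=
          hcont.comp ((continuous_subtype_val.comp continuous_snd).sub
            (continuous_subtype_val.comp ((continuous_linearPolicy wstar).comp continuous_fst)))
        exact hk.mul hq.measurable
      · have h1 := hf.mem_Icc p.1 p.2
        have h2 := kernelDensity_nonneg (D := B.toSetting) (bandwidth m) (linearPolicy w p.1) p.2
        have h3 := hreg.setting.kernelDensity_le_kernelSup hbw (linearPolicy w p.1) p.2
        rw [Real.norm_eq_abs, abs_of_nonneg (mul_nonneg h2 h1.1)]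
        nlinarith [h1.1, h1.2]
    have h2 := h1.integral_prod_left
    simp only [hg, hreg.setting.integral_smooth hbw]
    exact h2
  have h0int := integrable_of_continuous_sphere (hf.continuous_comp w)
  rw [hsm, hf.smoothedLoss_zero, ← integral_sub hgint h0int]
  have hbound : ∀ x : Sphere d,
      ‖g x - f ((linearPolicy w x : ℝ) - linearPolicy wstar x)‖ ≤ radius L m := by
    intro x
    have hprob := hreg.setting.isProbabilityMeasure_smooth hbw (linearPolicy w x)
    have hfi : Integrable (fun a : Action => f ((a : ℝ) - linearPolicy wstar x))
        (smooth B.toSetting (bandwidth m) (linearPolicy w x)) := by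
      refine Integrable.of_bound (Continuous.aestronglyMeasurable ?_) 1
        (Filter.Eventually.of_forall fun a => ?_)
      · exact hcont.comp (continuous_subtype_val.sub continuous_const)
      · have := hf.mem_Icc x a
        rw [Real.norm_eq_abs, abs_of_nonneg this.1]; exact this.2
    have he : g x - f ((linearPolicy w x : ℝ) - linearPolicy wstar x) =
        ∫ a : Action, (f ((a : ℝ) - linearPolicy wstar x) -
          f ((linearPolicy w x : ℝ) - linearPolicy wstar x))
          ∂(smooth B.toSetting (bandwidth m) (linearPolicy w x)) := by
      rw [integral_sub hfi (integrable_const _)]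
      simp [hg]
    rw [he]
    have hae : ∀ᵐ a : Action ∂(smooth B.toSetting (bandwidth m) (linearPolicy w x)),
        ‖f ((a : ℝ) - linearPolicy wstar x) -
          f ((linearPolicy w x : ℝ) - linearPolicy wstar x)‖ ≤ radius L m := by
      have hkm : Measurable fun a' => ENNReal.ofReal
          (kernelDensity B.toSetting (bandwidth m) (linearPolicy w x) a') :=
        ((hreg.setting.measurable_kernelDensity (bandwidth m)).comp
          measurable_prodMk_left).ennreal_ofReal
      rw [smooth, if_neg hbw.ne', ae_withDensity_iff hkm]
      refine Filter.Eventually.of_forall fun a ha => ?_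
      have hd : dist (linearPolicy w x) a ≤ bandwidth m := by
        by_contra hd
        exact ha (by simp [kernelDensity, hd])
      rw [Subtype.dist_eq, dist_comm, Real.dist_eq] at hd
      refine (hf.lipschitz _ _).trans ?_
      rw [sub_sub_sub_cancel_right]
      exact mul_le_mul_of_nonneg_left hd (by linarith [hf.one_le])
    simpa using norm_integral_le_of_norm_le_const hae
  simpa using norm_integral_le_of_norm_le_const (μ := uniformSphere d)
    (Filter.Eventually.of_forall hbound)

theorem IsLinkFunction.isOptimalLipschitz (hf : IsLinkFunction lossLaw loss wstar L L₀ f)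
    (hW : wstar ∈ W) : IsOptimalLipschitz (sphereBandit W lossLaw loss) L wstar :=
  ⟨hW, fun w _ => hf.optimal w, fun w _ m _ => hf.abs_smoothedLoss_sub_le w m⟩

/-- Lets the additive constants in the packing and volume bounds be absorbed into multiples of √d /
L₀. -/
theorem IsLinkFunction.one_le_ratio (hf : IsLinkFunction lossLaw loss wstar L L₀ f) :
    1 ≤ Real.sqrt d / L₀ := by
  rw [one_le_div hf.pos]
  refine hf.slope_le_one.trans ?_
  rw [Real.one_le_sqrt]
  exact_mod_cast NeZero.one_le

theorem IsLinkFunction.zoomingCoeff_le (hf : IsLinkFunction lossLaw loss wstar L L₀ f)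
    (hW : wstar ∈ W) {ε : ℝ} (hε : 0 < ε) :
    zoomingCoeff (sphereBandit W lossLaw loss) L ε ≤
      ENNReal.ofReal (49 * (L / (L₀ * ε) * Real.sqrt d)) := by
  have h0 := hf.pos
  have h1 := hf.one_le
  have h2 := hf.one_le_ratio
  refine iSup_le fun ε' => iSup_le fun hε' => ?_
  have hpos : 0 < ε' := hε.trans_le hε'
  refine (ENNReal.div_le_div_right (hf.expectedPacking_le hW (by linarith : 0 ≤ 12 * L) hpos)
    _).trans ?_
  rw [← ENNReal.ofReal_div_of_pos hpos]
  refine ENNReal.ofReal_le_ofReal ?_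
  calc (1 + 4 * (12 * L) * (Real.sqrt d / L₀)) / ε'
      ≤ (49 * (L * (Real.sqrt d / L₀))) / ε' :=
        div_le_div_of_nonneg_right (by nlinarith) hpos.le
    _ ≤ (49 * (L * (Real.sqrt d / L₀))) / ε := by gcongr
    _ = _ := by field_simp

/-- The active policies lie within R = 24 L h √d / L₀ of `wstar`, so κ V ≤ (2 / h)(h + R), in which
h cancels: the bound is the same in all epochs. -/
theorem IsLinkFunction.kernelSup_mul_charVolume_le
    (hf : IsLinkFunction lossLaw loss wstar L L₀ f) {m : ℕ} {S : Finset (Sphere d)}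
    (hS : IsGood (sphereBandit W lossLaw loss) L wstar m S) :
    kernelSup (sphereBandit W lossLaw loss).toSetting (bandwidth m) *
      charVolume (sphereBandit W lossLaw loss).toSetting S (bandwidth m) ≤
      50 * (L * (Real.sqrt d / L₀)) := by
  have h0 := hf.pos
  have h1 := hf.one_le
  have h2 := hf.one_le_ratio
  have hbw := bandwidth_pos m
  have hbw1 : bandwidth m ≤ 2 := by
    unfold bandwidth
    rw [div_le_iff₀ (by positivity)]
    linarith [one_le_pow₀ (M₀ := ℝ) (n := m) (by norm_num : (1 : ℝ) ≤ 2)]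
  have hrad : radius L m = L * bandwidth m := rfl
  set R := 2 * Real.sqrt d / L₀ * (12 * radius L m) with hR
  have hR0 : 0 ≤ R := by rw [hR, hrad]; positivity
  have hdist : ∀ i ∈ S, dist i wstar ≤ R := fun i hi =>
    (hf.dist_le (W := W) i).trans
      (mul_le_mul_of_nonneg_left (by linarith [hS.le i hi]) (by positivity))
  calc _ ≤ 2 / bandwidth m * (bandwidth m + R) :=
        mul_le_mul (kernelSup_sphereBandit_le hbw hbw1)
          (charVolume_sphereBandit_le hbw.le hR0 hdist)
          (integral_nonneg fun _ => measureReal_nonneg) (by positivity)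
    _ = 2 + 48 * (L * (Real.sqrt d / L₀)) := by rw [hR, hrad]; field_simp; ring
    _ ≤ 50 * (L * (Real.sqrt d / L₀)) := by nlinarith

theorem IsLinkFunction.regret_le (hf : IsLinkFunction lossLaw loss wstar L L₀ f)
    (hW : wstar ∈ W) {Q : ℕ → Finset (Sphere d) → Sphere d → ℝ}
    (hQ : IsSolver (sphereBandit W lossLaw loss).toSetting L Q) {T : ℕ} (hT : 2 ≤ T) :
    regret (sphereBandit W lossLaw loss)
      (smoothPolicyEliminationL (sphereBandit W lossLaw loss).toSetting L T Q) T ≤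
      ((4000000 * Real.log T ^ 1 *
        Real.sqrt (T * Real.sqrt d * (L / L₀) * max 1 (Real.log (W.card : ℝ))) : ℝ) : EReal) := by
  have h0 := hf.pos
  have h1 := hf.one_le
  have hreg : (sphereBandit W lossLaw loss).IsRegular :=
    sphereBandit_isRegular hf.measurable_loss hf.loss_mem
  have : Nonempty Action := ⟨linearPolicy wstar wstar⟩
  have hmain := hreg.expectedLoss_le h1 hQ (hf.isOptimalLipschitz hW) hT (c := 50) (by norm_num)
    hf.one_le_ratio (fun w _ => hf.smoothedLoss_le_one w)
    fun m _ S hS => hf.kernelSup_mul_charVolume_le hS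
  have hδ := numBatches_le (sphereBandit W lossLaw loss).toSetting hT ⟨wstar, hW⟩
  change _ ≤ 30 * Real.log T * max 1 (Real.log (W.card : ℝ)) at hδ
  have hT' : (2 : ℝ) ≤ T := by exact_mod_cast hT
  have hlogT : 1 / 2 ≤ Real.log T := by
    have := Real.log_le_log (by norm_num) hT'
    linarith [Real.log_two_gt_d9]
  set δ : ℝ := (numBatches (sphereBandit W lossLaw loss).toSetting T : ℝ)
  set M := max 1 (Real.log (W.card : ℝ))
  have hM : 1 ≤ M := le_max_left _ _
  have hsqrt : Real.sqrt (T * (L * (Real.sqrt d / L₀)) * δ) ≤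
      8 * Real.log T * Real.sqrt (T * Real.sqrt d * (L / L₀) * M) := by
    rw [Real.sqrt_le_left (by positivity), mul_pow, Real.sq_sqrt (by positivity)]
    have e : T * Real.sqrt d * (L / L₀) * M = T * (L * (Real.sqrt d / L₀)) * M := by ring
    rw [e]
    set Y := T * (L * (Real.sqrt d / L₀)) with hY
    have hY0 : 0 ≤ Y := by positivity
    calc Y * δ ≤ Y * (30 * Real.log T * M) := mul_le_mul_of_nonneg_left hδ hY0
      _ = (30 * Real.log T) * (Y * M) := by ring
      -- As log T ≥ 1 / 2, 64 log² T ≥ 32 log T.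
      _ ≤ (8 * Real.log T) ^ 2 * (Y * M) :=
          mul_le_mul_of_nonneg_right (by nlinarith) (by positivity)
  set lam := smoothedLoss (sphereBandit W lossLaw loss) 0 wstar with hlam
  have hlam0 : 0 ≤ lam := hreg.smoothedLoss_nonneg 0 wstar
  set G := Real.sqrt (T * Real.sqrt d * (L / L₀) * M) with hG
  have hG0 : 0 ≤ G := Real.sqrt_nonneg _
  have hfin : expectedLoss (sphereBandit W lossLaw loss)
      (smoothPolicyEliminationL (sphereBandit W lossLaw loss).toSetting L T Q) T [] ≤
      ENNReal.ofReal (T * lam + 4000000 * Real.log T ^ 1 * G) := by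
    refine hmain.trans (ENNReal.ofReal_le_ofReal ?_)
    rw [pow_one]
    -- The constant is (8960 · 50 + 17) · 8 = 3584136.
    nlinarith [mul_nonneg (by linarith : 0 ≤ Real.log T) hG0]
  have hnn : 0 ≤ T * lam + 4000000 * Real.log T ^ 1 * G := by
    have : 0 ≤ Real.log T := by linarith
    positivity
  rw [regret, hf.bench_eq hW, ← hlam]
  refine (EReal.sub_le_sub (EReal.coe_ennreal_le_coe_ennreal_iff.2 hfin) le_rfl).trans ?_
  rw [EReal.coe_ennreal_ofReal, max_eq_left hnn, ← EReal.coe_sub]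
  exact EReal.coe_le_coe_iff.2 (by linarith)

end SphereBandit

end SmoothedBandit

end

/-! ### The proposition -/

theorem mainTheorem11 :
    ∃ (C : ℝ) (p : ℕ), 0 < C ∧
      ∀ (d : ℕ) (L L₀ : ℝ) (f : ℝ → ℝ) (W : Finset (Sphere d)) (wstar : Sphere d)
        (Z : Type*) [MeasurableSpace Z] (lossLaw : Kernel (Sphere d) Z) [IsMarkovKernel lossLaw]
        (loss : Z → Action → ℝ),
        1 ≤ L → 0 < L₀ →
        (∀ z z' : ℝ, |f z - f z'| ≤ L * |z - z'|) →
        (∀ z : ℝ, L₀ * |z| ≤ f z - f 0) →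
        wstar ∈ W →
        Measurable (Function.uncurry loss) →
        (∀ z a, loss z a ∈ Set.Icc (0 : ℝ) 1) →
        (∀ (x : Sphere d) (a : Action),
          ∫ z, loss z a ∂(lossLaw x) = f ((a : ℝ) - (linearPolicy wstar x : ℝ))) →
        (∀ ε : ℝ, 0 < ε →
          expectedPacking (sphereBandit W lossLaw loss) 0 (L * ε) ε ≤
            ENNReal.ofReal (C * (L / L₀ * Real.sqrt d))) ∧
        (∀ ε : ℝ, 0 < ε →
          zoomingCoeff (sphereBandit W lossLaw loss) L ε ≤
            ENNReal.ofReal (C * (L / (L₀ * ε) * Real.sqrt d))) ∧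
        (∃ Q : ℕ → Finset (Sphere d) → Sphere d → ℝ,
          IsSolver (sphereBandit W lossLaw loss).toSetting L Q) ∧
        (∀ Q : ℕ → Finset (Sphere d) → Sphere d → ℝ,
          IsSolver (sphereBandit W lossLaw loss).toSetting L Q →
          ∀ T : ℕ, 2 ≤ T →
            regret (sphereBandit W lossLaw loss)
                (smoothPolicyEliminationL (sphereBandit W lossLaw loss).toSetting L T Q) T ≤
              ((C * Real.log T ^ p *
                Real.sqrt (T * Real.sqrt d * (L / L₀) * max 1 (Real.log (W.card : ℝ))) : ℝ) :
                EReal)) := by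
  refine ⟨4000000, 1, by norm_num, ?_⟩
  intro d L L₀ f W wstar Z _ lossLaw _ loss hL hL₀ hlip hgrow hW hmeas hmem hint
  -- The sphere is empty in dimension 0, so the presence of `wstar` yields d ≥ 1.
  have : NeZero d := neZero_of_sphere wstar
  have hf : IsLinkFunction lossLaw loss wstar L L₀ f :=
    ⟨hL, hL₀, hlip, hgrow, hmeas, hmem, hint⟩
  have hratio := hf.one_le_ratio
  refine ⟨fun ε hε => ?_, fun ε hε => ?_, ?_, fun Q hQ T hT => hf.regret_le hW hQ hT⟩
  · refine (hf.expectedPacking_le hW (by linarith) hε).trans (ENNReal.ofReal_le_ofReal ?_)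
    have e : L / L₀ * Real.sqrt d = L * (Real.sqrt d / L₀) := by ring
    rw [e]
    nlinarith
  · refine (hf.zoomingCoeff_le hW hε).trans (ENNReal.ofReal_le_ofReal ?_)
    have : 0 ≤ L / (L₀ * ε) * Real.sqrt d := by positivity
    linarith
  · exact (sphereBandit_isRegular hmeas hmem).setting.exists_isSolver (by linarith)
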